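/- Let $d\ge 5$ and let $p:\mathbb Z^d\times\mathbb Z^d\to[0,1]$ be a random walk transition kernel: $\sum_{y}p(x,y)=1$ for all $x$, $p(x,y)=p(0,y-x)$ for all $x,y$, and $\{x: p(0,x)>0\}$ generates the group $\mathbb Z^d$. Put $p^*(x,y)=p(y,x)$. For a map $\psi:\mathbb R\to\mathbb Z^d$ and a finite set $S\subset\mathbb R$, consider coalescing random walks with transition kernel $p^*$ and step rate $1$, one released from the site $\psi(s)$ at time $s$ for each $s\in S$: the walks move independently until two of them are at the same site, from which time on they coincide. Let $\mathcal N^{\rm coal}_\infty\{(\psi(s),s): s\in S\}$ be the number of walks that coalesce eventually, i.e. the limit as $t\to\infty$ of $|S|$ minus the number of sites occupied by the walks at time $t$, and let $\mathbb E^*$ denote expectation with respect to the coalescing random walks. Call a collection of subsets $S_1,\dots,S_N$ of $\mathbb R$ ordered if $s<t$ for all $s\in S_i$, $t\in S_j$ and $i<j$, and let $d(S_j,S_k)=\inf\{|s-t|: s\in S_j,\,t\in S_k\}$. Then there exist $\delta:(0,\infty)\to(0,\infty)$ with $\lim_{K\to\infty}\delta(K)=0$ and, for each $\epsilon\in(0,(d-4)/2)$,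 a constant $C_\epsilon>0$ such that the following holds. For all $\rho\in(0,1)$, all $\psi:\mathbb R\to\mathbb Z^d$, all ordered collections of disjoint finite subsets $S_1,\dots,S_N$ of $\mathbb R$, all $\epsilon\in(0,(d-4)/2)$, $K>0$ and $r,r'>1$ with $1/r+1/r'=1$, $$\mathbb E^*\Bigl(\rho^{-\mathcal N^{\rm coal}_\infty\{(\psi(s),s):\,s\in\bigcup_{j=1}^N S_j\}}\Bigr)\le \exp\Bigl[\frac{\delta(K)}{\rho}\sum_{j=1}^N|S_j|+C_\epsilon K\,\frac{\rho^{-r'}-1}{r'}\sum_{1\le j<k\le N}\frac{|S_j||S_k|}{d(S_j,S_k)^{1+\epsilon}}\Bigr]\times\Bigl[\prod_{j=1}^N\mathbb E^*\Bigl(\rho^{-r\,\mathcal N^{\rm coal}_\infty\{(\psi(s),s):\,s\in S_j\}}\Bigr)\Bigr]^{1/r}.$$ (The expectation on the left is well defined, the random variable being bounded; terms with an empty $S_j$ or $S_k$ in the double sum are $0$.) -/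

import Mathlib

open MeasureTheory ProbabilityTheory Filter Topology

noncomputable section

namespace CoalescingRW

/-- The lattice `ℤ^d`. -/
abbrev Site (d : ℕ) : Type := Fin d → ℤ

/-- A translation-invariant random walk transition kernel on `ℤ^d` whose step distribution
generates `ℤ^d`. -/
structure WalkKernel (d : ℕ) where
  /-- The transition probabilities. -/
  p : Site d → Site d → ℝ
  nonneg : ∀ x y, 0 ≤ p x y
  hasSum_one : ∀ x, HasSum (fun y => p x y) 1
  translation : ∀ x y, p x y = p 0 (y - x)
  generates : AddSubgroup.closure {x : Site d | 0 < p 0 x} = ⊤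

variable {d : ℕ}

/-- The dual kernel `p*(x, y) = p(y, x)`. -/
def WalkKernel.dual (P : WalkKernel d) (x y : Site d) : ℝ := P.p y x

/-- The law of one step of a random walk with transition kernel `p*`: the step equals `z` with
probability `p*(0, z)`. -/
def dualStepLaw (P : WalkKernel d) : Measure (Site d) :=
  Measure.sum fun z => ENNReal.ofReal (P.dual 0 z) • Measure.dirac z

instance (P : WalkKernel d) : IsProbabilityMeasure (dualStepLaw P) := by
  have h1 : HasSum (fun z => P.dual 0 z) 1 := by
    have h := (Equiv.neg (Site d)).hasSum_iff.mpr (P.hasSum_one 0)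
    convert h using 1
    funext z
    simp [WalkKernel.dual, P.translation z 0]
  refine ⟨?_⟩
  rw [dualStepLaw, Measure.sum_apply _ MeasurableSet.univ]
  simp only [Measure.smul_apply, measure_univ, smul_eq_mul, mul_one]
  rw [← ENNReal.ofReal_tsum_of_nonneg (f := fun z => P.dual 0 z) (fun z => P.nonneg z 0) h1.summable, h1.tsum_eq,
    ENNReal.ofReal_one]

/-- The randomness that drives one walk: a sequence of (holding time, step) pairs. -/
abbrev Noise (d : ℕ) : Type := ℕ → ℝ × Site d

/-- The law of the randomness of one walk: independent mean-one exponential holding times, and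
independent steps with the dual step law. -/
def noiseLaw (P : WalkKernel d) : Measure (Noise d) :=
  Measure.infinitePi fun _ : ℕ => (expMeasure 1).prod (dualStepLaw P)

instance (P : WalkKernel d) : IsProbabilityMeasure (noiseLaw P) := by
  have := isProbabilityMeasure_expMeasure one_pos
  unfold noiseLaw
  infer_instance

/-- `ℙ*`: independent copies of the randomness of a walk, one for every release time `u ∈ ℝ`. -/
def law (P : WalkKernel d) : Measure (ℝ → Noise d) :=
  Measure.infinitePi fun _ : ℝ => noiseLaw P

instance (P : WalkKernel d) : IsProbabilityMeasure (law P) := by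
  unfold law
  infer_instance

/-- The number of jumps made by a walk within time `t` after its release. -/
def jumpCount (w : Noise d) (t : ℝ) : ℕ :=
  Set.ncard {n : ℕ | ∑ i ∈ Finset.range (n + 1), (w i).1 ≤ t}

/-- `Y^u(t)`: the position at time `t` of the walk with transition kernel `p*` and step rate `1`
that is released from the site `ψ u` at time `u`. These walks, `u ∈ ℝ`, are independent
under `law P`. -/
def walk (ψ : ℝ → Site d) (ω : ℝ → Noise d) (u t : ℝ) : Site d :=
  ψ u + ∑ i ∈ Finset.range (jumpCount (ω u) (t - u)), (ω u i).2

open scoped Classical in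
/-- In the system of coalescing random walks released along `ψ` at the times in `S`, the walk
released at time `u` has been absorbed by time `t`. The system is built recursively from the
independent walks: when two living walks meet, the one released earlier is absorbed
by the one released later. Thus `u` has been absorbed by time `t` if at some time `s ≤ t` the walk
released at `u` is at the same site as a walk that was released at a time `v ∈ (u, s]`
and that has not been absorbed itself by time `s`. -/
def Absorbed (ψ : ℝ → Site d) (S : Finset ℝ) (ω : ℝ → Noise d) (u t : ℝ) : Prop :=
  ∃ s, s ≤ t ∧ ∃ v, ∃ _ : v ∈ S, ∃ _ : u < v, v ≤ s ∧
    walk ψ ω u s = walk ψ ω v s ∧ ¬ Absorbed ψ S ω v s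
termination_by (S.filter fun v => u < v).card
decreasing_by
  apply Finset.card_lt_card
  rw [Finset.ssubset_iff_of_subset]
  · exact ⟨v, by simp [*], by simp⟩
  · intro x hx
    simp only [Finset.mem_filter] at hx ⊢
    exact ⟨hx.1, lt_trans ‹u < v› hx.2⟩

open scoped Classical in
/-- `ξ*_t{(ψ(s), s) : s ∈ S}`: the set of locations at time `t` of the coalescing random walks. -/
def locations (ψ : ℝ → Site d) (S : Finset ℝ) (ω : ℝ → Noise d) (t : ℝ) : Finset (Site d) :=
  (S.filter fun u => u ≤ t ∧ ¬ Absorbed ψ S ω u t).image fun u => walk ψ ω u t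

open scoped Classical in
/-- `N^coal_∞{(ψ(s), s) : s ∈ S}`: the number of walks that coalesce eventually. -/
def numCoal (ψ : ℝ → Site d) (S : Finset ℝ) (ω : ℝ → Noise d) : ℕ :=
  (S.filter fun u => ∃ t, Absorbed ψ S ω u t).card

lemma Absorbed.mono {ψ : ℝ → Site d} {S : Finset ℝ} {ω : ℝ → Noise d} {u t t' : ℝ}
    (h : Absorbed ψ S ω u t) (ht : t ≤ t') : Absorbed ψ S ω u t' := by
  rw [Absorbed] at h ⊢
  obtain ⟨s, hs, h⟩ := h
  exact ⟨s, hs.trans ht, h⟩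

/-- `numCoal` is the limit as `t → ∞` of the number of released walks minus the number of
locations occupied at time `t`. -/
lemma eventually_card_sub_card_locations (ψ : ℝ → Site d) (S : Finset ℝ) (ω : ℝ → Noise d) :
    ∀ᶠ t in atTop, S.card - (locations ψ S ω t).card = numCoal ψ S ω := by
  classical
  have h1 : ∀ᶠ t in atTop, ∀ u ∈ S, u ≤ t :=
    (Filter.eventually_all_finset S).2 fun u _ => eventually_ge_atTop u
  have h2 : ∀ᶠ t in atTop, ∀ u ∈ S, (∃ t', Absorbed ψ S ω u t') → Absorbed ψ S ω u t := by
    refine (Filter.eventually_all_finset S).2 fun u _ => ?_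
    by_cases h : ∃ t', Absorbed ψ S ω u t'
    · obtain ⟨t', ht'⟩ := h
      filter_upwards [eventually_ge_atTop t'] with t ht _
      exact ht'.mono ht
    · exact Eventually.of_forall fun t h' => absurd h' h
  filter_upwards [h1, h2] with t h1 h2
  have hne : ∀ u ∈ S, ∀ v ∈ S, u < v → ¬ Absorbed ψ S ω u t → ¬ Absorbed ψ S ω v t →
      walk ψ ω u t ≠ walk ψ ω v t := by
    intro u _ v hv huv hu hva he
    apply hu
    rw [Absorbed]
    exact ⟨t, le_rfl, v, hv, huv, h1 v hv, he, hva⟩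
  have hcard : (locations ψ S ω t).card
      = (S.filter fun u => ¬ ∃ t', Absorbed ψ S ω u t').card := by
    rw [locations, Finset.card_image_of_injOn]
    · congr 1
      ext u
      simp only [Finset.mem_filter]
      constructor
      · rintro ⟨hu, -, h⟩
        exact ⟨hu, fun h' => h (h2 u hu h')⟩
      · rintro ⟨hu, h⟩
        exact ⟨hu, h1 u hu, fun h' => h ⟨t, h'⟩⟩
    · intro u hu v hv he
      simp only [Finset.coe_filter, Set.mem_ofPred_eq] at hu hv
      rcases lt_trichotomy u v with h | h | h
      · exact absurd he (hne u hu.1 v hv.1 h hu.2.2 hv.2.2)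
      · exact h
      · exact absurd he.symm (hne v hv.1 u hu.1 h hv.2.2 hu.2.2)
  have := S.card_filter_add_card_filter_not (fun u => ∃ t', Absorbed ψ S ω u t')
  rw [hcard, numCoal]
  omega

/-- The distance between two finite sets of times. -/
def blockDist (A B : Finset ℝ) : ℝ := sInf (Set.image2 dist (A : Set ℝ) (B : Set ℝ))

end CoalescingRW

end

/-! The number of coalescences is computed by sequential absorption. The walks are run one after the
other, the latest released first. Each is stopped when it enters the obstacle set formed by the
surviving pieces of the walks already run, and its own surviving piece is added to that set.
Counting stopped walks gives `numCoal` almost surely (`ae_numCoal_eq`), so its generating function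
is `gen` with no initial obstacle (`lintegral_pow_hits`). Paths are recorded at rational times only:
space-time becomes countable and measurability is routine. Nothing is lost, because two
right-continuous step paths that meet share their site for a positive time.

The order in which walks are run is irrelevant in law. By the strong Markov property
(`lintegral_graph_splice`) the path after the first meeting may be resampled, and it then does not
matter which of the two walks carries the continuation (`run_swap`). Hence one more walk multiplies
`gen` by a factor between 1 and `y` (`le_gen_cons`, `gen_cons_le`), and killing walks at a set can
only lower `gen` (`lintegral_kill_le`).

Decoupling (`run_union_le`): let the latest block run against the obstacles `O` left by later
blocks, and let the earlier blocks enter through a terminal functional bounded by a constant times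
`ex (X A)`, with `X` subadditive and monotone. A three-factor Hölder inequality, applied walk by
walk, separates coalescence inside the block, visits to `O`, and the factor `ex (X (graph a w))`.
With `X` a multiple of `hitSum`, the expected number of independent earlier walks that visit a set,
the bound reproduces itself from block to block (`gen_pref_le`).

The random walk input is the heat kernel bound `exists_visit_le`: a given site is visited in a given
unit interval at age `t` with probability of order `(t + 1) ^ (-d / 2)`. As `2 + ε < d / 2`, the
expected number of earlier walks met by a walk is at most a weighted sum of the numbers of sites it
visits in successive unit intervals. Jensen's inequality gives exponential moments as long as the
total weight is at most 1 (`exists_lintegral_ex_hitSum_le`).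

For the parameters (`exists_gen_pref_le`), put `x = -log ρ` and `Lc = K ^ (1/4) / 2`, and take `δ K
= 1 / Lc`. If `Lc ≤ x` or `Lc ≤ 1`, the crude bound `x` per walk suffices. Otherwise each walk of
block `j` has a price `Q j`: if `Q j ≥ x` the block is simply dropped, and if `Q j < x` the
interaction with the past is weak enough for the exponential moment bound. -/

open scoped ENNReal

noncomputable section

namespace CoalescingRW

variable {d : ℕ}

/-! ### Resampling coordinates of product measures -/

/-- The sequence that follows `w` for the first `k` entries and then runs through `w'`. -/
def join {E : Type*} (k : ℕ) (w w' : ℕ → E) : ℕ → E := fun i => if i < k then w i else w' (i - k)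

lemma measurable_join {E : Type*} [MeasurableSpace E] (k : ℕ) :
    Measurable (fun q : (ℕ → E) × (ℕ → E) => join k q.1 q.2) := by
  refine measurable_pi_iff.2 fun i => ?_
  unfold join
  split_ifs <;> fun_prop

/-- A cylinder event pulls back to a rectangle: its coordinates below `k` constrain the first
sequence, the others, shifted by `k`, the second. Resampling everything after the first `k` jumps
rests on this. -/
lemma measurePreserving_join {E : Type*} [MeasurableSpace E] (μ : Measure E)
    [IsProbabilityMeasure μ] (k : ℕ) :
    MeasurePreserving (fun q : (ℕ → E) × (ℕ → E) => join k q.1 q.2)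
      ((Measure.infinitePi fun _ : ℕ => μ).prod (Measure.infinitePi fun _ : ℕ => μ))
      (Measure.infinitePi fun _ : ℕ => μ) := by
  refine ⟨measurable_join k, Measure.eq_infinitePi _ fun s t ht => ?_⟩
  rw [Measure.map_apply (measurable_join k) (.pi s.countable_toSet fun _ _ => ht _)]
  have : (fun q : (ℕ → E) × (ℕ → E) => join k q.1 q.2) ⁻¹' ((s : Set ℕ).pi t) =
      ((s.filter (· < k) : Finset ℕ) : Set ℕ).pi t ×ˢ
      ((((s.filter (¬ · < k)).image (· - k) : Finset ℕ)) : Set ℕ).pi (fun i => t (i + k)) := by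
    ext ⟨w, w'⟩
    simp only [Set.mem_preimage, Set.mem_pi, Finset.mem_coe, join, Set.mem_prod, Finset.mem_filter,
      Finset.mem_image]
    constructor
    · intro h
      refine ⟨fun i hi => by simpa [hi.2] using h i hi.1, ?_⟩
      rintro _ ⟨i, hi, rfl⟩
      have := h i hi.1
      rw [if_neg hi.2] at this
      rwa [Nat.sub_add_cancel (not_lt.1 hi.2)]
    · rintro ⟨h1, h2⟩ i hi
      split_ifs with hk
      · exact h1 i ⟨hi, hk⟩
      · have := h2 (i - k) ⟨i, ⟨hi, hk⟩, rfl⟩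
        rwa [Nat.sub_add_cancel (not_lt.1 hk)] at this
  rw [this, Measure.prod_prod, Measure.infinitePi_pi _ (fun i _ => ht i),
    Measure.infinitePi_pi _ (fun i _ => ht _), Finset.prod_image,
    ← Finset.prod_filter_mul_prod_filter_not s (· < k)]
  · congr 1
    refine Finset.prod_congr rfl fun i hi => ?_
    rw [Nat.sub_add_cancel (not_lt.1 (Finset.mem_filter.1 hi).2)]
  · intro i hi j hj h
    simp at hi hj h
    omega

/-- Independence in the form used to integrate out the noise of a single walk. -/
lemma measurePreserving_update {ι E : Type*} [DecidableEq ι] [MeasurableSpace E] (μ : Measure E)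
    [IsProbabilityMeasure μ] (u : ι) :
    MeasurePreserving (fun q : (ι → E) × E => Function.update q.1 u q.2)
      ((Measure.infinitePi fun _ : ι => μ).prod μ) (Measure.infinitePi fun _ : ι => μ) := by
  have hm : Measurable (fun q : (ι → E) × E => Function.update q.1 u q.2) := by
    refine measurable_pi_iff.2 fun i => ?_
    by_cases h : i = u
    · subst h; simpa using measurable_snd
    · simp only [Function.update_of_ne h]; fun_prop
  refine ⟨hm, Measure.eq_infinitePi _ fun s t ht => ?_⟩
  rw [Measure.map_apply hm (.pi s.countable_toSet fun _ _ => ht _)]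
  have : (fun q : (ι → E) × E => Function.update q.1 u q.2) ⁻¹' ((s : Set ι).pi t) =
      ((s.erase u : Finset ι) : Set ι).pi t ×ˢ (if u ∈ s then t u else Set.univ) := by
    ext ⟨w, x⟩
    simp only [Set.mem_preimage, Set.mem_pi, Finset.mem_coe, Set.mem_prod, Finset.mem_erase]
    constructor
    · intro h
      refine ⟨fun i hi => by simpa [hi.1] using h i hi.2, ?_⟩
      split_ifs with hu
      · simpa using h u hu
      · trivial
    · rintro ⟨h1, h2⟩ i hi
      by_cases hu : i = u
      · subst hu; simpa [hi] using h2
      · simpa [hu] using h1 i ⟨hu, hi⟩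
  rw [this, Measure.prod_prod, Measure.infinitePi_pi _ (fun i _ => ht i)]
  split_ifs with hu
  · rw [Finset.prod_erase_mul _ _ hu]
  · rw [measure_univ, mul_one, Finset.erase_eq_of_notMem hu]

/-! ### The exponential law -/

instance : IsProbabilityMeasure (expMeasure 1) := isProbabilityMeasure_expMeasure one_pos

lemma lintegral_expMeasure {f : ℝ → ℝ≥0∞} (hf : Measurable f) :
    ∫⁻ h, f h ∂(expMeasure 1) = ∫⁻ h in Set.Ici 0, ENNReal.ofReal (Real.exp (-h)) * f h := by
  rw [expMeasure, gammaMeasure, lintegral_withDensity_eq_lintegral_mul _ _ hf]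
  · rw [← lintegral_indicator measurableSet_Ici]
    refine lintegral_congr fun h => ?_
    simp only [Pi.mul_apply, Set.indicator, Set.mem_Ici]
    have : gammaPDF 1 1 h = ENNReal.ofReal (if 0 ≤ h then 1 * Real.exp (-(1 * h)) else 0) :=
      exponentialPDF_eq 1 h
    rw [this]
    split_ifs <;> simp
  · exact (measurable_gammaPDFReal 1 1).ennreal_ofReal

/-- Memorylessness, by translating the density `exp (-h)` by `c`. -/
lemma lintegral_expMeasure_gt {f : ℝ → ℝ≥0∞} (hf : Measurable f) {c : ℝ} (hc : 0 ≤ c) :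
    ∫⁻ h, (Set.Ioi c).indicator f h ∂(expMeasure 1)
      = ENNReal.ofReal (Real.exp (-c)) * ∫⁻ h, f (h + c) ∂(expMeasure 1) := by
  rw [lintegral_expMeasure (hf.indicator measurableSet_Ioi),
    lintegral_expMeasure (f := fun h => f (h + c)) (hf.comp (measurable_add_const c)),
    ← lintegral_const_mul' _ _ ENNReal.ofReal_ne_top, ← lintegral_indicator measurableSet_Ici,
    ← lintegral_indicator measurableSet_Ici, ← lintegral_add_right_eq_self _ c]
  -- The half-lines are closed on one side and open on the other; they differ at one point, a null
  -- set.
  have h0 : ∀ᵐ h : ℝ, h ≠ 0 := by simp [ae_iff]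
  refine lintegral_congr_ae ?_
  filter_upwards [h0] with h hh
  simp only [Set.indicator, Set.mem_Ici, Set.mem_Ioi, ← mul_assoc, ← ENNReal.ofReal_mul (Real.exp_nonneg _), ← Real.exp_add]
  rcases lt_or_gt_of_ne hh with h1 | h1
  · rw [if_neg (not_le.2 h1), if_neg (show ¬ c < h + c by linarith)]; simp
  · rw [if_pos h1.le, if_pos (show c < h + c by linarith), if_pos (show 0 ≤ h + c by linarith)]
    simp

lemma expMeasure_Ioi_le (c : ℝ) : expMeasure 1 (Set.Ioi c) ≤ ENNReal.ofReal (Real.exp (-c)) := by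
  rcases le_total 0 c with hc | hc
  · have := lintegral_expMeasure_gt (f := fun _ => 1) measurable_const hc
    rw [lintegral_indicator measurableSet_Ioi] at this
    simp at this
    exact this.le
  · refine prob_le_one.trans ?_
    rw [ENNReal.one_le_ofReal]
    exact Real.one_le_exp (by linarith)

lemma expMeasure_Ioi {c : ℝ} (hc : 0 ≤ c) :
    expMeasure 1 (Set.Ioi c) = ENNReal.ofReal (Real.exp (-c)) := by
  have := lintegral_expMeasure_gt (f := fun _ => 1) measurable_const hc
  rw [lintegral_indicator measurableSet_Ioi] at this
  simpa using this

/-! ### Surgery on the noise of one walk -/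

/-- Delay the first jump by `c`. -/
def delay (c : ℝ) (w : Noise d) : Noise d := Function.update w 0 ((w 0).1 + c, (w 0).2)

lemma measurable_delay : Measurable (fun q : ℝ × Noise d => delay q.1 q.2) := by
  refine measurable_pi_iff.2 fun i => ?_
  unfold delay
  by_cases h : i = 0
  · subst h; simp only [Function.update_self]; fun_prop
  · simp only [Function.update_of_ne h]; fun_prop

lemma lintegral_noise_join (P : WalkKernel d) (k : ℕ) {f : Noise d → ℝ≥0∞} (hf : Measurable f) :
    ∫⁻ w, f w ∂(noiseLaw P) = ∫⁻ w, ∫⁻ w', f (join k w w') ∂(noiseLaw P) ∂(noiseLaw P) := by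
  have h := measurePreserving_join ((expMeasure 1).prod (dualStepLaw P)) k
  rw [← lintegral_prod (fun q : Noise d × Noise d => f (join k q.1 q.2)) (hf.comp (measurable_join k)).aemeasurable]
  exact (h.lintegral_comp hf).symm

lemma lintegral_noise_zero (P : WalkKernel d) {f : ℝ × Site d → ℝ≥0∞} (hf : Measurable f) (i : ℕ) :
    ∫⁻ w, f (w i) ∂(noiseLaw P) = ∫⁻ h, ∫⁻ z, f (h, z) ∂(dualStepLaw P) ∂(expMeasure 1) := by
  have h := measurePreserving_eval_infinitePi (fun _ : ℕ => (expMeasure 1).prod (dualStepLaw P)) i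
  rw [← lintegral_prod f hf.aemeasurable]
  exact h.lintegral_comp hf

/-- The sequence starting with `p` and continuing with `w`. -/
def cons (p : ℝ × Site d) (w : Noise d) : Noise d := join 1 (fun _ => p) w

@[simp] lemma cons_zero (p : ℝ × Site d) (w : Noise d) : cons p w 0 = p := by simp [cons, join]
@[simp] lemma cons_succ (p : ℝ × Site d) (w : Noise d) (i : ℕ) : cons p w (i + 1) = w i := by
  simp [cons, join]

lemma measurable_cons : Measurable (fun q : (ℝ × Site d) × Noise d => cons q.1 q.2) := by
  exact (measurable_join 1).comp
    ((measurable_pi_iff.2 fun _ => measurable_fst).prodMk measurable_snd)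

lemma lintegral_noise_cons (P : WalkKernel d) {f : Noise d → ℝ≥0∞} (hf : Measurable f) :
    ∫⁻ w, f w ∂(noiseLaw P) = ∫⁻ h, ∫⁻ z, ∫⁻ w, f (cons (h, z) w)
      ∂(noiseLaw P) ∂(dualStepLaw P) ∂(expMeasure 1) := by
  rw [lintegral_noise_join P 1 hf, ← lintegral_noise_zero P
    (f := fun p => ∫⁻ w, f (cons p w) ∂(noiseLaw P)) _ 0]
  · refine lintegral_congr fun w => lintegral_congr fun w' => ?_
    congr 1
    ext1 i
    rcases i with _ | i <;> simp [cons, join]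
  · exact (hf.comp measurable_cons).lintegral_prod_right'

/-- Memorylessness: conditioned on being longer than `c`, the first holding time is delayed by
`c`. -/
lemma lintegral_noise_gt (P : WalkKernel d) {f : Noise d → ℝ≥0∞} (hf : Measurable f) {c : ℝ}
    (hc : 0 ≤ c) :
    ∫⁻ w, {w : Noise d | c < (w 0).1}.indicator f w ∂(noiseLaw P)
      = ENNReal.ofReal (Real.exp (-c)) * ∫⁻ w, f (delay c w) ∂(noiseLaw P) := by
  have hm : MeasurableSet {w : Noise d | c < (w 0).1} :=
    measurableSet_lt measurable_const (by fun_prop)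
  have hd : Measurable (fun w : Noise d => f (delay c w)) :=
    hf.comp (measurable_delay.comp (measurable_const.prodMk measurable_id))
  rw [lintegral_noise_cons P (hf.indicator hm), lintegral_noise_cons P hd]
  have hg : Measurable fun h : ℝ => ∫⁻ z, ∫⁻ w, f (cons (h, z) w) ∂(noiseLaw P) ∂(dualStepLaw P) := by
    have h1 : Measurable fun p : ℝ × Site d => ∫⁻ w, f (cons p w) ∂(noiseLaw P) :=
      (hf.comp measurable_cons).lintegral_prod_right'
    exact h1.lintegral_prod_right'
  have := lintegral_expMeasure_gt hg hc
  convert this using 1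
  · refine lintegral_congr fun h => ?_
    by_cases hh : c < h <;> simp [Set.indicator, hh]
  · congr 1
    refine lintegral_congr fun h => lintegral_congr fun z => lintegral_congr fun w => ?_
    congr 1
    ext1 i
    rcases i with _ | i <;> simp [delay]

lemma noise_zero_gt (P : WalkKernel d) {c : ℝ} (hc : 0 ≤ c) :
    noiseLaw P {w : Noise d | c < (w 0).1} = ENNReal.ofReal (Real.exp (-c)) := by
  have hm : MeasurableSet {w : Noise d | c < (w 0).1} :=
    measurableSet_lt measurable_const (by fun_prop)
  have := lintegral_noise_gt P (f := fun _ => 1) measurable_const hc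
  rw [lintegral_indicator hm] at this
  simpa using this

/-- Strong Markov property at a time during the `k`-th holding period. -/
lemma lintegral_noise_markov (P : WalkKernel d) (k : ℕ) {f : Noise d → ℝ≥0∞} (hf : Measurable f)
    {F : Set (Noise d)} (hF : MeasurableSet F) {c : Noise d → ℝ} (hc : Measurable c)
    (hFk : ∀ w w', join k w w' ∈ F ↔ w ∈ F) (hck : ∀ w w', c (join k w w') = c w)
    (hc0 : ∀ w ∈ F, 0 ≤ c w) :
    ∫⁻ w, {w | w ∈ F ∧ c w < (w k).1}.indicator f w ∂(noiseLaw P)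
      = ∫⁻ w, {w | w ∈ F ∧ c w < (w k).1}.indicator
          (fun w => ∫⁻ w', f (join k w (delay (c w) w')) ∂(noiseLaw P)) w ∂(noiseLaw P) := by
  have hG : MeasurableSet {w : Noise d | w ∈ F ∧ c w < (w k).1} :=
    hF.inter (measurableSet_lt hc (by fun_prop))
  have hf2 : Measurable fun q : Noise d × Noise d => f (join k q.1 (delay (c q.1) q.2)) :=
    hf.comp ((measurable_join k).comp (measurable_fst.prodMk
      (measurable_delay.comp ((hc.comp measurable_fst).prodMk measurable_snd))))
  have key : ∀ w w' : Noise d, join k w w' ∈ {w : Noise d | w ∈ F ∧ c w < (w k).1} ↔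
      (w ∈ F ∧ c w < (w' 0).1) := by
    intro w w'
    simp only [Set.mem_ofPred_eq, hFk, hck]
    simp [join]
  rw [lintegral_noise_join P k (hf.indicator hG),
    lintegral_noise_join P k (hf2.lintegral_prod_right'.indicator hG)]
  refine lintegral_congr fun w => ?_
  by_cases hw : w ∈ F
  · have h1 := lintegral_noise_gt P (f := fun w' => f (join k w w'))
      (hf.comp ((measurable_join k).comp (measurable_const.prodMk measurable_id))) (hc0 w hw)
    have e1 : ∀ w' : Noise d, {w : Noise d | w ∈ F ∧ c w < (w k).1}.indicator f (join k w w') =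
        {w' : Noise d | c w < (w' 0).1}.indicator (fun w' => f (join k w w')) w' := by
      intro w'
      by_cases hh : c w < (w' 0).1
      · rw [Set.indicator_of_mem ((key w w').2 ⟨hw, hh⟩), Set.indicator_of_mem (by exact hh)]
      · rw [Set.indicator_of_notMem (fun h => hh ((key w w').1 h).2),
          Set.indicator_of_notMem (by exact hh)]
    simp_rw [e1]
    rw [h1]
    have e2 : ∀ w' : Noise d, {w : Noise d | w ∈ F ∧ c w < (w k).1}.indicator
          (fun w => ∫⁻ w', f (join k w (delay (c w) w')) ∂(noiseLaw P)) (join k w w') =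
        {w' : Noise d | c w < (w' 0).1}.indicator
          (fun _ => ∫⁻ w', f (join k w (delay (c w) w')) ∂(noiseLaw P)) w' := by
      intro w'
      -- The resampled integrand sees only the first `k` pairs, hence is constant in `w'`; both
      -- sides then give the probability that the holding time exceeds `c w`.
      have : ∀ w'' : Noise d, join k (join k w w') w'' = join k w w'' := by
        intro w''; ext1 i; unfold join; split_ifs <;> rfl
      by_cases hh : c w < (w' 0).1
      · rw [Set.indicator_of_mem ((key w w').2 ⟨hw, hh⟩), Set.indicator_of_mem (by exact hh)]
        simp only [hck, this]
      · rw [Set.indicator_of_notMem (fun h => hh ((key w w').1 h).2),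
          Set.indicator_of_notMem (by exact hh)]
    simp_rw [e2]
    rw [lintegral_indicator (measurableSet_lt measurable_const (by fun_prop)), setLIntegral_const, noise_zero_gt P (hc0 w hw), mul_comm]
  · have e : ∀ (g : Noise d → ℝ≥0∞) (w' : Noise d),
        {w : Noise d | w ∈ F ∧ c w < (w k).1}.indicator g (join k w w') = 0 := by
      intro g w'
      rw [Set.indicator_of_notMem]
      rw [key]; tauto
    simp [e]

lemma indicator_one_congr {α β : Type*} {s : Set α} {t : Set β} {x : α} {y : β}
    (h : x ∈ s ↔ y ∈ t) : s.indicator (1 : α → ℝ≥0∞) x = t.indicator 1 y := by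
  by_cases hx : x ∈ s
  · rw [Set.indicator_of_mem hx, Set.indicator_of_mem (h.1 hx)]; rfl
  · rw [Set.indicator_of_notMem hx, Set.indicator_of_notMem (fun hy => hx (h.2 hy))]

/-! ### Jump times and embedded chain -/

/-- The time of the `k`-th jump, measured from the release. -/
def arrival (w : Noise d) (k : ℕ) : ℝ := ∑ i ∈ Finset.range k, (w i).1

/-- The displacement after `k` jumps. -/
def position (w : Noise d) (k : ℕ) : Site d := ∑ i ∈ Finset.range k, (w i).2

@[simp] lemma arrival_zero (w : Noise d) : arrival w 0 = 0 := by simp [arrival]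
@[simp] lemma position_zero (w : Noise d) : position w 0 = 0 := by simp [position]
lemma arrival_succ (w : Noise d) (k : ℕ) : arrival w (k + 1) = arrival w k + (w k).1 := by
  simp [arrival, Finset.sum_range_succ]

@[fun_prop] lemma measurable_arrival (k : ℕ) : Measurable (fun w : Noise d => arrival w k) := by
  unfold arrival; fun_prop
@[fun_prop] lemma measurable_position (k : ℕ) : Measurable (fun w : Noise d => position w k) := by
  unfold position; fun_prop

lemma arrival_cons (p : ℝ × Site d) (w : Noise d) (k : ℕ) :
    arrival (cons p w) (k + 1) = p.1 + arrival w k := by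
  simp [arrival, Finset.sum_range_succ', add_comm]
lemma position_cons (p : ℝ × Site d) (w : Noise d) (k : ℕ) :
    position (cons p w) (k + 1) = p.2 + position w k := by
  simp [position, Finset.sum_range_succ', add_comm]

/-! ### Poisson-type bounds for jump times -/

/-- The volume `b ^ k / k!` of the simplex, extended by zero. -/
def simplexVol (k : ℕ) (b : ℝ) : ℝ := if 0 ≤ b then b ^ k / k.factorial else 0

lemma measurable_simplexVol (k : ℕ) : Measurable (simplexVol k) := by
  unfold simplexVol
  exact Measurable.ite measurableSet_Ici (by fun_prop) measurable_const

lemma lintegral_simplexVol (k : ℕ) (b : ℝ) :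
    ∫⁻ h in Set.Ici 0, ENNReal.ofReal (simplexVol k (b - h)) =
      ENNReal.ofReal (simplexVol (k + 1) b) := by
  rw [← lintegral_indicator measurableSet_Ici]
  rcases lt_or_ge b 0 with hb | hb
  · have : ∀ h : ℝ, (Set.Ici 0).indicator (fun h => ENNReal.ofReal (simplexVol k (b - h))) h = 0 := by
      intro h
      simp only [Set.indicator, Set.mem_Ici]
      split_ifs with h0
      · rw [simplexVol, if_neg (by linarith)]; simp
      · rfl
    rw [lintegral_congr this]
    simp [simplexVol, not_le.2 hb]
  · have : ∀ h : ℝ, (Set.Ici 0).indicator (fun h => ENNReal.ofReal (simplexVol k (b - h))) h =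
        (Set.Icc 0 b).indicator (fun h => ENNReal.ofReal ((b - h) ^ k / k.factorial)) h := by
      intro h
      simp only [Set.indicator, Set.mem_Ici, Set.mem_Icc, simplexVol]
      by_cases h0 : 0 ≤ h <;> by_cases h1 : h ≤ b <;> simp [h0, h1, sub_nonneg]
    simp_rw [this]
    rw [lintegral_indicator measurableSet_Icc, ← ofReal_integral_eq_lintegral_ofReal,
      integral_Icc_eq_integral_Ioc, ← intervalIntegral.integral_of_le hb,
      intervalIntegral.integral_comp_sub_left (fun x => x ^ k / (k.factorial : ℝ)) b,
      intervalIntegral.integral_div, integral_pow, simplexVol, if_pos hb]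
    · congr 1
      have : (k.factorial : ℝ) ≠ 0 := by positivity
      have h2 : (k : ℝ) + 1 ≠ 0 := by positivity
      rw [Nat.factorial_succ]; push_cast; field_simp; simp
    · exact (by fun_prop : Continuous fun x : ℝ => (b - x) ^ k / (k.factorial : ℝ)).continuousOn.integrableOn_Icc
    · filter_upwards [self_mem_ae_restrict measurableSet_Icc] with x hx
      have : 0 ≤ b - x := by linarith [hx.2]
      simp only [Pi.zero_apply]
      positivity

/-- Holding times and steps are independent. The first `k` holding times have density `exp (-sum)`
on the simplex of volume `b ^ k / k!`, and the next one exceeds `a - sum` with probability at most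
`exp (-(a - sum))`; the exponentials multiply to `exp (-a)`. Splitting off the first holding time
shifts both `a` and `b`, so `a` has to be allowed to be negative. Taking `b = a + 1` controls a
whole unit of time at once. -/
lemma noise_state_le (P : WalkKernel d) (k : ℕ) (a b : ℝ) (A : Set (Site d)) :
    noiseLaw P {w | arrival w k ≤ b ∧ a < arrival w (k + 1) ∧ position w k ∈ A} ≤
      ENNReal.ofReal (Real.exp (-a) * simplexVol k b) * noiseLaw P {w | position w k ∈ A} := by
  have hmQ : ∀ k (a b : ℝ) {A : Set (Site d)}, MeasurableSet A → MeasurableSet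
      {w : Noise d | arrival w k ≤ b ∧ a < arrival w (k + 1) ∧ position w k ∈ A} := by
    intro k a b A hA
    exact (measurableSet_le (measurable_arrival k) measurable_const).inter
      ((measurableSet_lt measurable_const (measurable_arrival (k + 1))).inter
        (measurable_position k hA))
  induction k generalizing a b A with
  | zero =>
    by_cases h0 : (0 : Site d) ∈ A
    · rcases lt_or_ge b 0 with hb | hb
      · simp [not_le.2 hb]
      · simp only [arrival_zero, hb, zero_add, position_zero, h0, and_true, true_and]
        have : arrival (d := d) = fun w k => ∑ i ∈ Finset.range k, (w i).1 := rfl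
        simp only [this, Finset.sum_range_one, simplexVol, hb, if_true]
        have e := measurePreserving_eval_infinitePi
          (fun _ : ℕ => (expMeasure 1).prod (dualStepLaw P)) 0
        have e2 := e.measure_preimage (s := Set.Ioi a ×ˢ Set.univ)
          (measurableSet_Ioi.prod .univ).nullMeasurableSet
        have e3 : (Function.eval 0 ⁻¹' Set.Ioi a ×ˢ (Set.univ : Set (Site d))) =
            {w : Noise d | a < (w 0).1} := by
          ext w; simp
        rw [e3, Measure.prod_prod] at e2
        have : noiseLaw P {w : Noise d | a < (w 0).1} = expMeasure 1 (Set.Ioi a) := by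
          rw [noiseLaw, e2]; simp
        rw [this]
        have h1 : noiseLaw P {w : Noise d | True} = 1 := by simp
        rw [h1]
        simpa using expMeasure_Ioi_le a
    · simp [h0]
  | succ k ih =>
    have hA : MeasurableSet A := .of_discrete
    have hm1 := hmQ (k + 1) a b hA
    have hm2 : MeasurableSet {w : Noise d | position w (k + 1) ∈ A} := measurable_position _ hA
    rw [← lintegral_indicator_one hm1, ← lintegral_indicator_one hm2,
      lintegral_noise_cons P (measurable_one.indicator hm1),
      lintegral_noise_cons P (measurable_one.indicator hm2)]
    have e1 : ∀ (h : ℝ) (z : Site d), ∫⁻ w, Set.indicator {w : Noise d | arrival w (k + 1) ≤ b ∧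
        a < arrival w (k + 1 + 1) ∧ position w (k + 1) ∈ A} 1 (cons (h, z) w) ∂(noiseLaw P) =
        noiseLaw P {w | arrival w k ≤ b - h ∧ a - h < arrival w (k + 1) ∧
          position w k ∈ {x | z + x ∈ A}} := by
      intro h z
      rw [← lintegral_indicator_one (hmQ _ _ _ .of_discrete)]
      refine lintegral_congr fun w => ?_
      refine indicator_one_congr ?_
      simp only [Set.mem_ofPred_eq]
      rw [arrival_cons, arrival_cons, position_cons]
      have i1 : h + arrival w k ≤ b ↔ arrival w k ≤ b - h := by constructor <;> intro <;> linarith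
      have i2 : a < h + arrival w (k + 1) ↔ a - h < arrival w (k + 1) := by
        constructor <;> intro <;> linarith
      exact and_congr i1 (and_congr i2 Iff.rfl)
    have e2 : ∀ (h : ℝ) (z : Site d), ∫⁻ w, Set.indicator {w : Noise d | position w (k + 1) ∈ A} 1
        (cons (h, z) w) ∂(noiseLaw P) = noiseLaw P {w | position w k ∈ {x | z + x ∈ A}} := by
      intro h z
      rw [← lintegral_indicator_one
        (show MeasurableSet {w : Noise d | position w k ∈ {x | z + x ∈ A}} from
          measurable_position k .of_discrete)]
      refine lintegral_congr fun w => ?_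
      refine indicator_one_congr ?_
      simp only [Set.mem_ofPred_eq]
      rw [position_cons]
    simp_rw [e1, e2]
    calc _ ≤ ∫⁻ h, ∫⁻ z, ENNReal.ofReal (Real.exp (-(a - h)) * simplexVol k (b - h)) *
          noiseLaw P {w | position w k ∈ {x | z + x ∈ A}} ∂(dualStepLaw P) ∂(expMeasure 1) :=
          lintegral_mono fun h => lintegral_mono fun z => ih (a - h) (b - h) _
      _ = ∫⁻ h, ENNReal.ofReal (Real.exp (-(a - h)) * simplexVol k (b - h)) *
          (∫⁻ z, noiseLaw P {w | position w k ∈ {x | z + x ∈ A}} ∂(dualStepLaw P))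
            ∂(expMeasure 1) := by
          refine lintegral_congr fun h => ?_
          rw [lintegral_const_mul' _ _ ENNReal.ofReal_ne_top]
      _ = ENNReal.ofReal (Real.exp (-a) * simplexVol (k + 1) b) *
          ∫⁻ z, noiseLaw P {w | position w k ∈ {x | z + x ∈ A}} ∂(dualStepLaw P) := by
          have hms : Measurable fun h => ENNReal.ofReal (Real.exp (-(a - h)) * simplexVol k (b - h)) :=
            ((by fun_prop : Measurable fun h : ℝ => Real.exp (-(a - h))).mul
              ((measurable_simplexVol k).comp (by fun_prop))).ennreal_ofReal
          rw [lintegral_mul_const _ hms, lintegral_expMeasure hms]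
          congr 1
          rw [ENNReal.ofReal_mul (Real.exp_nonneg _), ← lintegral_simplexVol,
            ← lintegral_const_mul' _ _ ENNReal.ofReal_ne_top]
          refine lintegral_congr fun h => ?_
          rw [← ENNReal.ofReal_mul (Real.exp_nonneg _), ← ENNReal.ofReal_mul (Real.exp_nonneg _),
            ← mul_assoc, ← Real.exp_add]
          congr 3; ring
      _ = _ := by simp

/-- Positive holding times whose sum diverges. -/
def Good (w : Noise d) : Prop := (∀ i, 0 < (w i).1) ∧ ∀ b, ∃ k, b < arrival w k

lemma ae_pos (P : WalkKernel d) : ∀ᵐ w ∂(noiseLaw P), ∀ i, 0 < (w i).1 := by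
  rw [ae_all_iff]
  intro i
  have e := measurePreserving_eval_infinitePi (fun _ : ℕ => (expMeasure 1).prod (dualStepLaw P)) i
  have h1 : ∀ᵐ h ∂(expMeasure 1), 0 < h := by
    have h2 := expMeasure_Ioi (le_refl (0 : ℝ))
    simp only [neg_zero, Real.exp_zero, ENNReal.ofReal_one] at h2
    rw [prob_compl_eq_zero_iff measurableSet_Ioi |>.symm] at h2
    exact h2
  have h3 : ∀ᵐ p ∂((expMeasure 1).prod (dualStepLaw P)), 0 < p.1 :=
    Measure.quasiMeasurePreserving_fst.ae h1
  exact e.quasiMeasurePreserving.ae h3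

lemma noise_arrival_le (P : WalkKernel d) (k : ℕ) (b : ℝ) :
    noiseLaw P {w | arrival w k ≤ b} ≤ ENNReal.ofReal (simplexVol k b) := by
  have h := noise_state_le P k 0 b Set.univ
  simp only [Set.mem_univ, and_true, neg_zero, Real.exp_zero, one_mul] at h
  have : noiseLaw P {w : Noise d | True} = 1 := by simp
  rw [this, mul_one] at h
  refine le_trans (measure_mono_ae ?_) h
  filter_upwards [ae_pos P] with w hw hk
  refine ⟨hk, ?_⟩
  exact Finset.sum_pos (fun i _ => hw i) (by simp)

/-- No explosion: the probability that `k` jumps occur by time `n` is at most `n ^ k / k!`, which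
tends to 0 in `k`. -/
lemma ae_good (P : WalkKernel d) : ∀ᵐ w ∂(noiseLaw P), Good w := by
  have h1 : ∀ n : ℕ, ∀ᵐ w ∂(noiseLaw P), ∃ k, (n : ℝ) < arrival w k := by
    intro n
    rw [ae_iff]
    have h2 : ∀ k, noiseLaw P {w | ¬ ∃ k, (n : ℝ) < arrival w k} ≤ ENNReal.ofReal ((n : ℝ) ^ k / k.factorial) := by
      intro k
      have := noise_arrival_le P k n
      rw [simplexVol, if_pos (Nat.cast_nonneg n)] at this
      refine (measure_mono ?_).trans this
      intro w hw
      simp only [not_exists, not_lt, Set.mem_ofPred_eq] at hw ⊢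
      exact hw k
    have h3 := ENNReal.tendsto_ofReal (FloorSemiring.tendsto_pow_div_factorial_atTop (n : ℝ))
    rw [ENNReal.ofReal_zero] at h3
    exact le_antisymm (ge_of_tendsto' h3 h2) bot_le
  filter_upwards [ae_pos P, ae_all_iff.2 h1] with w hw hw2
  refine ⟨hw, fun b => ?_⟩
  obtain ⟨n, hn⟩ := exists_nat_gt b
  obtain ⟨k, hk⟩ := hw2 n
  exact ⟨k, hn.trans hk⟩

/-! ### Space-time graphs of walks, sampled at rational times -/

/-- Space-time points with a rational time. -/
abbrev Pt (d : ℕ) : Type := ℚ × Site d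

/-- The space-time graph of the walk released at time `a.1` from the site `a.2`. -/
def graph (a : ℝ × Site d) (w : Noise d) : Set (Pt d) :=
  {p | ∃ k, a.1 + arrival w k ≤ p.1 ∧ (p.1 : ℝ) < a.1 + arrival w (k + 1) ∧
    p.2 = a.2 + position w k}

/-- The part of `V` that precedes the first visit of `V` to `O`. -/
def alive (V O : Set (Pt d)) : Set (Pt d) :=
  {p | p ∈ V ∧ ∃ q : ℚ, p.1 < q ∧ ∀ p' ∈ V, p' ∈ O → q ≤ p'.1}

/-- The first time at which `V` visits `O`. -/
def hitTime (V O : Set (Pt d)) : ℝ := sInf ((fun p : Pt d => (p.1 : ℝ)) '' (V ∩ O))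

/-- The number of jumps up to time `t` after the release. -/
def stateAt (w : Noise d) (t : ℝ) : ℕ := sInf {k | t < arrival w (k + 1)}

/-- The site at the absolute time `t` of the walk released from `a`. -/
def siteAt (a : ℝ × Site d) (w : Noise d) (t : ℝ) : Site d :=
  a.2 + position w (stateAt w (t - a.1))

section Measurability

variable {α : Type*} [MeasurableSpace α]

lemma measurableSet_mem_of_measurable {V : α → Set (Pt d)} (hV : Measurable V) (p : Pt d) :
    MeasurableSet {x | p ∈ V x} := measurableSet_setOfPred.2 (measurable_set_iff.1 hV p)

lemma measurable_set_of {V : α → Set (Pt d)} (h : ∀ p, MeasurableSet {x | p ∈ V x}) :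
    Measurable V := measurable_set_iff.2 fun p => measurableSet_setOfPred.1 (h p)

lemma Measurable.set_union {V O : α → Set (Pt d)} (hV : Measurable V) (hO : Measurable O) :
    Measurable fun x => V x ∪ O x :=
  measurable_set_of fun p =>
    (measurableSet_mem_of_measurable hV p).union (measurableSet_mem_of_measurable hO p)

lemma Measurable.set_inter {V O : α → Set (Pt d)} (hV : Measurable V) (hO : Measurable O) :
    Measurable fun x => V x ∩ O x :=
  measurable_set_of fun p =>
    (measurableSet_mem_of_measurable hV p).inter (measurableSet_mem_of_measurable hO p)

lemma Measurable.set_nonempty {V : α → Set (Pt d)} (hV : Measurable V) :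
    MeasurableSet {x | (V x).Nonempty} := by
  have : {x | (V x).Nonempty} = ⋃ p, {x | p ∈ V x} := by
    ext x; simp [Set.Nonempty]
  rw [this]
  exact .iUnion fun p => measurableSet_mem_of_measurable hV p

lemma Measurable.alive {V O : α → Set (Pt d)} (hV : Measurable V) (hO : Measurable O) :
    Measurable fun x => alive (V x) (O x) := by
  refine measurable_set_of fun p => ?_
  have : {x | p ∈ CoalescingRW.alive (V x) (O x)} = {x | p ∈ V x} ∩ ⋃ q : ℚ, ⋃ _ : p.1 < q,
      ⋂ p' : Pt d, ⋂ _ : ¬ q ≤ p'.1, ({x | p' ∈ V x} ∩ {x | p' ∈ O x})ᶜ := by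
    ext x
    simp only [CoalescingRW.alive, Set.mem_ofPred_eq, Set.mem_inter_iff, Set.mem_iUnion, Set.mem_iInter,
      Set.mem_compl_iff, exists_prop]
    refine and_congr_right fun _ => exists_congr fun q => and_congr_right fun _ =>
      forall_congr' fun p' => ?_
    tauto
  rw [this]
  exact (measurableSet_mem_of_measurable hV p).inter (.iUnion fun q => .iUnion fun _ =>
    .iInter fun p' => .iInter fun _ => ((measurableSet_mem_of_measurable hV p').inter
      (measurableSet_mem_of_measurable hO p')).compl)

lemma measurable_graph {a : α → ℝ × Site d} {w : α → Noise d} (ha : Measurable a)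
    (hw : Measurable w) : Measurable fun x => graph (a x) (w x) := by
  refine measurable_set_of fun p => ?_
  have : {x | p ∈ graph (a x) (w x)} = ⋃ k, ({x | (a x).1 + arrival (w x) k ≤ p.1} ∩
      ({x | (p.1 : ℝ) < (a x).1 + arrival (w x) (k + 1)} ∩
        {x | p.2 = (a x).2 + position (w x) k})) := by
    ext x; simp [graph]
  rw [this]
  have h1 : ∀ k, Measurable fun x => (a x).1 + arrival (w x) k := fun k =>
    ha.fst.add ((measurable_arrival k).comp hw)
  have h2 : ∀ k, Measurable fun x => (a x).2 + position (w x) k := fun k =>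
    ha.snd.add ((measurable_position k).comp hw)
  exact .iUnion fun k => (measurableSet_le (h1 k) measurable_const).inter
    ((measurableSet_lt measurable_const (h1 _)).inter (measurableSet_eq_fun measurable_const (h2 k)))

lemma measurable_hitTime {V O : α → Set (Pt d)} (hV : Measurable V) (hO : Measurable O) :
    Measurable fun x => hitTime (V x) (O x) := by
  refine measurable_of_Iio fun t => ?_
  have hI := Measurable.set_inter hV hO
  have hB : MeasurableSet {x | BddBelow ((fun p : Pt d => (p.1 : ℝ)) '' (V x ∩ O x))} := by
    have : {x | BddBelow ((fun p : Pt d => (p.1 : ℝ)) '' (V x ∩ O x))} =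
        ⋃ n : ℕ, ⋂ p : Pt d, ⋂ _ : (p.1 : ℝ) < -n, {x | p ∈ V x ∩ O x}ᶜ := by
      ext x
      simp only [Set.mem_iUnion, Set.mem_iInter, Set.mem_compl_iff, Set.mem_ofPred_eq]
      constructor
      · rintro ⟨b, hb⟩
        obtain ⟨n, hn⟩ := exists_nat_gt (-b)
        refine ⟨n, fun p hp hp' => ?_⟩
        have : b ≤ (p.1 : ℝ) := hb ⟨p, hp', rfl⟩
        linarith
      · rintro ⟨n, hn⟩
        refine ⟨-n, ?_⟩
        rintro _ ⟨p, hp, rfl⟩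
        exact not_lt.1 fun h => hn p h hp
    rw [this]
    exact .iUnion fun n => .iInter fun p => .iInter fun _ =>
      (measurableSet_mem_of_measurable hI p).compl
  have hN := Measurable.set_nonempty hI
  -- The infimum of an empty set, or of a set unbounded below, is 0 by convention; the second piece
  -- of the decomposition collects these cases.
  have : (fun x => hitTime (V x) (O x)) ⁻¹' Set.Iio t =
      (({x | (V x ∩ O x).Nonempty} ∩
        {x | BddBelow ((fun p : Pt d => (p.1 : ℝ)) '' (V x ∩ O x))}) ∩
        ⋃ p : Pt d, ⋃ _ : (p.1 : ℝ) < t, {x | p ∈ V x ∩ O x}) ∪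
      (({x | (V x ∩ O x).Nonempty} ∩
        {x | BddBelow ((fun p : Pt d => (p.1 : ℝ)) '' (V x ∩ O x))})ᶜ ∩ {_x | 0 < t}) := by
    ext x
    simp only [Set.mem_preimage, Set.mem_Iio, Set.mem_union, Set.mem_iUnion,
      Set.mem_inter_iff, Set.mem_compl_iff, exists_prop, hitTime, Set.mem_ofPred_eq]
    by_cases hx : (V x ∩ O x).Nonempty ∧ BddBelow ((fun p : Pt d => (p.1 : ℝ)) '' (V x ∩ O x))
    · rw [csInf_lt_iff hx.2 (hx.1.image _)]
      simp only [hx, not_true_eq_false, false_and, or_false, true_and, and_self, Set.mem_image, Set.mem_inter_iff]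
      constructor
      · rintro ⟨_, ⟨p, hp, rfl⟩, h⟩; exact ⟨p, h, hp⟩
      · rintro ⟨p, h, hp⟩; exact ⟨_, ⟨p, hp, rfl⟩, h⟩
    · have : sInf ((fun p : Pt d => (p.1 : ℝ)) '' (V x ∩ O x)) = 0 := by
        by_cases hne : (V x ∩ O x).Nonempty
        · exact Real.sInf_of_not_bddBelow fun h => hx ⟨hne, h⟩
        · rw [Set.not_nonempty_iff_eq_empty.1 hne, Set.image_empty, Real.sInf_empty]
      rw [this]
      simp only [hx, not_false_eq_true, true_and, false_and, false_or]
  rw [this]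
  exact ((hN.inter hB).inter (.iUnion fun p => .iUnion fun _ =>
    measurableSet_mem_of_measurable hI p)).union ((hN.inter hB).compl.inter (.const _))

lemma measurable_stateAt {w : α → Noise d} {t : α → ℝ} (hw : Measurable w) (ht : Measurable t) :
    Measurable fun x => stateAt (w x) (t x) := by
  have hm : ∀ k, MeasurableSet {x | t x < arrival (w x) (k + 1)} := fun k =>
    measurableSet_lt ht ((measurable_arrival _).comp hw)
  refine measurable_to_countable' fun k => ?_
  have : (fun x => stateAt (w x) (t x)) ⁻¹' {k} =
      ({x | t x < arrival (w x) (k + 1)} ∩ ⋂ j, ⋂ _ : j < k, {x | t x < arrival (w x) (j + 1)}ᶜ) ∪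
      ((⋂ j, {x | t x < arrival (w x) (j + 1)}ᶜ) ∩ {_x | k = 0}) := by
    ext x
    simp only [Set.mem_preimage, Set.mem_singleton_iff, stateAt, Set.mem_union, Set.mem_inter_iff,
      Set.mem_iInter, Set.mem_compl_iff, Set.mem_ofPred_eq]
    constructor
    · rintro rfl
      by_cases hne : {k | t x < arrival (w x) (k + 1)}.Nonempty
      · exact Or.inl ⟨Nat.sInf_mem hne, fun j hj => Nat.notMem_of_lt_sInf hj⟩
      · refine Or.inr ⟨fun j hj => hne ⟨j, hj⟩, ?_⟩
        rw [Set.not_nonempty_iff_eq_empty.1 hne, Nat.sInf_empty]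
    · rintro (⟨h1, h2⟩ | ⟨h1, h2⟩)
      · refine le_antisymm (Nat.sInf_le h1) (le_of_not_gt fun h => h2 _ h
          (Nat.sInf_mem (s := {k | t x < arrival (w x) (k + 1)}) ⟨k, h1⟩))
      · have : {k | t x < arrival (w x) (k + 1)} = ∅ := by ext j; simpa using h1 j
        rw [this, Nat.sInf_empty, h2]
  rw [this]
  exact ((hm k).inter (.iInter fun j => .iInter fun _ => (hm j).compl)).union
    ((MeasurableSet.iInter fun j => (hm j).compl).inter (.const _))

lemma measurable_siteAt {a : α → ℝ × Site d} {w : α → Noise d} {t : α → ℝ} (ha : Measurable a)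
    (hw : Measurable w) (ht : Measurable t) : Measurable fun x => siteAt (a x) (w x) (t x) := by
  refine ha.snd.add ?_
  have h2 : Measurable fun q : ℕ × Noise d => position q.2 q.1 :=
    measurable_from_prod_countable_right fun k => measurable_position k
  exact h2.comp ((measurable_stateAt hw (ht.sub ha.fst)).prodMk hw)

end Measurability

/-! ### Deterministic facts about graphs -/

lemma Good.strictMono {w : Noise d} (hw : Good w) : StrictMono (arrival w) :=
  strictMono_nat_of_lt_succ fun k => by rw [arrival_succ]; linarith [hw.1 k]

lemma Good.arrival_nonneg {w : Noise d} (hw : Good w) (k : ℕ) : 0 ≤ arrival w k := by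
  simpa using hw.strictMono.monotone (Nat.zero_le k)

lemma Good.stateAt_eq {w : Noise d} (hw : Good w) {t : ℝ} {k : ℕ} (h1 : arrival w k ≤ t)
    (h2 : t < arrival w (k + 1)) : stateAt w t = k := by
  refine le_antisymm (Nat.sInf_le h2) (le_csInf ⟨k, h2⟩ fun j hj => ?_)
  have : arrival w k < arrival w (j + 1) := h1.trans_lt hj
  have := hw.strictMono.lt_iff_lt.1 this
  omega

lemma Good.lt_arrival_stateAt {w : Noise d} (hw : Good w) (t : ℝ) :
    t < arrival w (stateAt w t + 1) := by
  refine Nat.sInf_mem (s := {k | t < arrival w (k + 1)}) ?_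
  obtain ⟨k, hk⟩ := hw.2 t
  exact ⟨k, hk.trans (hw.strictMono k.lt_succ_self)⟩

lemma arrival_stateAt_le (w : Noise d) {t : ℝ} (ht : 0 ≤ t) :
    arrival w (stateAt w t) ≤ t := by
  rcases h : stateAt w t with _ | k
  · simpa using ht
  · by_contra hlt
    have : k ∈ {k | t < arrival w (k + 1)} := not_le.1 hlt
    have := Nat.sInf_le this
    rw [stateAt] at h
    omega

lemma Good.mem_graph {w : Noise d} (hw : Good w) {a : ℝ × Site d} {p : Pt d} :
    p ∈ graph a w ↔ a.1 ≤ p.1 ∧ p.2 = siteAt a w p.1 := by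
  constructor
  · rintro ⟨k, h1, h2, h3⟩
    refine ⟨by linarith [hw.arrival_nonneg k], ?_⟩
    rw [h3, siteAt, hw.stateAt_eq (k := k) (by linarith) (by linarith)]
  · rintro ⟨h1, h2⟩
    refine ⟨stateAt w (p.1 - a.1), ?_, ?_, h2⟩
    · linarith [arrival_stateAt_le w (t := p.1 - a.1) (by linarith)]
    · linarith [hw.lt_arrival_stateAt (p.1 - a.1)]

lemma Good.siteAt_const {w : Noise d} (hw : Good w) {a : ℝ × Site d} {t : ℝ} (ht : a.1 ≤ t) :
    ∃ t', t < t' ∧ ∀ s, t ≤ s → s < t' → siteAt a w s = siteAt a w t := by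
  have h1 := arrival_stateAt_le w (t := t - a.1) (by linarith)
  have h2 := hw.lt_arrival_stateAt (t - a.1)
  refine ⟨a.1 + arrival w (stateAt w (t - a.1) + 1), by linarith, fun s hs1 hs2 => ?_⟩
  rw [siteAt, siteAt, hw.stateAt_eq (t := s - a.1) (k := stateAt w (t - a.1)) (by linarith) (by linarith)]

lemma alive_subset (V O : Set (Pt d)) : alive V O ⊆ V := fun _ h => h.1

lemma bddBelow_hits {V O : Set (Pt d)} {b : ℝ} (hb : ∀ p ∈ V, b ≤ p.1) :
    BddBelow ((fun p : Pt d => (p.1 : ℝ)) '' (V ∩ O)) :=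
  ⟨b, by rintro _ ⟨p, hp, rfl⟩; exact hb p hp.1⟩

/-- The rational witness in `alive` expresses survival strictly before the infimum of the visits. It
keeps the definition countable and covers a path without visits without a case distinction. -/
lemma mem_alive_iff {V O : Set (Pt d)} {b : ℝ} (hb : ∀ p ∈ V, b ≤ p.1) (hne : (V ∩ O).Nonempty)
    {p : Pt d} : p ∈ alive V O ↔ p ∈ V ∧ (p.1 : ℝ) < hitTime V O := by
  refine and_congr_right fun _ => ?_
  constructor
  · rintro ⟨q, hq, h⟩
    have : (q : ℝ) ≤ hitTime V O := by
      refine le_csInf (hne.image _) ?_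
      rintro _ ⟨p', hp', rfl⟩
      show (q : ℝ) ≤ (p'.1 : ℝ)
      exact_mod_cast h p' hp'.1 hp'.2
    have h2 : (p.1 : ℝ) < q := by exact_mod_cast hq
    linarith
  · intro h
    obtain ⟨q, h1, h2⟩ := exists_rat_btwn h
    refine ⟨q, by exact_mod_cast h1, fun p' hp' hO => ?_⟩
    have := csInf_le (bddBelow_hits (O := O) hb) ⟨p', ⟨hp', hO⟩, rfl⟩
    have h3 : (q : ℝ) ≤ p'.1 := h2.le.trans this
    exact_mod_cast h3

lemma alive_eq_self {V O : Set (Pt d)} (h : ¬ (V ∩ O).Nonempty) : alive V O = V := by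
  ext p
  refine ⟨fun hp => hp.1, fun hp => ⟨hp, p.1 + 1, by linarith, fun p' h1 h2 => absurd ⟨p', h1, h2⟩ h⟩⟩

lemma le_of_mem_graph {a : ℝ × Site d} {w : Noise d} (hw : Good w) :
    ∀ p ∈ graph a w, a.1 ≤ (p.1 : ℝ) := fun _ hp => (hw.mem_graph.1 hp).1

lemma hitTime_le {V O : Set (Pt d)} {b : ℝ} (hb : ∀ p ∈ V, b ≤ p.1) {p : Pt d} (h1 : p ∈ V)
    (h2 : p ∈ O) : hitTime V O ≤ p.1 :=
  csInf_le (bddBelow_hits (O := O) hb) ⟨p, ⟨h1, h2⟩, rfl⟩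

/-! ### The strong Markov property at the first visit to a set -/

open scoped Classical in
/-- The graph of the walk that follows `w` until its first visit to `O` and then continues
with the noise `w'`. -/
def splice (a : ℝ × Site d) (O : Set (Pt d)) (w w' : Noise d) : Set (Pt d) :=
  if (graph a w ∩ O).Nonempty then alive (graph a w) O ∪
    graph (hitTime (graph a w) O, siteAt a w (hitTime (graph a w) O)) w' else graph a w

/-- The walk with noise `w` does not visit `O` before its `k`-th jump, and its site after that
jump occurs in `O` later on. -/
def meetsAtState (a : ℝ × Site d) (O : Set (Pt d)) (k : ℕ) : Set (Noise d) :=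
  {w | (∃ p ∈ O, a.1 + arrival w k ≤ p.1 ∧ p.2 = a.2 + position w k) ∧
    ∀ j < k, ∀ p ∈ O, ¬ (a.1 + arrival w j ≤ p.1 ∧ (p.1 : ℝ) < a.1 + arrival w (j + 1) ∧
      p.2 = a.2 + position w j)}

/-- The points of `O` at the site of the walk after the `k`-th jump, later than that jump. -/
def stateHits (a : ℝ × Site d) (O : Set (Pt d)) (k : ℕ) (w : Noise d) : Set (Pt d) :=
  {p | p ∈ O ∧ a.1 + arrival w k ≤ p.1 ∧ p.2 = a.2 + position w k}

/-- The time between the `k`-th jump and the first point of `stateHits`. -/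
def stateDelay (a : ℝ × Site d) (O : Set (Pt d)) (k : ℕ) (w : Noise d) : ℝ :=
  hitTime (stateHits a O k w) Set.univ - a.1 - arrival w k

lemma arrival_join_le {k j : ℕ} (hj : j ≤ k) (w w' : Noise d) :
    arrival (join k w w') j = arrival w j := by
  refine Finset.sum_congr rfl fun i hi => ?_
  have := Finset.mem_range.1 hi
  rw [join, if_pos (by omega)]

lemma position_join_le {k j : ℕ} (hj : j ≤ k) (w w' : Noise d) :
    position (join k w w') j = position w j := by
  refine Finset.sum_congr rfl fun i hi => ?_
  have := Finset.mem_range.1 hi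
  rw [join, if_pos (by omega)]

lemma arrival_join_add (k j : ℕ) (w w' : Noise d) :
    arrival (join k w w') (k + j) = arrival w k + arrival w' j := by
  rw [arrival, Finset.sum_range_add, ← arrival, arrival_join_le le_rfl]
  congr 1
  exact Finset.sum_congr rfl fun i _ => by simp [join]

lemma position_join_add (k j : ℕ) (w w' : Noise d) :
    position (join k w w') (k + j) = position w k + position w' j := by
  rw [position, Finset.sum_range_add, ← position, position_join_le le_rfl]
  congr 1
  exact Finset.sum_congr rfl fun i _ => by simp [join]

lemma arrival_delay (c : ℝ) (w : Noise d) (j : ℕ) :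
    arrival (delay c w) (j + 1) = c + arrival w (j + 1) := by
  simp [arrival, Finset.sum_range_succ', delay]; ring

lemma position_delay (c : ℝ) (w : Noise d) (j : ℕ) :
    position (delay c w) j = position w j := by
  refine Finset.sum_congr rfl fun i _ => ?_
  rcases i with _ | i <;> simp [delay]

lemma stateHits_join (a : ℝ × Site d) (O : Set (Pt d)) (k : ℕ) (w w' : Noise d) :
    stateHits a O k (join k w w') = stateHits a O k w := by
  simp [stateHits, arrival_join_le, position_join_le]

lemma stateDelay_join (a : ℝ × Site d) (O : Set (Pt d)) (k : ℕ) (w w' : Noise d) :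
    stateDelay a O k (join k w w') = stateDelay a O k w := by
  simp [stateDelay, stateHits_join, arrival_join_le]

lemma mem_meetsAtState_join (a : ℝ × Site d) (O : Set (Pt d)) (k : ℕ) (w w' : Noise d) :
    join k w w' ∈ meetsAtState a O k ↔ w ∈ meetsAtState a O k := by
  simp only [meetsAtState, Set.mem_ofPred_eq, arrival_join_le le_rfl, position_join_le le_rfl]
  refine and_congr_right fun _ => forall_congr' fun j => forall_congr' fun hj => ?_
  rw [arrival_join_le (by omega), arrival_join_le (by omega), position_join_le (by omega)]

lemma measurable_stateHits (a : ℝ × Site d) (O : Set (Pt d)) (k : ℕ) :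
    Measurable (stateHits a O k) := by
  refine measurable_set_of fun p => ?_
  have : {w | p ∈ stateHits a O k w} = {_w | p ∈ O} ∩ ({w | a.1 + arrival w k ≤ p.1} ∩
      {w | p.2 = a.2 + position w k}) := by ext w; exact Iff.rfl
  rw [this]
  have h2 : Measurable fun w : Noise d => a.2 + position w k :=
    measurable_const.add (measurable_position k)
  exact (MeasurableSet.const _).inter ((measurableSet_le
    (measurable_const.add (measurable_arrival k)) measurable_const).inter
    (measurableSet_eq_fun measurable_const h2))

lemma stateHits_ge {a : ℝ × Site d} {O : Set (Pt d)} {k : ℕ} {w : Noise d} :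
    ∀ p ∈ stateHits a O k w, a.1 + arrival w k ≤ p.1 := fun _ h => h.2.1

lemma measurable_stateDelay (a : ℝ × Site d) (O : Set (Pt d)) (k : ℕ) :
    Measurable (stateDelay a O k) := by
  exact ((measurable_hitTime (measurable_stateHits a O k) measurable_const).sub
    measurable_const).sub (measurable_arrival k)

lemma measurableSet_meetsAtState (a : ℝ × Site d) (O : Set (Pt d)) (k : ℕ) :
    MeasurableSet (meetsAtState a O k) := by
  have : meetsAtState a O k = {w | (stateHits a O k w).Nonempty} ∩
      ⋂ j, ⋂ _ : j < k, ⋂ p, ⋂ _ : p ∈ O, ({w | a.1 + arrival w j ≤ (p : Pt d).1} ∩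
        ({w | (p.1 : ℝ) < a.1 + arrival w (j + 1)} ∩ {w | p.2 = a.2 + position w j}))ᶜ := by
    ext w
    simp only [meetsAtState, stateHits, Set.Nonempty, Set.mem_ofPred_eq, Set.mem_inter_iff,
      Set.mem_iInter, Set.mem_compl_iff]
  rw [this]
  have h1 : ∀ k, Measurable fun w : Noise d => a.1 + arrival w k := fun k =>
    measurable_const.add (measurable_arrival k)
  have h2 : ∀ k, Measurable fun w : Noise d => a.2 + position w k := fun k =>
    measurable_const.add (measurable_position k)
  exact (Measurable.set_nonempty (measurable_stateHits a O k)).inter (.iInter fun j =>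
    .iInter fun _ => .iInter fun p => .iInter fun _ =>
      ((measurableSet_le (h1 j) measurable_const).inter ((measurableSet_lt measurable_const
        (h1 _)).inter (measurableSet_eq_fun measurable_const (h2 j)))).compl)

lemma stateDelay_nonneg {a : ℝ × Site d} {O : Set (Pt d)} {k : ℕ} {w : Noise d}
    (h : w ∈ meetsAtState a O k) : 0 ≤ stateDelay a O k w := by
  have : a.1 + arrival w k ≤ hitTime (stateHits a O k w) Set.univ := by
    obtain ⟨p, hp⟩ := h.1
    refine le_csInf (Set.Nonempty.image _ ⟨p, hp, trivial⟩) ?_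
    rintro _ ⟨p', hp', rfl⟩
    exact stateHits_ge p' hp'.1
  unfold stateDelay; linarith

/-- With its converse `state_of_hitTime`, this puts the event that the first visit occurs after
exactly `k` jumps into the form required by `lintegral_noise_markov`: a condition on the first `k`
pairs, together with the next holding time exceeding a function of these pairs. -/
lemma hitTime_of_state {a : ℝ × Site d} {O : Set (Pt d)} {k : ℕ} {w : Noise d} (hw : Good w)
    (h : w ∈ meetsAtState a O k) (hc : stateDelay a O k w < (w k).1) :
    (graph a w ∩ O).Nonempty ∧
      hitTime (graph a w) O = a.1 + arrival w k + stateDelay a O k w ∧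
      stateAt w (hitTime (graph a w) O - a.1) = k := by
  have hne : (stateHits a O k w ∩ Set.univ).Nonempty := by
    obtain ⟨p, hp⟩ := h.1; exact ⟨p, hp, trivial⟩
  have hσ : hitTime (stateHits a O k w) Set.univ = a.1 + arrival w k + stateDelay a O k w := by
    unfold stateDelay; ring
  have hlt : hitTime (stateHits a O k w) Set.univ < a.1 + arrival w (k + 1) := by
    rw [hσ, arrival_succ]; linarith
  have hin : ∀ p ∈ stateHits a O k w, (p.1 : ℝ) < a.1 + arrival w (k + 1) → p ∈ graph a w ∩ O :=
    fun p hp h => ⟨⟨k, hp.2.1, h, hp.2.2⟩, hp.1⟩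
  have hout : ∀ p ∈ graph a w ∩ O, p ∈ stateHits a O k w ∨ a.1 + arrival w (k + 1) ≤ p.1 := by
    rintro p ⟨⟨j, h1, h2, h3⟩, hO⟩
    rcases lt_trichotomy j k with hj | rfl | hj
    · exact absurd ⟨h1, h2, h3⟩ (h.2 j hj p hO)
    · exact Or.inl ⟨hO, h1, h3⟩
    · right; linarith [hw.strictMono.monotone (show k + 1 ≤ j by omega)]
  obtain ⟨_, ⟨p, hp, rfl⟩, hpt⟩ := exists_lt_of_csInf_lt (hne.image _) hlt
  have hpg := hin p hp.1 hpt
  have e : hitTime (graph a w) O = hitTime (stateHits a O k w) Set.univ := by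
    refine le_antisymm ?_ ?_
    · refine le_csInf (hne.image _) ?_
      rintro _ ⟨p', hp', rfl⟩
      by_cases h' : (p'.1 : ℝ) < a.1 + arrival w (k + 1)
      · exact hitTime_le (le_of_mem_graph hw) (hin p' hp'.1 h').1 hp'.1.1
      · have := hitTime_le (O := O) (le_of_mem_graph hw) hpg.1 hpg.2
        exact this.trans (hpt.le.trans (not_lt.1 h'))
    · refine le_csInf (Set.Nonempty.image _ ⟨p, hpg⟩) ?_
      rintro _ ⟨p', hp', rfl⟩
      rcases hout p' hp' with h' | h'
      · exact hitTime_le stateHits_ge h' (Set.mem_univ _)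
      · exact hlt.le.trans h'
  refine ⟨⟨p, hpg⟩, e.trans hσ, ?_⟩
  refine hw.stateAt_eq ?_ ?_
  · rw [e, hσ]; linarith [stateDelay_nonneg h]
  · rw [e]; linarith

lemma state_of_hitTime {a : ℝ × Site d} {O : Set (Pt d)} {k : ℕ} {w : Noise d} (hw : Good w)
    (hne : (graph a w ∩ O).Nonempty) (hk : stateAt w (hitTime (graph a w) O - a.1) = k) :
    w ∈ meetsAtState a O k ∧ stateDelay a O k w < (w k).1 := by
  have hge : a.1 ≤ hitTime (graph a w) O := by
    refine le_csInf (hne.image _) ?_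
    rintro _ ⟨p, hp, rfl⟩
    exact le_of_mem_graph hw p hp.1
  have h1 := arrival_stateAt_le w (t := hitTime (graph a w) O - a.1) (by linarith)
  have h2 := hw.lt_arrival_stateAt (hitTime (graph a w) O - a.1)
  rw [hk] at h1 h2
  obtain ⟨_, ⟨p, hp, rfl⟩, hpt⟩ := exists_lt_of_csInf_lt (hne.image _)
    (show hitTime (graph a w) O < a.1 + arrival w (k + 1) by linarith)
  have hstate : ∀ j ≤ k, ∀ p ∈ graph a w ∩ O, (p.1 : ℝ) < a.1 + arrival w (j + 1) → j = k := by
    intro j hj p hp h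
    by_contra hne'
    have := hitTime_le (O := O) (le_of_mem_graph hw) hp.1 hp.2
    have := hw.strictMono.monotone (show j + 1 ≤ k by omega)
    linarith
  obtain ⟨j, g1, g2, g3⟩ := hp.1
  have hjk : j ≤ k := by
    have : arrival w j < arrival w (k + 1) := by linarith
    have := hw.strictMono.lt_iff_lt.1 this
    omega
  obtain rfl := hstate j hjk p hp g2
  refine ⟨⟨⟨p, hp.2, g1, g3⟩, fun i hi p' hO hp' => ?_⟩, ?_⟩
  · have := hstate i hi.le p' ⟨⟨i, hp'⟩, hO⟩ hp'.2.1
    omega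
  · have := hitTime_le (O := Set.univ) (stateHits_ge (a := a) (O := O) (k := j) (w := w))
      (p := p) ⟨hp.2, g1, g3⟩ trivial
    rw [arrival_succ] at g2
    unfold stateDelay; linarith

/-- At the first visit the current holding period has age `stateDelay`. Adding this age to the first
holding time of `w'` places the jumps of the continuation where a walk restarted at the visit has
them. -/
lemma graph_join_delay {a : ℝ × Site d} {O : Set (Pt d)} {k : ℕ} {w w' : Noise d} (hw : Good w)
    (hw' : Good w') (h : w ∈ meetsAtState a O k) (hc : stateDelay a O k w < (w k).1) :
    graph a (join k w (delay (stateDelay a O k w) w')) = splice a O w w' := by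
  obtain ⟨hne, hτ, hs⟩ := hitTime_of_state hw h hc
  have hc0 := stateDelay_nonneg h
  rw [splice, if_pos hne]
  have hξ : siteAt a w (hitTime (graph a w) O) = a.2 + position w k := by rw [siteAt, hs]
  rw [hξ]
  set c := stateDelay a O k w with hcdef
  set τ := hitTime (graph a w) O with hτdef
  have A1 : ∀ j, arrival (join k w (delay c w')) (k + (j + 1)) = arrival w k + c + arrival w' (j + 1) := by
    intro j; rw [arrival_join_add, arrival_delay]; ring
  have A0 : ∀ j ≤ k, arrival (join k w (delay c w')) j = arrival w j := fun j hj =>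
    arrival_join_le hj _ _
  have X1 : ∀ j, position (join k w (delay c w')) (k + j) = position w k + position w' j := by
    intro j; rw [position_join_add, position_delay]
  have X0 : ∀ j ≤ k, position (join k w (delay c w')) j = position w j := fun j hj =>
    position_join_le hj _ _
  have hTk : arrival w (k + 1) = arrival w k + (w k).1 := arrival_succ w k
  ext p
  rw [Set.mem_union, mem_alive_iff (le_of_mem_graph hw) hne]
  constructor
  · rintro ⟨m, h1, h2, h3⟩
    rcases lt_or_ge m k with hm | hm
    · rw [A0 m hm.le] at h1
      rw [A0 (m + 1) hm] at h2
      rw [X0 m hm.le] at h3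
      refine Or.inl ⟨⟨m, h1, h2, h3⟩, ?_⟩
      have := hw.strictMono.monotone (show m + 1 ≤ k by omega)
      linarith
    · obtain ⟨j, rfl⟩ := Nat.exists_eq_add_of_le hm
      rw [X1] at h3
      rw [add_assoc, A1] at h2
      rcases j with _ | j
      · rw [add_zero, A0 k le_rfl] at h1
        simp only [position_zero, add_zero] at h3
        rcases lt_or_ge (p.1 : ℝ) τ with hp | hp
        · exact Or.inl ⟨⟨k, h1, by linarith, h3⟩, hp⟩
        · exact Or.inr ⟨0, by simpa using hp, by simp only [zero_add] at h2 ⊢; linarith, by simpa using h3⟩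
      · rw [A1] at h1
        exact Or.inr ⟨j + 1, by simp only; linarith, by simp only; linarith, by rw [h3, add_assoc]⟩
  · rintro (⟨⟨m, h1, h2, h3⟩, hp⟩ | ⟨j, h1, h2, h3⟩)
    · have hmk : m ≤ k := by
        have : arrival w m < arrival w (k + 1) := by linarith
        have := hw.strictMono.lt_iff_lt.1 this
        omega
      rcases hmk.lt_or_eq with hm | rfl
      · exact ⟨m, by rwa [A0 m hm.le], by rwa [A0 (m + 1) hm], by rwa [X0 m hm.le]⟩
      · have g := A1 0
        rw [zero_add] at g
        have := hw'.arrival_nonneg 1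
        exact ⟨m, by rwa [A0 m le_rfl], by rw [g]; linarith, by rwa [X0 m le_rfl]⟩
    · simp only at h1 h2 h3
      refine ⟨k + j, ?_, ?_, ?_⟩
      · rcases j with _ | j
        · rw [add_zero, A0 k le_rfl]; simp only [arrival_zero] at h1; linarith
        · rw [A1]; linarith
      · rw [add_assoc, A1]; linarith
      · rw [X1, h3, add_assoc]

lemma lintegral_eq_of_partition {α : Type*} [MeasurableSpace α] {μ : Measure α} {κ : α → ℕ}
    (hκ : Measurable κ) {f g : α → ℝ≥0∞} (hf : Measurable f) (hg : Measurable g)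
    (h : ∀ k, ∫⁻ x, (κ ⁻¹' {k}).indicator f x ∂μ = ∫⁻ x, (κ ⁻¹' {k}).indicator g x ∂μ) :
    ∫⁻ x, f x ∂μ = ∫⁻ x, g x ∂μ := by
  have key : ∀ {f : α → ℝ≥0∞}, Measurable f →
      ∫⁻ x, f x ∂μ = ∑' k, ∫⁻ x, (κ ⁻¹' {k}).indicator f x ∂μ := by
    intro f hf
    rw [← lintegral_tsum fun k => (hf.indicator (hκ (measurableSet_singleton k))).aemeasurable]
    refine lintegral_congr fun x => ?_
    rw [tsum_eq_single (κ x) fun k hk => Set.indicator_of_notMem (by simpa using hk.symm) _]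
    simp
  rw [key hf, key hg]
  exact tsum_congr h

lemma measurable_splice {α : Type*} [MeasurableSpace α] (a : ℝ × Site d) {O : α → Set (Pt d)}
    {w w' : α → Noise d} (hO : Measurable O) (hw : Measurable w) (hw' : Measurable w') :
    Measurable fun x => splice a (O x) (w x) (w' x) := by
  have hg : Measurable fun x => graph a (w x) := measurable_graph measurable_const hw
  have hτ : Measurable fun x => hitTime (graph a (w x)) (O x) := measurable_hitTime hg hO
  have hξ := measurable_siteAt (a := fun _ : α => a) measurable_const hw hτ
  exact Measurable.ite (Measurable.set_nonempty (Measurable.set_inter hg hO))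
    (Measurable.set_union (Measurable.alive hg hO)
      (measurable_graph (hτ.prodMk hξ) hw')) hg

/-- The strong Markov property at the first visit to `O`. -/
theorem lintegral_graph_splice (P : WalkKernel d) (a : ℝ × Site d) (O : Set (Pt d))
    {Ψ : Set (Pt d) → ℝ≥0∞} (hΨ : Measurable Ψ) :
    ∫⁻ w, Ψ (graph a w) ∂(noiseLaw P) =
      ∫⁻ w, ∫⁻ w', Ψ (splice a O w w') ∂(noiseLaw P) ∂(noiseLaw P) := by
  classical
  have hg : Measurable (graph (d := d) a) := measurable_graph measurable_const measurable_id
  have hτ : Measurable fun w : Noise d => hitTime (graph a w) O :=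
    measurable_hitTime hg measurable_const
  have hN : MeasurableSet {w : Noise d | (graph a w ∩ O).Nonempty} :=
    Measurable.set_nonempty (Measurable.set_inter hg measurable_const)
  -- The partition is by the number of jumps before the visit, shifted by one so that 0 is left for
  -- paths that never visit `O`.
  have hκ : Measurable fun w : Noise d => if (graph a w ∩ O).Nonempty then
      stateAt w (hitTime (graph a w) O - a.1) + 1 else 0 :=
    Measurable.ite hN ((measurable_stateAt measurable_id (hτ.sub measurable_const)).add_const 1)
      measurable_const
  have hs : Measurable fun w => ∫⁻ w', Ψ (splice a O w w') ∂(noiseLaw P) :=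
    (hΨ.comp (measurable_splice a measurable_const measurable_fst
      measurable_snd)).lintegral_prod_right'
  refine lintegral_eq_of_partition hκ (hΨ.comp hg) hs fun k => ?_
  rcases k with _ | k
  · refine lintegral_congr fun w => ?_
    by_cases hw : (graph a w ∩ O).Nonempty
    · rw [Set.indicator_of_notMem (by simp [hw]), Set.indicator_of_notMem (by simp [hw])]
    · rw [Set.indicator_of_mem (by simp [hw]), Set.indicator_of_mem (by simp [hw])]
      simp [splice, hw]
  · have hE : ∀ w, Good w → (w ∈ (fun w : Noise d => if (graph a w ∩ O).Nonempty then
        stateAt w (hitTime (graph a w) O - a.1) + 1 else 0) ⁻¹' {k + 1} ↔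
        w ∈ meetsAtState a O k ∧ stateDelay a O k w < (w k).1) := by
      intro w hw
      simp only [Set.mem_preimage, Set.mem_singleton_iff]
      constructor
      · intro h
        by_cases hne : (graph a w ∩ O).Nonempty
        · rw [if_pos hne] at h
          exact state_of_hitTime hw hne (by omega)
        · rw [if_neg hne] at h; omega
      · rintro ⟨h1, h2⟩
        obtain ⟨g1, -, g3⟩ := hitTime_of_state hw h1 h2
        rw [if_pos g1, g3]
    have key := lintegral_noise_markov P k (hΨ.comp hg) (measurableSet_meetsAtState a O k)
      (measurable_stateDelay a O k) (mem_meetsAtState_join a O k)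
      (stateDelay_join a O k) (fun w hw => stateDelay_nonneg hw)
    rw [lintegral_congr_ae (g := fun w => {w : Noise d | w ∈ meetsAtState a O k ∧
      stateDelay a O k w < (w k).1}.indicator (Ψ ∘ graph a) w), key]
    · refine lintegral_congr_ae ?_
      filter_upwards [ae_good P] with w hw
      by_cases hh : w ∈ meetsAtState a O k ∧ stateDelay a O k w < (w k).1
      · rw [Set.indicator_of_mem (by exact hh), Set.indicator_of_mem ((hE w hw).2 hh)]
        refine lintegral_congr_ae ?_
        filter_upwards [ae_good P] with w' hw'
        rw [Function.comp_apply, graph_join_delay hw hw' hh.1 hh.2]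
      · rw [Set.indicator_of_notMem (by exact hh),
          Set.indicator_of_notMem (fun h => hh ((hE w hw).1 h))]
    · filter_upwards [ae_good P] with w hw
      by_cases hh : w ∈ meetsAtState a O k ∧ stateDelay a O k w < (w k).1
      · rw [Set.indicator_of_mem ((hE w hw).2 hh), Set.indicator_of_mem (by exact hh)]; rfl
      · rw [Set.indicator_of_notMem (fun h => hh ((hE w hw).1 h)),
          Set.indicator_of_notMem (by exact hh)]

/-! ### Sequential absorption -/

open scoped Classical in
/-- The factor `y` if `V` visits `Γ`, and `1` otherwise. -/
def weight (y : ℝ≥0∞) (V Γ : Set (Pt d)) : ℝ≥0∞ := if (V ∩ Γ).Nonempty then y else 1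

/-- Walks released from the points of a list are run one after the other, each one until it visits
the obstacle set, which is then enlarged by the graph of the walk up to that visit. The value
is the expectation of `y` to the number of absorbed walks times `Θ` of the final obstacle set. -/
def run (P : WalkKernel d) (y : ℝ≥0∞) (Θ : Set (Pt d) → ℝ≥0∞) :
    List (ℝ × Site d) → Set (Pt d) → ℝ≥0∞
  | [], Γ => Θ Γ
  | a :: l, Γ => ∫⁻ w, weight y (graph a w) Γ * run P y Θ l (Γ ∪ alive (graph a w) Γ) ∂(noiseLaw P)

lemma weight_of_hit {y : ℝ≥0∞} {V Γ : Set (Pt d)} (h : (V ∩ Γ).Nonempty) : weight y V Γ = y :=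
  if_pos h

lemma weight_of_not_hit {y : ℝ≥0∞} {V Γ : Set (Pt d)} (h : ¬ (V ∩ Γ).Nonempty) :
    weight y V Γ = 1 := if_neg h

lemma weight_congr {y : ℝ≥0∞} {V Γ V' Γ' : Set (Pt d)}
    (h : (V ∩ Γ).Nonempty ↔ (V' ∩ Γ').Nonempty) : weight y V Γ = weight y V' Γ' := by
  by_cases hV : (V ∩ Γ).Nonempty
  · rw [weight_of_hit hV, weight_of_hit (h.1 hV)]
  · rw [weight_of_not_hit hV, weight_of_not_hit (fun h' => hV (h.2 h'))]

lemma run_append (P : WalkKernel d) (y : ℝ≥0∞) (Θ : Set (Pt d) → ℝ≥0∞) (l l' : List (ℝ × Site d))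
    (Γ : Set (Pt d)) : run P y Θ (l ++ l') Γ = run P y (run P y Θ l') l Γ := by
  induction l generalizing Γ with
  | nil => rfl
  | cons a l ih => simp [run, ih]

section Measurability

variable {α : Type*} [MeasurableSpace α]

lemma Measurable.weight (y : ℝ≥0∞) {V O : α → Set (Pt d)} (hV : Measurable V) (hO : Measurable O) :
    Measurable fun x => weight y (V x) (O x) :=
  Measurable.ite (Measurable.set_nonempty (Measurable.set_inter hV hO)) measurable_const
    measurable_const

lemma measurable_run (P : WalkKernel d) (y : ℝ≥0∞) {Θ : Set (Pt d) → ℝ≥0∞} (hΘ : Measurable Θ)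
    (l : List (ℝ × Site d)) : Measurable (run P y Θ l) := by
  induction l with
  | nil => exact hΘ
  | cons a l ih =>
    have hg : Measurable fun q : Set (Pt d) × Noise d => graph a q.2 :=
      measurable_graph measurable_const measurable_snd
    exact ((Measurable.weight y hg measurable_fst).mul (ih.comp (Measurable.set_union measurable_fst
      (Measurable.alive hg measurable_fst)))).lintegral_prod_right'

end Measurability

/-! ### Paths started at a given time -/

/-- `F` is a set of space-time points with at most one site for each time, that starts at time `τ`
and stays at the site `ξ` for some time. -/
structure IsPathFrom (τ : ℝ) (ξ : Site d) (F : Set (Pt d)) : Prop where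
  ge : ∀ p ∈ F, τ ≤ p.1
  eq_of_time_eq : ∀ p ∈ F, ∀ p' ∈ F, p.1 = p'.1 → p = p'
  start : ∃ t', τ < t' ∧ ∀ q : ℚ, τ ≤ q → q < t' → (q, ξ) ∈ F

lemma Good.isPathFrom {w : Noise d} (hw : Good w) (a : ℝ × Site d) :
    IsPathFrom a.1 a.2 (graph a w) := by
  refine ⟨le_of_mem_graph hw, fun p hp p' hp' h => ?_, ?_⟩
  · refine Prod.ext h ?_
    rw [(hw.mem_graph.1 hp).2, (hw.mem_graph.1 hp').2, h]
  · obtain ⟨t', ht, h⟩ := hw.siteAt_const (a := a) le_rfl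
    refine ⟨t', ht, fun q h1 h2 => hw.mem_graph.2 ⟨h1, ?_⟩⟩
    have : stateAt w 0 = 0 := hw.stateAt_eq (by simp) (by simpa [arrival] using hw.1 0)
    rw [h q h1 h2, siteAt, sub_self, this, position_zero, add_zero]

lemma Good.isPathFrom_mk {w : Noise d} (hw : Good w) (τ : ℝ) (ξ : Site d) :
    IsPathFrom τ ξ (graph (τ, ξ) w) := hw.isPathFrom (τ, ξ)

lemma alive_eq_lt {V O : Set (Pt d)} {τ : ℝ} (h1 : ∀ p ∈ V, p ∈ O → τ ≤ p.1)
    (h2 : ∀ t, τ < t → ∃ p ∈ V, p ∈ O ∧ (p.1 : ℝ) < t) :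
    alive V O = {p | p ∈ V ∧ (p.1 : ℝ) < τ} := by
  ext p
  refine and_congr_right fun _ => ⟨?_, fun h => ?_⟩
  · rintro ⟨q, hq, h⟩
    by_contra hp
    obtain ⟨p', g1, g2, g3⟩ := h2 q (lt_of_le_of_lt (not_lt.1 hp) (by exact_mod_cast hq))
    have : (q : ℝ) ≤ p'.1 := by exact_mod_cast h p' g1 g2
    linarith
  · obtain ⟨q, g1, g2⟩ := exists_rat_btwn h
    refine ⟨q, by exact_mod_cast g1, fun p' hp' hO => ?_⟩
    have : (q : ℝ) ≤ p'.1 := g2.le.trans (h1 p' hp' hO)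
    exact_mod_cast this

lemma exists_hit_lt {V O : Set (Pt d)} (hne : (V ∩ O).Nonempty) {t : ℝ} (ht : hitTime V O < t) :
    ∃ p ∈ V, p ∈ O ∧ (p.1 : ℝ) < t := by
  obtain ⟨_, ⟨p, hp, rfl⟩, h⟩ := exists_lt_of_csInf_lt (hne.image _) ht
  exact ⟨p, hp.1, hp.2, h⟩

lemma hitTime_eq {V O : Set (Pt d)} {τ : ℝ} (h1 : ∀ p ∈ V, p ∈ O → τ ≤ p.1)
    (h2 : ∀ t, τ < t → ∃ p ∈ V, p ∈ O ∧ (p.1 : ℝ) < t) : hitTime V O = τ := by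
  obtain ⟨p, g1, g2, -⟩ := h2 (τ + 1) (by linarith)
  refine le_antisymm (le_of_forall_gt_imp_ge_of_dense fun t ht => ?_) (le_csInf ⟨_, p, ⟨g1, g2⟩, rfl⟩ ?_)
  · obtain ⟨p', k1, k2, k3⟩ := h2 t ht
    have hbd : BddBelow ((fun p : Pt d => (p.1 : ℝ)) '' (V ∩ O)) :=
      ⟨τ, by rintro _ ⟨p, hp, rfl⟩; exact h1 p hp.1 hp.2⟩
    exact (csInf_le hbd ⟨p', ⟨k1, k2⟩, rfl⟩).trans k3.le
  · rintro _ ⟨p, hp, rfl⟩; exact h1 p hp.1 hp.2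

/-- Absorption of a concatenated path whose first part is absorbed. -/
lemma alive_union_of_hit {V F A : Set (Pt d)} {τ : ℝ} (hV : ∀ p ∈ V, (p.1 : ℝ) < τ)
    (hF : ∀ p ∈ F, τ ≤ p.1) (h : (V ∩ A).Nonempty) : alive (V ∪ F) A = alive V A := by
  obtain ⟨p0, hp0, hA0⟩ := h
  ext p
  constructor
  · rintro ⟨hp | hp, q, hq, hh⟩
    · exact ⟨hp, q, hq, fun p' hp' => hh p' (Or.inl hp')⟩
    · have h1 := hh p0 (Or.inl hp0) hA0
      have h2 : (p0.1 : ℝ) < p.1 := (hV p0 hp0).trans_le (hF p hp)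
      have h3 : p0.1 < p.1 := by exact_mod_cast h2
      linarith
  · rintro ⟨hp, q, hq, hh⟩
    refine ⟨Or.inl hp, q, hq, fun p' hp' hA => ?_⟩
    rcases hp' with hp' | hp'
    · exact hh p' hp' hA
    · have h1 := hh p0 hp0 hA0
      have h2 : (p0.1 : ℝ) < p'.1 := (hV p0 hp0).trans_le (hF p' hp')
      have h3 : p0.1 < p'.1 := by exact_mod_cast h2
      linarith

/-- Absorption of a concatenated path whose first part is not absorbed. -/
lemma alive_union_of_not_hit {V F A : Set (Pt d)} {τ : ℝ} (hV : ∀ p ∈ V, (p.1 : ℝ) < τ)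
    (hF : ∀ p ∈ F, τ ≤ p.1) (h : ¬ (V ∩ A).Nonempty) : alive (V ∪ F) A = V ∪ alive F A := by
  have hVA : ∀ p ∈ V, p ∉ A := fun p h1 h2 => h ⟨p, h1, h2⟩
  ext p
  constructor
  · rintro ⟨hp | hp, q, hq, hh⟩
    · exact Or.inl hp
    · exact Or.inr ⟨hp, q, hq, fun p' hp' => hh p' (Or.inr hp')⟩
  · rintro (hp | ⟨hp, q, hq, hh⟩)
    · obtain ⟨q, h1, h2⟩ := exists_rat_btwn (hV p hp)
      refine ⟨Or.inl hp, q, by exact_mod_cast h1, fun p' hp' hA => ?_⟩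
      rcases hp' with hp' | hp'
      · exact absurd hA (hVA p' hp')
      · have : (q : ℝ) ≤ p'.1 := h2.le.trans (hF p' hp')
        exact_mod_cast this
    · refine ⟨Or.inr hp, q, hq, fun p' hp' hA => ?_⟩
      rcases hp' with hp' | hp'
      · exact absurd hA (hVA p' hp')
      · exact hh p' hp' hA

/-- A path already absorbed by `Γ` cannot feel obstacles that it would meet only later. -/
lemma alive_union_of_disjoint {B Γ X : Set (Pt d)} (h : ¬ (alive B Γ ∩ X).Nonempty) :
    alive B (Γ ∪ X) = alive B Γ := by
  ext p
  constructor
  · rintro ⟨hp, q, hq, hh⟩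
    exact ⟨hp, q, hq, fun p' hp' hA => hh p' hp' (Or.inl hA)⟩
  · rintro ⟨hp, q, hq, hh⟩
    refine ⟨hp, q, hq, fun p' hp' hA => ?_⟩
    rcases hA with hA | hA
    · exact hh p' hp' hA
    · by_contra hlt
      exact h ⟨p', ⟨hp', q, not_le.1 hlt, hh⟩, hA⟩

lemma hits_union_of_disjoint {B Γ X : Set (Pt d)} (h : ¬ (alive B Γ ∩ X).Nonempty) :
    (B ∩ (Γ ∪ X)).Nonempty ↔ (B ∩ Γ).Nonempty := by
  constructor
  · rintro ⟨p, hp, hA | hA⟩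
    · exact ⟨p, hp, hA⟩
    · by_contra hB
      rw [alive_eq_self hB] at h
      exact h ⟨p, hp, hA⟩
  · rintro ⟨p, hp, hA⟩
    exact ⟨p, hp, Or.inl hA⟩

/-! ### Meeting of two walks -/

section Meeting

variable {a b : ℝ × Site d} {wa wb : Noise d} {Γ O F : Set (Pt d)}

lemma eq_site_near {t' : ℝ} (hwa : Good wa) {τ : ℝ}
    (hs : ∀ s, τ ≤ s → s < t' → siteAt a wa s = siteAt a wa τ) {p : Pt d} (hp : p ∈ graph a wa)
    (h1 : τ ≤ p.1) (h2 : p.1 < t') : p = (p.1, siteAt a wa τ) :=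
  Prod.ext rfl ((hwa.mem_graph.1 hp).2.trans (hs _ h1 h2))

lemma le_hitTime (hwa : Good wa) (hO : (graph a wa ∩ O).Nonempty) : a.1 ≤ hitTime (graph a wa) O := by
  refine le_csInf (hO.image _) ?_
  rintro _ ⟨p, hp, rfl⟩
  exact le_of_mem_graph hwa p hp.1

/-- Near the first visit to `O`, a walk and the path that restarts there agree. -/
lemma exists_near (hwa : Good wa) (hO : (graph a wa ∩ O).Nonempty)
    (hF : IsPathFrom (hitTime (graph a wa) O) (siteAt a wa (hitTime (graph a wa) O)) F) :
    ∃ t', hitTime (graph a wa) O < t' ∧ ∀ p : Pt d, hitTime (graph a wa) O ≤ p.1 → (p.1 : ℝ) < t' →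
      (p ∈ graph a wa ↔ p ∈ F) := by
  have hge := le_hitTime hwa hO
  set τ := hitTime (graph a wa) O
  obtain ⟨t1, ht1, h1⟩ := hwa.siteAt_const (a := a) hge
  obtain ⟨t2, ht2, h2⟩ := hF.start
  refine ⟨min t1 t2, lt_min ht1 ht2, fun p hp1 hp2 => ?_⟩
  have g1 := hp2.trans_le (min_le_left _ _)
  have g2 := hp2.trans_le (min_le_right _ _)
  constructor
  · intro hp
    rw [eq_site_near hwa h1 hp hp1 g1]
    exact h2 _ hp1 g2
  · intro hp
    have : p = (p.1, siteAt a wa τ) := hF.eq_of_time_eq _ hp _ (h2 p.1 hp1 g2) rfl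
    rw [this]
    exact hwa.mem_graph.2 ⟨hge.trans hp1, (h1 _ hp1 g1).symm⟩

lemma mem_pre_iff (hwa : Good wa) (hO : (graph a wa ∩ O).Nonempty) {p : Pt d} :
    p ∈ alive (graph a wa) O ↔ p ∈ graph a wa ∧ (p.1 : ℝ) < hitTime (graph a wa) O :=
  mem_alive_iff (le_of_mem_graph hwa) hO

/-- If the walk is absorbed by `Γ` before it visits `O`, the continuation after the visit to `O`
does not matter. -/
lemma restart_of_dead (hwa : Good wa) (hO : (graph a wa ∩ O).Nonempty)
    (hF : IsPathFrom (hitTime (graph a wa) O) (siteAt a wa (hitTime (graph a wa) O)) F)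
    (hM : ¬ (alive (graph a wa) Γ ∩ O).Nonempty) :
    alive (alive (graph a wa) O ∪ F) Γ = alive (graph a wa) Γ ∧
      (((alive (graph a wa) O ∪ F) ∩ Γ).Nonempty ↔ (graph a wa ∩ Γ).Nonempty) := by
  obtain ⟨t', ht', hnear⟩ := exists_near hwa hO hF
  have hpre : ∀ p, p ∈ alive (graph a wa) O ↔ _ := fun p => mem_pre_iff hwa hO
  have hge := le_hitTime hwa hO
  have hlt := fun t => exists_hit_lt (t := t) hO
  set τ := hitTime (graph a wa) O
  set A := graph a wa
  -- If the restarted path survived past `τ`, then the original path, which agrees with it just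
  -- after `τ`, would be alive at visits to `O` arbitrarily close to `τ`, against `hM`.
  have hdead : ∀ p ∈ F, p ∉ alive (alive A O ∪ F) Γ := by
    rintro p hp ⟨-, q, hq, hh⟩
    have hτq : τ < q := lt_of_le_of_lt (hF.ge p hp) (by exact_mod_cast hq)
    obtain ⟨p2, hA2, hO2, h2⟩ := hlt (min t' q) (lt_min ht' hτq)
    obtain ⟨q2, g1, g2⟩ := exists_rat_btwn h2
    refine hM ⟨p2, ⟨hA2, q2, by exact_mod_cast g1, fun p3 hA3 hΓ3 => ?_⟩, hO2⟩
    by_contra hlt3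
    have hlt3' : (p3.1 : ℝ) < q2 := by exact_mod_cast not_le.1 hlt3
    have hmem : p3 ∈ alive A O ∪ F := by
      rcases lt_or_ge (p3.1 : ℝ) τ with h3 | h3
      · exact Or.inl ((hpre p3).2 ⟨hA3, h3⟩)
      · exact Or.inr ((hnear p3 h3 (hlt3'.trans (g2.trans_le (min_le_left _ _)))).1 hA3)
    have : (q : ℝ) ≤ p3.1 := by exact_mod_cast hh p3 hmem hΓ3
    linarith [g2.trans_le (min_le_right t' (q : ℝ))]
  have hdead' : ∀ p ∈ alive A Γ, (p.1 : ℝ) < τ := by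
    rintro p ⟨hp, q, hq, hh⟩
    by_contra h
    have hτq : τ < q := lt_of_le_of_lt (not_lt.1 h) (by exact_mod_cast hq)
    obtain ⟨p2, hA2, hO2, h2⟩ := hlt q hτq
    exact hM ⟨p2, ⟨hA2, q, by exact_mod_cast h2, hh⟩, hO2⟩
  refine ⟨?_, ?_⟩
  · ext p
    constructor
    · intro hp
      rcases hp.1 with hpV | hpF
      · have h1 := (hpre p).1 hpV
        obtain ⟨-, q, hq, hh⟩ := hp
        obtain ⟨q2, g1, g2⟩ := exists_rat_btwn (lt_min h1.2 (show (p.1 : ℝ) < q by exact_mod_cast hq))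
        refine ⟨h1.1, q2, by exact_mod_cast g1, fun p' hp' hΓ => ?_⟩
        rcases lt_or_ge (p'.1 : ℝ) τ with h3 | h3
        · have : q ≤ p'.1 := hh p' (Or.inl ((hpre p').2 ⟨hp', h3⟩)) hΓ
          have h4 : (q : ℝ) ≤ p'.1 := by exact_mod_cast this
          have : (q2 : ℝ) ≤ p'.1 := (g2.trans_le (min_le_right _ _)).le.trans h4
          exact_mod_cast this
        · have : (q2 : ℝ) ≤ p'.1 := (g2.trans_le (min_le_left _ _)).le.trans h3
          exact_mod_cast this
      · exact absurd hp (hdead p hpF)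
    · intro hp
      have h1 := hdead' p hp
      obtain ⟨hpA, q, hq, hh⟩ := hp
      obtain ⟨q2, g1, g2⟩ := exists_rat_btwn (lt_min h1 (show (p.1 : ℝ) < q by exact_mod_cast hq))
      refine ⟨Or.inl ((hpre p).2 ⟨hpA, h1⟩), q2, by exact_mod_cast g1, fun p' hp' hΓ => ?_⟩
      rcases hp' with hp' | hp'
      · have h4 : (q : ℝ) ≤ p'.1 := by exact_mod_cast hh p' ((hpre p').1 hp').1 hΓ
        have : (q2 : ℝ) ≤ p'.1 := (g2.trans_le (min_le_right _ _)).le.trans h4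
        exact_mod_cast this
      · have : (q2 : ℝ) ≤ p'.1 := (g2.trans_le (min_le_left _ _)).le.trans (hF.ge p' hp')
        exact_mod_cast this
  · have h1 : (A ∩ Γ).Nonempty := by
      by_contra h
      rw [alive_eq_self h] at hM
      exact hM hO
    have h2 : ((alive A O ∪ F) ∩ Γ).Nonempty := by
      by_contra h
      obtain ⟨t2, ht2, hst⟩ := hF.start
      obtain ⟨q, k1, k2⟩ := exists_rat_btwn ht2
      have hq := hst q k1.le k2
      refine hdead _ hq ?_
      rw [alive_eq_self h]
      exact Or.inr hq
    simp [h1, h2]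

/-- The situation at the first meeting of two walks that have not been absorbed by `Γ`. -/
lemma restart_of_meet (hwa : Good wa) (hwb : Good wb)
    (hM : (alive (graph a wa) Γ ∩ alive (graph b wb) Γ).Nonempty)
    (hF : IsPathFrom (hitTime (graph a wa) (alive (graph b wb) Γ))
      (siteAt a wa (hitTime (graph a wa) (alive (graph b wb) Γ))) F) :
    alive (alive (graph a wa) (alive (graph b wb) Γ) ∪ F) Γ =
        alive (graph a wa) (alive (graph b wb) Γ) ∪ alive F Γ ∧
      (((alive (graph a wa) (alive (graph b wb) Γ) ∪ F) ∩ Γ).Nonempty ↔ (F ∩ Γ).Nonempty) ∧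
      (graph b wb ∩ (Γ ∪ alive (alive (graph a wa) (alive (graph b wb) Γ) ∪ F) Γ)).Nonempty ∧
      alive (graph b wb) (Γ ∪ alive (alive (graph a wa) (alive (graph b wb) Γ) ∪ F) Γ) =
        alive (graph b wb) (alive (graph a wa) Γ) ∧
      hitTime (graph b wb) (alive (graph a wa) Γ) = hitTime (graph a wa) (alive (graph b wb) Γ) ∧
      siteAt b wb (hitTime (graph a wa) (alive (graph b wb) Γ)) =
        siteAt a wa (hitTime (graph a wa) (alive (graph b wb) Γ)) := by
  obtain ⟨p0, ⟨hp0A, q0, hq0, hh0⟩, hp0B⟩ := hM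
  have hO : (graph a wa ∩ alive (graph b wb) Γ).Nonempty := ⟨p0, hp0A, hp0B⟩
  obtain ⟨t', ht', hnear⟩ := exists_near hwa hO hF
  have hpre : ∀ p, p ∈ alive (graph a wa) (alive (graph b wb) Γ) ↔ _ := fun p => mem_pre_iff hwa hO
  have hge := le_hitTime hwa hO
  have hle : ∀ p ∈ graph a wa, p ∈ alive (graph b wb) Γ →
      hitTime (graph a wa) (alive (graph b wb) Γ) ≤ p.1 :=
    fun p => hitTime_le (le_of_mem_graph hwa)
  have hlt := fun t => exists_hit_lt (t := t) hO
  set τ := hitTime (graph a wa) (alive (graph b wb) Γ)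
  set A := graph a wa
  set B := graph b wb
  have hτq : τ < q0 := lt_of_le_of_lt (hle p0 hp0A hp0B) (by exact_mod_cast hq0)
  have hq0' : ∀ p ∈ A, p ∈ Γ → (q0 : ℝ) ≤ p.1 := fun p h1 h2 => by exact_mod_cast hh0 p h1 h2
  have hpreΓ : ¬ (alive A (alive B Γ) ∩ Γ).Nonempty := by
    rintro ⟨p, hp, hΓ⟩
    have := (hpre p).1 hp
    linarith [hq0' p this.1 hΓ]
  have hVlt : ∀ p ∈ alive A (alive B Γ), (p.1 : ℝ) < τ := fun p hp => ((hpre p).1 hp).2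
  have hFΓ : ∀ p ∈ F, p ∈ Γ → min t' (q0 : ℝ) ≤ p.1 := by
    intro p hp hΓ
    by_contra h
    have h' := not_le.1 h
    have := (hnear p (hF.ge p hp) (h'.trans_le (min_le_left _ _))).2 hp
    linarith [hq0' p this hΓ, h'.trans_le (min_le_right t' (q0 : ℝ))]
  have hmin : τ < min t' q0 := lt_min ht' hτq
  -- The meeting time `τ` need not be rational. Joint visits at rational times arbitrarily soon
  -- after `τ` replace a visit at `τ` itself.
  have hmeet : ∀ t, τ < t → ∃ p, p ∈ A ∧ p ∈ alive B Γ ∧ p ∈ alive A Γ ∧ p ∈ alive F Γ ∧ τ ≤ p.1 ∧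
      (p.1 : ℝ) < t := by
    intro t ht
    obtain ⟨p2, hA2, hB2, h2⟩ := hlt (min t (min t' q0)) (lt_min ht hmin)
    have g1 := h2.trans_le (min_le_right _ _)
    refine ⟨p2, hA2, hB2, ⟨hA2, q0, ?_, hh0⟩, ⟨?_, ?_⟩, hle p2 hA2 hB2, h2.trans_le (min_le_left _ _)⟩
    · exact_mod_cast g1.trans_le (min_le_right _ _)
    · exact (hnear p2 (hle p2 hA2 hB2) (g1.trans_le (min_le_left _ _))).1 hA2
    · obtain ⟨q, k1, k2⟩ := exists_rat_btwn g1
      refine ⟨q, by exact_mod_cast k1, fun p hp hΓ => ?_⟩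
      have := k2.le.trans (hFΓ p hp hΓ)
      exact_mod_cast this
  have e1 := alive_union_of_not_hit hVlt hF.ge hpreΓ
  have hBτ : ∀ p ∈ B, (p.1 : ℝ) < τ → p ∈ alive B Γ := by
    intro p hp h
    obtain ⟨q, h1, h2⟩ := hp0B.2
    have : (p.1 : ℝ) < p0.1 := h.trans_le (hle p0 hp0A hp0B)
    refine ⟨hp, q, lt_trans ?_ h1, h2⟩
    exact_mod_cast this
  have hBΓ : ∀ p ∈ B, p ∈ Γ → τ ≤ p.1 := by
    intro p hp hΓ
    by_contra h
    obtain ⟨q, h1, h2⟩ := (hBτ p hp (not_le.1 h)).2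
    exact absurd (h2 p hp hΓ) (not_le.2 h1)
  have hBA : ∀ p ∈ B, p ∈ A → τ ≤ p.1 := by
    intro p hp hA
    by_contra h
    exact h (hle p hA (hBτ p hp (not_le.1 h)))
  have k1 : ∀ p ∈ B, p ∈ Γ ∪ alive (alive A (alive B Γ) ∪ F) Γ → τ ≤ p.1 := by
    intro p hp h
    rw [e1] at h
    rcases h with h | h | h
    · exact hBΓ p hp h
    · exact hBA p hp ((hpre p).1 h).1
    · exact hF.ge p h.1
  have k2 : ∀ t, τ < t → ∃ p ∈ B, p ∈ Γ ∪ alive (alive A (alive B Γ) ∪ F) Γ ∧ (p.1 : ℝ) < t := by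
    intro t ht
    obtain ⟨p, -, g2, -, g4, -, g6⟩ := hmeet t ht
    refine ⟨p, g2.1, ?_, g6⟩
    rw [e1]
    exact Or.inr (Or.inr g4)
  have k3 : ∀ p ∈ B, p ∈ alive A Γ → τ ≤ p.1 := fun p hp h => hBA p hp h.1
  have k4 : ∀ t, τ < t → ∃ p ∈ B, p ∈ alive A Γ ∧ (p.1 : ℝ) < t := by
    intro t ht
    obtain ⟨p, -, g2, g3, -, -, g6⟩ := hmeet t ht
    exact ⟨p, g2.1, g3, g6⟩
  refine ⟨e1, ?_, ?_, ?_, hitTime_eq k3 k4, ?_⟩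
  · constructor
    · rintro ⟨p, hp | hp, hΓ⟩
      · exact absurd ⟨p, hp, hΓ⟩ hpreΓ
      · exact ⟨p, hp, hΓ⟩
    · rintro ⟨p, hp, hΓ⟩; exact ⟨p, Or.inr hp, hΓ⟩
  · obtain ⟨p, g1, g2, -⟩ := k2 (τ + 1) (by linarith)
    exact ⟨p, g1, g2⟩
  · rw [alive_eq_lt k1 k2, alive_eq_lt k3 k4]
  · have hbτ : b.1 ≤ τ := by
      by_contra h
      obtain ⟨p, -, g2, -, -, -, g6⟩ := hmeet b.1 (not_le.1 h)
      linarith [le_of_mem_graph hwb p g2.1]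
    obtain ⟨ta, hta, ha⟩ := hwa.siteAt_const (a := a) hge
    obtain ⟨tb, htb, hb⟩ := hwb.siteAt_const (a := b) hbτ
    obtain ⟨p, g1, g2, -, -, g5, g6⟩ := hmeet (min ta tb) (lt_min hta htb)
    have f1 := eq_site_near hwa ha g1 g5 (g6.trans_le (min_le_left _ _))
    have f2 := eq_site_near hwb hb g2.1 g5 (g6.trans_le (min_le_right _ _))
    rw [f1] at f2
    exact (Prod.ext_iff.1 f2).2.symm

end Meeting

/-- The contribution of two walks with graphs `A` and `B`, the first one being run first. -/
def pairValue (y : ℝ≥0∞) (Θ : Set (Pt d) → ℝ≥0∞) (Γ A B : Set (Pt d)) : ℝ≥0∞ :=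
  weight y A Γ * (weight y B (Γ ∪ alive A Γ) *
    Θ (Γ ∪ alive A Γ ∪ alive B (Γ ∪ alive A Γ)))

lemma pairValue_of_disjoint (y : ℝ≥0∞) (Θ : Set (Pt d) → ℝ≥0∞) {Γ A B : Set (Pt d)}
    (h : ¬ (alive A Γ ∩ alive B Γ).Nonempty) :
    pairValue y Θ Γ A B = weight y A Γ * (weight y B Γ * Θ (Γ ∪ alive A Γ ∪ alive B Γ)) := by
  rw [Set.inter_comm] at h
  rw [pairValue, alive_union_of_disjoint h, weight_congr (hits_union_of_disjoint h)]

/-- If the two walks meet while both are alive, exactly one is absorbed there and the other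
continues along `w'`. In either order the final obstacle set consists of `Γ`, the two pieces before
the meeting, and the live part of the continuation. If they do not meet alive, the continuation is
irrelevant and the value is symmetric. -/
lemma splice_swap {y : ℝ≥0∞} {Θ : Set (Pt d) → ℝ≥0∞} {Γ : Set (Pt d)} {a b : ℝ × Site d}
    {wa wb w' : Noise d} (ha : Good wa) (hb : Good wb) (hw' : Good w') :
    pairValue y Θ Γ (splice a (alive (graph b wb) Γ) wa w') (graph b wb) =
      pairValue y Θ Γ (splice b (alive (graph a wa) Γ) wb w') (graph a wa) := by
  by_cases hM : (alive (graph a wa) Γ ∩ alive (graph b wb) Γ).Nonempty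
  · have hM' : (alive (graph b wb) Γ ∩ alive (graph a wa) Γ).Nonempty := by
      rwa [Set.inter_comm]
    have hOa : (graph a wa ∩ alive (graph b wb) Γ).Nonempty :=
      hM.mono (Set.inter_subset_inter_left _ (alive_subset _ _))
    have hOb : (graph b wb ∩ alive (graph a wa) Γ).Nonempty :=
      hM'.mono (Set.inter_subset_inter_left _ (alive_subset _ _))
    obtain ⟨e1, e2, e3, e4, e5, e6⟩ := restart_of_meet ha hb hM (hw'.isPathFrom_mk _ _)
    obtain ⟨f1, f2, f3, f4, f5, f6⟩ := restart_of_meet hb ha hM' (hw'.isPathFrom_mk _ _)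
    simp only [splice, if_pos hOa, if_pos hOb]
    rw [pairValue, pairValue, weight_of_hit e3, weight_of_hit f3, e4, f4, e1, f1, weight_congr e2,
      weight_congr f2, e5, e6]
    congr 3
    ext p
    simp only [Set.mem_union]
    tauto
  · have key : ∀ {a b : ℝ × Site d} {wa wb : Noise d}, Good wa → Good wb →
        ¬ (alive (graph a wa) Γ ∩ alive (graph b wb) Γ).Nonempty →
        pairValue y Θ Γ (splice a (alive (graph b wb) Γ) wa w') (graph b wb) =
          weight y (graph a wa) Γ * (weight y (graph b wb) Γ *
            Θ (Γ ∪ alive (graph a wa) Γ ∪ alive (graph b wb) Γ)) := by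
      intro a b wa wb ha hb hM
      by_cases hO : (graph a wa ∩ alive (graph b wb) Γ).Nonempty
      · obtain ⟨e1, e2⟩ := restart_of_dead ha hO (hw'.isPathFrom_mk _ _) hM
        rw [splice, if_pos hO, pairValue_of_disjoint, e1, weight_congr e2]
        rwa [e1]
      · rw [splice, if_neg hO, pairValue_of_disjoint _ _ hM]
    rw [key ha hb hM, key hb ha (by rwa [Set.inter_comm])]
    rw [mul_left_comm]
    congr 3
    rw [Set.union_assoc, Set.union_comm (alive _ _), ← Set.union_assoc]

/-- The order in which two walks are run does not matter. -/
theorem run_swap (P : WalkKernel d) (y : ℝ≥0∞) {Θ : Set (Pt d) → ℝ≥0∞} (hΘ : Measurable Θ)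
    (a b : ℝ × Site d) (l : List (ℝ × Site d)) (Γ : Set (Pt d)) :
    run P y Θ (a :: b :: l) Γ = run P y Θ (b :: a :: l) Γ := by
  set Θ' := run P y Θ l with hΘ'
  have hΘm : Measurable Θ' := measurable_run P y hΘ l
  have hpm : ∀ {α : Type} [MeasurableSpace α] {A B : α → Set (Pt d)}, Measurable A →
      Measurable B → Measurable fun x => pairValue y Θ' Γ (A x) (B x) := by
    intro α _ A B hA hB
    have h1 : Measurable fun x => Γ ∪ alive (A x) Γ :=
      Measurable.set_union measurable_const (Measurable.alive hA measurable_const)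
    exact (Measurable.weight y hA measurable_const).mul ((Measurable.weight y hB h1).mul
      (hΘm.comp (Measurable.set_union h1 (Measurable.alive hB h1))))
  have hg : ∀ {α : Type} [MeasurableSpace α] (a : ℝ × Site d) {w : α → Noise d}, Measurable w →
      Measurable fun x => graph a (w x) := fun a _ h => measurable_graph measurable_const h
  -- The walk run first is resampled at its first visit to the live part of the other one. Both
  -- orders then become integrals over the same three noises, with integrands equal by
  -- `splice_swap`.
  have key : ∀ a b : ℝ × Site d, run P y Θ (a :: b :: l) Γ =
      ∫⁻ wb, ∫⁻ wa, ∫⁻ w', pairValue y Θ' Γ (splice a (alive (graph b wb) Γ) wa w') (graph b wb)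
        ∂(noiseLaw P) ∂(noiseLaw P) ∂(noiseLaw P) := by
    intro a b
    have h1 : run P y Θ (a :: b :: l) Γ = ∫⁻ wa, ∫⁻ wb, pairValue y Θ' Γ (graph a wa) (graph b wb)
        ∂(noiseLaw P) ∂(noiseLaw P) := by
      simp only [run, ← hΘ', pairValue]
      refine lintegral_congr fun wa => (lintegral_const_mul _ ?_).symm
      have h1 : Measurable fun _ : Noise d => Γ ∪ alive (graph a wa) Γ := measurable_const
      have hg' : Measurable (graph (d := d) b) := hg b measurable_id
      exact (Measurable.weight y hg' h1).mul
        (hΘm.comp (Measurable.set_union h1 (Measurable.alive hg' h1)))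
    rw [h1, lintegral_lintegral_swap]
    · refine lintegral_congr fun wb => ?_
      exact lintegral_graph_splice P a (alive (graph b wb) Γ)
        (Ψ := fun A => pairValue y Θ' Γ A (graph b wb)) (hpm measurable_id measurable_const)
    · exact (hpm (hg a measurable_fst) (hg b measurable_snd)).aemeasurable
  rw [key a b, key b a, lintegral_lintegral_swap]
  · refine lintegral_congr_ae ?_
    filter_upwards [ae_good P] with wa ha
    refine lintegral_congr_ae ?_
    filter_upwards [ae_good P] with wb hb
    refine lintegral_congr_ae ?_
    filter_upwards [ae_good P] with w' hw'
    exact splice_swap ha hb hw'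
  · have hgb : Measurable fun q : (Noise d × Noise d) × Noise d => graph b q.1.1 :=
      hg b measurable_fst.fst
    exact (Measurable.lintegral_prod_right' (f := fun q : (Noise d × Noise d) × Noise d =>
      pairValue y Θ' Γ (splice a (alive (graph b q.1.1) Γ) q.1.2 q.2) (graph b q.1.1))
      (hpm (measurable_splice a (Measurable.alive hgb measurable_const) measurable_fst.snd
        measurable_snd) hgb)).aemeasurable

/-! ### Monotonicity of the generating function -/

lemma one_le_weight {y : ℝ≥0∞} (hy : 1 ≤ y) (V Γ : Set (Pt d)) : 1 ≤ weight y V Γ := by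
  unfold weight; split_ifs <;> simp [hy]

lemma weight_le {y : ℝ≥0∞} (hy : 1 ≤ y) (V Γ : Set (Pt d)) : weight y V Γ ≤ y := by
  unfold weight; split_ifs <;> simp [hy]

/-- The expectation of `y` to the number of absorbed walks. -/
abbrev gen (P : WalkKernel d) (y : ℝ≥0∞) (l : List (ℝ × Site d)) (Γ : Set (Pt d)) : ℝ≥0∞ :=
  run P y (fun _ => 1) l Γ

lemma measurable_gen (P : WalkKernel d) (y : ℝ≥0∞) (l : List (ℝ × Site d)) :
    Measurable (gen P y l) := measurable_run P y measurable_const l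

/-- One more walk increases the number of absorbed walks by at most one. -/
theorem gen_cons_le (P : WalkKernel d) {y : ℝ≥0∞} (hy : 1 ≤ y) (a : ℝ × Site d)
    (l : List (ℝ × Site d)) (Γ : Set (Pt d)) (hyt : y ≠ ∞) :
    gen P y (a :: l) Γ ≤ y * gen P y l Γ := by
  induction l generalizing Γ with
  | nil =>
    simp only [run, mul_one]
    calc _ ≤ ∫⁻ _, y ∂(noiseLaw P) := lintegral_mono fun w => weight_le hy _ _
      _ = y := by simp
  | cons b l ih =>
    -- The new walk is moved behind `b`; repeating this, it is run last, where its effect is at most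
    -- one factor `y`.
    rw [gen, run_swap P y measurable_const, gen, run, run, ← lintegral_const_mul' _ _ hyt]
    refine lintegral_mono fun w => ?_
    rw [mul_left_comm]
    exact mul_le_mul_right (ih _) _

/-- One more walk does not decrease the number of absorbed walks. -/
theorem le_gen_cons (P : WalkKernel d) {y : ℝ≥0∞} (hy : 1 ≤ y) (a : ℝ × Site d)
    (l : List (ℝ × Site d)) (Γ : Set (Pt d)) : gen P y l Γ ≤ gen P y (a :: l) Γ := by
  induction l generalizing Γ with
  | nil =>
    simp only [run, mul_one]
    calc (1 : ℝ≥0∞) = ∫⁻ _, 1 ∂(noiseLaw P) := by simp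
      _ ≤ _ := lintegral_mono fun w => one_le_weight hy _ _
  | cons b l ih =>
    rw [gen, gen, run_swap P y measurable_const, run, run]
    exact lintegral_mono fun w => mul_le_mul_right (ih _) _

/-- Removing walks when they visit `O` does not increase the number of absorbed walks. -/
theorem lintegral_kill_le (P : WalkKernel d) {y : ℝ≥0∞} (hy : 1 ≤ y) (a : ℝ × Site d)
    (l : List (ℝ × Site d)) (A O : Set (Pt d)) :
    ∫⁻ w, weight y (alive (graph a w) O) A * gen P y l (A ∪ alive (alive (graph a w) O) A)
        ∂(noiseLaw P) ≤ gen P y (a :: l) A := by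
  have hΨ : Measurable fun V : Set (Pt d) => weight y V A * gen P y l (A ∪ alive V A) :=
    (Measurable.weight y measurable_id measurable_const).mul ((measurable_gen P y l).comp
      (Measurable.set_union measurable_const (Measurable.alive measurable_id measurable_const)))
  have e := lintegral_graph_splice P a O hΨ
  rw [gen, run]
  refine le_trans (lintegral_mono_ae ?_) e.symm.le
  filter_upwards [ae_good P] with w hw
  by_cases hO : (graph a w ∩ O).Nonempty
  · simp only [splice, if_pos hO]
    have hV : ∀ p ∈ alive (graph a w) O, (p.1 : ℝ) < hitTime (graph a w) O :=
      fun p hp => ((mem_pre_iff hw hO).1 hp).2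
    set V := alive (graph a w) O
    set τ := hitTime (graph a w) O
    by_cases hA : (V ∩ A).Nonempty
    · calc _ = ∫⁻ _, weight y V A * gen P y l (A ∪ alive V A) ∂(noiseLaw P) := by simp
        _ ≤ _ := by
          refine lintegral_mono_ae ?_
          filter_upwards [ae_good P] with w' hw'
          have h1 : ((V ∪ graph (τ, siteAt a w τ) w') ∩ A).Nonempty :=
            hA.mono (Set.inter_subset_inter_left _ Set.subset_union_left)
          rw [alive_union_of_hit hV (le_of_mem_graph hw') hA, weight_of_hit hA, weight_of_hit h1]
    · have h1 : weight y V A = 1 := weight_of_not_hit hA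
      rw [alive_eq_self hA, h1, one_mul]
      -- The killed walk leaves the obstacle `V`. Restoring its continuation amounts to adding a
      -- walk released at the place and time of the killing, which does not lower `gen`.
      refine (le_gen_cons P hy (τ, siteAt a w τ) l (A ∪ V)).trans ?_
      rw [gen, run]
      refine lintegral_mono_ae ?_
      filter_upwards [ae_good P] with w' hw'
      have hF : ∀ p ∈ graph (τ, siteAt a w τ) w', τ ≤ p.1 := le_of_mem_graph hw'
      set F := graph (τ, siteAt a w τ) w'
      have hFV : ¬ (alive F A ∩ V).Nonempty := by
        rintro ⟨p, hp, hp'⟩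
        linarith [hF p hp.1, hV p hp']
      have h2 : ((V ∪ F) ∩ A).Nonempty ↔ (F ∩ (A ∪ V)).Nonempty := by
        rw [hits_union_of_disjoint hFV]
        constructor
        · rintro ⟨p, hp | hp, hpA⟩
          · exact absurd ⟨p, hp, hpA⟩ hA
          · exact ⟨p, hp, hpA⟩
        · rintro ⟨p, hp, hpA⟩; exact ⟨p, Or.inr hp, hpA⟩
      rw [alive_union_of_not_hit hV hF hA, alive_union_of_disjoint hFV, ← Set.union_assoc]
      rw [weight_congr h2]
  · simp [splice, hO, alive_eq_self hO]

/-! ### The heat kernel bound -/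

/-- The pairing of a frequency with a site. -/
def dot (θ : Fin d → ℝ) (z : Site d) : ℝ := ∑ i, θ i * z i

lemma dot_add (θ : Fin d → ℝ) (x y : Site d) : dot θ (x + y) = dot θ x + dot θ y := by
  simp [dot, mul_add, Finset.sum_add_distrib]
lemma dot_neg (θ : Fin d → ℝ) (x : Site d) : dot θ (-x) = -dot θ x := by
  simp [dot]
lemma dot_sub (θ : Fin d → ℝ) (x y : Site d) : dot θ (x - y) = dot θ x - dot θ y := by
  rw [sub_eq_add_neg, dot_add, dot_neg, sub_eq_add_neg]

lemma measurable_dot : Measurable fun q : (Fin d → ℝ) × Site d => dot q.1 q.2 := by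
  refine measurable_from_prod_countable_left fun z => ?_
  unfold dot; fun_prop

/-- One minus the real part of the characteristic function of a step. -/
def gap (P : WalkKernel d) (θ : Fin d → ℝ) : ℝ := ∫ z, (1 - Real.cos (dot θ z)) ∂(dualStepLaw P)

/-- The characteristic function of a step. -/
def stepChar (P : WalkKernel d) (θ : Fin d → ℝ) : ℂ :=
  ∫ z, Complex.exp (dot θ z * Complex.I) ∂(dualStepLaw P)

lemma integrable_cos (P : WalkKernel d) (θ : Fin d → ℝ) :
    Integrable (fun z => Real.cos (dot θ z)) (dualStepLaw P) :=
  Integrable.of_bound (C := 1) (measurable_of_countable _).aestronglyMeasurable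
    (.of_forall fun z => by simpa using Real.abs_cos_le_one _)

lemma integrable_one_sub_cos (P : WalkKernel d) (θ : Fin d → ℝ) :
    Integrable (fun z => 1 - Real.cos (dot θ z)) (dualStepLaw P) :=
  (integrable_const _).sub (integrable_cos P θ)

lemma integrable_exp_dot (P : WalkKernel d) (θ : Fin d → ℝ) :
    Integrable (fun z => Complex.exp (dot θ z * Complex.I)) (dualStepLaw P) :=
  Integrable.of_bound (C := 1) (measurable_of_countable _).aestronglyMeasurable
    (.of_forall fun z => by rw [Complex.norm_exp_ofReal_mul_I])

lemma stepChar_re (P : WalkKernel d) (θ : Fin d → ℝ) : (stepChar P θ).re = 1 - gap P θ := by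
  have h := (integral_re (integrable_exp_dot P θ)).symm
  simp only [RCLike.re_to_complex] at h
  rw [stepChar, h, gap, integral_sub (integrable_const _) (integrable_cos P θ)]
  simp [Complex.exp_ofReal_mul_I_re]

lemma gap_nonneg (P : WalkKernel d) (θ : Fin d → ℝ) : 0 ≤ gap P θ :=
  integral_nonneg fun z => by simpa using Real.cos_le_one _

lemma le_gap_of_step (P : WalkKernel d) (x : Site d) (θ : Fin d → ℝ) :
    P.p 0 x * (1 - Real.cos (dot θ x)) ≤ gap P θ := by
  have h1 := setIntegral_le_integral (s := {-x}) (integrable_one_sub_cos P θ)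
    (.of_forall fun z => by simpa using Real.cos_le_one _)
  rw [integral_singleton, dot_neg, Real.cos_neg, smul_eq_mul] at h1
  refine le_trans (mul_le_mul_of_nonneg_right ?_ (by simpa using Real.cos_le_one _)) h1
  have h2 : ENNReal.ofReal (P.p 0 x) ≤ dualStepLaw P {-x} := by
    rw [dualStepLaw, Measure.sum_apply _ (measurableSet_singleton _)]
    refine le_trans ?_ (ENNReal.le_tsum (-x))
    simp [WalkKernel.dual, P.translation (-x) 0]
  rw [Measure.real, ← ENNReal.toReal_ofReal (P.nonneg 0 x)]
  exact ENNReal.toReal_mono (measure_ne_top _ _) h2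

/-- `1 - cos t` is half of `|1 - exp (i t)| ^ 2`; apply the triangle inequality and `(u + v) ^ 2 ≤ 2
u ^ 2 + 2 v ^ 2`. -/
lemma one_sub_cos_add_le (a b : ℝ) :
    1 - Real.cos (a + b) ≤ 2 * (1 - Real.cos a) + 2 * (1 - Real.cos b) := by
  rw [Real.cos_add]
  nlinarith [sq_nonneg (Real.cos a + Real.cos b - 2), sq_nonneg (Real.sin b - Real.sin a),
    Real.sin_sq_add_cos_sq a, Real.sin_sq_add_cos_sq b]

/-- The sites for which such a constant exists form a subgroup containing all possible steps, hence
are all of `ℤ^d`. -/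
lemma exists_one_sub_cos_le (P : WalkKernel d) (x : Site d) :
    ∃ C : ℝ, 0 ≤ C ∧ ∀ θ, 1 - Real.cos (dot θ x) ≤ C * gap P θ := by
  have hx : x ∈ AddSubgroup.closure {x : Site d | 0 < P.p 0 x} := by
    rw [P.generates]; trivial
  induction hx using AddSubgroup.closure_induction with
  | mem x hx =>
    have hx : 0 < P.p 0 x := hx
    refine ⟨(P.p 0 x)⁻¹, (inv_pos.2 hx).le, fun θ => ?_⟩
    rw [inv_mul_eq_div, le_div_iff₀ hx, mul_comm]
    exact le_gap_of_step P x θ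
  | zero => exact ⟨0, le_rfl, fun θ => by simp [dot]⟩
  | add x y _ _ hx hy =>
    obtain ⟨C, hC, h1⟩ := hx
    obtain ⟨C', hC', h2⟩ := hy
    refine ⟨2 * C + 2 * C', by positivity, fun θ => ?_⟩
    rw [dot_add]
    refine (one_sub_cos_add_le _ _).trans ?_
    linarith [h1 θ, h2 θ]
  | neg x _ hx =>
    obtain ⟨C, hC, h1⟩ := hx
    exact ⟨C, hC, fun θ => by rw [dot_neg, Real.cos_neg]; exact h1 θ⟩

/-- Apply the previous bound to the unit vectors and use `1 - cos t ≥ 2 t ^ 2 / π ^ 2` for `|t| ≤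
π`. No moments of the step law are needed. -/
lemma exists_sq_le_gap (P : WalkKernel d) : ∃ κ : ℝ, 0 < κ ∧ ∀ θ : Fin d → ℝ,
    (∀ i, |θ i| ≤ Real.pi) → κ * ∑ i, θ i ^ 2 ≤ gap P θ := by
  choose C hC h using fun i : Fin d => exists_one_sub_cos_le P (Pi.single i 1)
  have hS : 0 ≤ ∑ i, C i := Finset.sum_nonneg fun i _ => hC i
  refine ⟨(Real.pi ^ 2 / 2 * ∑ i, C i + 1)⁻¹, by positivity, fun θ hθ => ?_⟩
  rw [inv_mul_eq_div, div_le_iff₀ (by positivity)]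
  have h1 : ∀ i, θ i ^ 2 ≤ Real.pi ^ 2 / 2 * (C i * gap P θ) := by
    intro i
    have h2 := h i θ
    have h3 : dot θ (Pi.single i 1) = θ i := by simp [dot, Pi.single_apply]
    rw [h3] at h2
    have h4 := Real.cos_le_one_sub_mul_cos_sq (hθ i)
    have h5 : 2 / Real.pi ^ 2 * θ i ^ 2 ≤ C i * gap P θ := by linarith
    have h6 := mul_le_mul_of_nonneg_left h5 (show 0 ≤ Real.pi ^ 2 / 2 by positivity)
    have : Real.pi ^ 2 / 2 * (2 / Real.pi ^ 2 * θ i ^ 2) = θ i ^ 2 := by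
      have := Real.pi_ne_zero; field_simp
    linarith
  calc ∑ i, θ i ^ 2 ≤ ∑ i, Real.pi ^ 2 / 2 * (C i * gap P θ) := Finset.sum_le_sum fun i _ => h1 i
    _ = gap P θ * (Real.pi ^ 2 / 2 * ∑ i, C i) := by
      rw [← Finset.mul_sum, ← Finset.sum_mul]; ring
    _ ≤ _ := by nlinarith [gap_nonneg P θ]

/-! ### Fourier inversion for the walk -/

/-- Lebesgue measure on the cube `(-π, π]^d` of frequencies. -/
def box (d : ℕ) : Measure (Fin d → ℝ) :=
  Measure.pi fun _ => volume.restrict (Set.Ioc (-Real.pi) Real.pi)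

instance : IsFiniteMeasure (box d) := by unfold box; infer_instance

lemma ae_box : ∀ᵐ θ ∂(box d), ∀ i, |θ i| ≤ Real.pi := by
  rw [ae_all_iff]
  intro i
  have h : ∀ᵐ x ∂(volume.restrict (Set.Ioc (-Real.pi) Real.pi)), |x| ≤ Real.pi := by
    filter_upwards [self_mem_ae_restrict measurableSet_Ioc] with x hx
    exact abs_le.2 ⟨hx.1.le, hx.2⟩
  exact (Measure.quasiMeasurePreserving_eval (fun _ => volume.restrict (Set.Ioc (-Real.pi) Real.pi)) i).ae h

lemma integral_exp_int (m : ℤ) : ∫ x in Set.Ioc (-Real.pi) Real.pi,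
    Complex.exp ((x * m : ℝ) * Complex.I) = if m = 0 then (2 * Real.pi : ℂ) else 0 := by
  have hpi : -Real.pi ≤ Real.pi := by linarith [Real.pi_pos]
  rw [← intervalIntegral.integral_of_le hpi]
  split_ifs with hm
  · subst hm
    simp
    ring
  · have e : ∀ x : ℝ, Complex.exp ((x * m : ℝ) * Complex.I) = Complex.exp ((m * Complex.I) * x) := by
      intro x; congr 1; push_cast; ring
    have hc : (m * Complex.I : ℂ) ≠ 0 := by simp [hm]
    simp_rw [e]
    rw [integral_exp_mul_complex hc, div_eq_zero_iff]
    left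
    rw [sub_eq_zero, Complex.exp_eq_exp_iff_exists_int]
    exact ⟨m, by push_cast; ring⟩

lemma integral_box_exp (x : Site d) : ∫ θ, Complex.exp (dot θ x * Complex.I) ∂(box d) =
    if x = 0 then (2 * Real.pi : ℂ) ^ d else 0 := by
  have e : ∀ θ : Fin d → ℝ, Complex.exp (dot θ x * Complex.I) =
      ∏ i, Complex.exp ((θ i * x i : ℝ) * Complex.I) := by
    intro θ
    rw [← Complex.exp_sum, ← Finset.sum_mul, dot]
    push_cast; rfl
  simp_rw [e, box]
  rw [integral_fintype_prod_eq_prod (𝕜 := ℂ) (fun i (t : ℝ) => Complex.exp ((t * x i : ℝ) * Complex.I))]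
  simp_rw [integral_exp_int]
  split_ifs with hx
  · subst hx; simp
  · obtain ⟨i, hi⟩ := Function.ne_iff.1 hx
    exact Finset.prod_eq_zero (Finset.mem_univ i) (by simpa using hi)

/-- The law of the embedded chain. -/
def chainProb (P : WalkKernel d) (k : ℕ) (x : Site d) : ℝ :=
  (noiseLaw P).real {w | position w k ∈ ({x} : Set (Site d))}

lemma measurable_stepChar (P : WalkKernel d) : Measurable (stepChar P) := by
  have h : StronglyMeasurable fun q : (Fin d → ℝ) × Site d =>
      Complex.exp (dot q.1 q.2 * Complex.I) :=
    (Complex.measurable_exp.comp ((Complex.measurable_ofReal.comp measurable_dot).mul_const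
      _)).stronglyMeasurable
  exact h.integral_prod_right.measurable

lemma norm_stepChar_le (P : WalkKernel d) (θ : Fin d → ℝ) : ‖stepChar P θ‖ ≤ 1 := by
  refine (norm_integral_le_integral_norm _).trans ?_
  simp [Complex.norm_exp_ofReal_mul_I]

lemma chainProb_zero (P : WalkKernel d) (x : Site d) :
    chainProb P 0 x = if x = 0 then 1 else 0 := by
  rw [chainProb]
  split_ifs with h
  · subst h; simp
  · simp [Ne.symm h]

lemma chainProb_succ (P : WalkKernel d) (k : ℕ) (x : Site d) :
    chainProb P (k + 1) x = ∫ z, chainProb P k (x - z) ∂(dualStepLaw P) := by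
  have hm2 : ∀ k (A : Set (Site d)), MeasurableSet {w : Noise d | position w k ∈ A} :=
    fun k A => measurable_position _ .of_discrete
  have e2 : noiseLaw P {w | position w (k + 1) ∈ ({x} : Set (Site d))} =
      ∫⁻ z, noiseLaw P {w | position w k ∈ ({x - z} : Set (Site d))} ∂(dualStepLaw P) := by
    rw [← lintegral_indicator_one (hm2 _ _), lintegral_noise_cons P (measurable_one.indicator (hm2 _ _))]
    simp only [← lintegral_indicator_one (hm2 _ _)]
    have : ∀ (h : ℝ) (z : Site d) (w : Noise d),
        Set.indicator {w : Noise d | position w (k + 1) ∈ ({x} : Set (Site d))} (1 : Noise d → ℝ≥0∞)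
          (cons (h, z) w) = Set.indicator {w : Noise d | position w k ∈ ({x - z} : Set (Site d))} 1 w := by
      intro h z w
      refine indicator_one_congr ?_
      simp only [Set.mem_ofPred_eq]
      rw [position_cons]
      simp only [Set.mem_singleton_iff]
      rw [eq_sub_iff_add_eq, add_comm]
    simp_rw [this]
    simp
  rw [chainProb, Measure.real, e2]
  exact (integral_toReal (measurable_of_countable _).aemeasurable (.of_forall fun z => measure_lt_top _ _)).symm

lemma norm_fourier_le (P : WalkKernel d) (k : ℕ) (x : Site d) (θ : Fin d → ℝ) :
    ‖Complex.exp (dot θ x * Complex.I) * stepChar P θ ^ k‖ ≤ 1 := by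
  rw [norm_mul, Complex.norm_exp_ofReal_mul_I, one_mul, norm_pow]
  exact pow_le_one₀ (norm_nonneg _) (norm_stepChar_le P θ)

lemma measurable_fourier (P : WalkKernel d) (k : ℕ) :
    Measurable fun q : (Fin d → ℝ) × Site d =>
      Complex.exp (dot q.1 q.2 * Complex.I) * stepChar P q.1 ^ k :=
  (Complex.measurable_exp.comp ((Complex.measurable_ofReal.comp measurable_dot).mul_const _)).mul
    (((measurable_stepChar P).comp measurable_fst).pow_const k)

lemma chainProb_eq (P : WalkKernel d) (k : ℕ) (x : Site d) :
    (2 * Real.pi : ℂ) ^ d * chainProb P k x =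
      ∫ θ, Complex.exp (dot θ (-x) * Complex.I) * stepChar P θ ^ k ∂(box d) := by
  induction k generalizing x with
  | zero =>
    simp only [pow_zero, mul_one, integral_box_exp, chainProb_zero, neg_eq_zero]
    split_ifs <;> simp
  | succ k ih =>
    rw [chainProb_succ, ← integral_complex_ofReal, ← integral_const_mul]
    simp_rw [ih]
    rw [integral_integral_swap]
    · refine integral_congr_ae (.of_forall fun θ => ?_)
      simp only
      rw [pow_succ, stepChar, ← mul_assoc, ← integral_const_mul]
      refine integral_congr_ae (.of_forall fun z => ?_)
      simp only
      rw [neg_sub, dot_sub, dot_neg, mul_right_comm, ← Complex.exp_add]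
      congr 2
      push_cast; ring
    · refine Integrable.of_bound (C := 1) ?_ (.of_forall fun q => ?_)
      · have h : Measurable fun q : Site d × (Fin d → ℝ) => (q.2, -(x - q.1)) :=
          measurable_snd.prodMk ((measurable_of_countable (fun z : Site d => -(x - z))).comp
            measurable_fst)
        exact ((measurable_fourier P k).comp h).aestronglyMeasurable
      · exact norm_fourier_le P k _ _

/-- Poissonization: summing the inversion formulas with weights `b ^ k / k!` turns the powers of
`stepChar` into an exponential. -/
lemma hasSum_chainProb (P : WalkKernel d) (b : ℝ) (hb : 0 ≤ b) (x : Site d) :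
    HasSum (fun k : ℕ => (2 * Real.pi : ℂ) ^ d * ((b ^ k / k.factorial * chainProb P k x : ℝ) : ℂ))
      (∫ θ, Complex.exp (dot θ (-x) * Complex.I) * Complex.exp (b * stepChar P θ) ∂(box d)) := by
  have hF : ∀ k : ℕ, (2 * Real.pi : ℂ) ^ d * ((b ^ k / k.factorial * chainProb P k x : ℝ) : ℂ) =
      ∫ θ, ((b ^ k / k.factorial : ℝ) : ℂ) *
        (Complex.exp (dot θ (-x) * Complex.I) * stepChar P θ ^ k) ∂(box d) := by
    intro k
    rw [integral_const_mul, ← chainProb_eq]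
    push_cast; ring
  have hi : ∀ k : ℕ, Integrable (fun θ => ((b ^ k / k.factorial : ℝ) : ℂ) *
        (Complex.exp (dot θ (-x) * Complex.I) * stepChar P θ ^ k)) (box d) := by
    intro k
    refine Integrable.const_mul (Integrable.of_bound (C := 1) ?_ (.of_forall fun θ =>
      norm_fourier_le P k _ _)) _
    exact ((measurable_fourier P k).comp (measurable_id.prodMk measurable_const)).aestronglyMeasurable
  have hbound : ∀ (k : ℕ) (θ : Fin d → ℝ), ‖((b ^ k / k.factorial : ℝ) : ℂ) *
        (Complex.exp (dot θ (-x) * Complex.I) * stepChar P θ ^ k)‖ ≤ b ^ k / k.factorial := by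
    intro k θ
    have h0 : 0 ≤ b ^ k / (k.factorial : ℝ) := by positivity
    rw [norm_mul, Complex.norm_real, Real.norm_of_nonneg h0]
    exact mul_le_of_le_one_right h0 (norm_fourier_le P k _ _)
  simp_rw [hF]
  have hsum : Summable fun k : ℕ => ∫ θ, ‖((b ^ k / k.factorial : ℝ) : ℂ) *
        (Complex.exp (dot θ (-x) * Complex.I) * stepChar P θ ^ k)‖ ∂(box d) := by
    refine Summable.of_nonneg_of_le (fun k => integral_nonneg fun θ => norm_nonneg _)
      (fun k => integral_mono (hi k).norm (integrable_const _) (hbound k)) ?_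
    simp only [integral_const, smul_eq_mul]
    exact (Real.summable_pow_div_factorial b).mul_left _
  have h := hasSum_integral_of_summable_integral_norm hi hsum
  have e : ∀ θ, ∑' k : ℕ, ((b ^ k / k.factorial : ℝ) : ℂ) *
        (Complex.exp (dot θ (-x) * Complex.I) * stepChar P θ ^ k) =
      Complex.exp (dot θ (-x) * Complex.I) * Complex.exp (b * stepChar P θ) := by
    intro θ
    have h2 := (NormedSpace.expSeries_div_hasSum_exp (b * stepChar P θ : ℂ)).mul_left
      (Complex.exp (dot θ (-x) * Complex.I))
    rw [← Complex.exp_eq_exp_ℂ] at h2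
    rw [← h2.tsum_eq]
    refine tsum_congr fun k => ?_
    rw [mul_pow]
    push_cast
    field_simp
  simp_rw [e] at h
  exact h

lemma integral_box_gaussian_le {c : ℝ} (hc : 0 < c) :
    ∫ θ, Real.exp (-(c * ∑ i, θ i ^ 2)) ∂(box d) ≤ Real.sqrt (Real.pi / c) ^ d := by
  have e : ∀ θ : Fin d → ℝ, Real.exp (-(c * ∑ i, θ i ^ 2)) = ∏ i, Real.exp (-c * θ i ^ 2) := by
    intro θ
    rw [← Real.exp_sum, ← Finset.mul_sum]; congr 1; ring
  simp_rw [e, box]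
  rw [integral_fintype_prod_eq_prod (𝕜 := ℝ) (fun (i : Fin d) (t : ℝ) => Real.exp (-c * t ^ 2))]
  refine (Finset.prod_le_prod (fun i _ => integral_nonneg fun t => Real.exp_nonneg _)
    (fun i _ => ?_)).trans_eq (by simp : ∏ i : Fin d, Real.sqrt (Real.pi / c) = _)
  rw [← integral_gaussian c]
  exact setIntegral_le_integral (integrable_exp_neg_mul_sq hc) (.of_forall fun t => Real.exp_nonneg _)

/-- The modulus of `exp (b * stepChar)` depends only on the real part `1 - gap`, so periodicity of
the embedded chain is harmless in continuous time. The quadratic lower bound on `gap` then leaves a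
Gaussian integral of order `b ^ (-d / 2)`. -/
lemma exists_tsum_chainProb_le (P : WalkKernel d) : ∃ C : ℝ, 0 < C ∧ ∀ (b : ℝ), 0 < b → ∀ x : Site d,
    Summable (fun k : ℕ => b ^ k / k.factorial * chainProb P k x) ∧
    Real.exp (-b) * ∑' k : ℕ, b ^ k / k.factorial * chainProb P k x ≤ C * b ^ (-(d : ℝ) / 2) := by
  obtain ⟨κ, hκ, hgap⟩ := exists_sq_le_gap P
  refine ⟨((2 * Real.pi) ^ d)⁻¹ * (Real.pi / κ) ^ ((d : ℝ) / 2), by positivity, fun b hb x => ?_⟩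
  have hs := hasSum_chainProb P b hb.le x
  have hpi : (0 : ℝ) < (2 * Real.pi) ^ d := by positivity
  have hs2 : HasSum (fun k : ℕ => ((((2 * Real.pi) ^ d * (b ^ k / k.factorial * chainProb P k x)) : ℝ) : ℂ))
      (∫ θ, Complex.exp (dot θ (-x) * Complex.I) * Complex.exp (b * stepChar P θ) ∂(box d)) := by
    convert hs using 2; push_cast; rfl
  have hsum : Summable (fun k : ℕ => (2 * Real.pi) ^ d * (b ^ k / k.factorial * chainProb P k x)) :=
    Complex.summable_ofReal.1 hs2.summable
  have hsum' : Summable (fun k : ℕ => b ^ k / k.factorial * chainProb P k x) :=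
    (summable_mul_left_iff hpi.ne').1 hsum
  refine ⟨hsum', ?_⟩
  have hval : (((2 * Real.pi) ^ d * ∑' k : ℕ, b ^ k / k.factorial * chainProb P k x : ℝ) : ℂ) =
      ∫ θ, Complex.exp (dot θ (-x) * Complex.I) * Complex.exp (b * stepChar P θ) ∂(box d) := by
    rw [← hs2.tsum_eq, ← tsum_mul_left, Complex.ofReal_tsum]
  have hnn : 0 ≤ ∑' k : ℕ, b ^ k / k.factorial * chainProb P k x :=
    tsum_nonneg fun k => mul_nonneg (by positivity) measureReal_nonneg
  have hle : (2 * Real.pi) ^ d * ∑' k : ℕ, b ^ k / k.factorial * chainProb P k x ≤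
      ∫ θ, Real.exp (b * (1 - κ * ∑ i, θ i ^ 2)) ∂(box d) := by
    have h1 := congrArg norm hval
    rw [Complex.norm_real, Real.norm_of_nonneg (mul_nonneg hpi.le hnn)] at h1
    rw [h1]
    refine norm_integral_le_of_norm_le ?_ ?_
    · refine Integrable.of_bound (C := Real.exp b) (Continuous.aestronglyMeasurable (by fun_prop))
        (.of_forall fun θ => ?_)
      rw [Real.norm_of_nonneg (Real.exp_nonneg _)]
      refine Real.exp_le_exp.2 ?_
      have : 0 ≤ ∑ i, θ i ^ 2 := Finset.sum_nonneg fun i _ => sq_nonneg _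
      have : 0 ≤ κ * ∑ i, θ i ^ 2 := by positivity
      nlinarith
    · filter_upwards [ae_box] with θ hθ
      rw [norm_mul, Complex.norm_exp_ofReal_mul_I, one_mul, Complex.norm_exp]
      refine Real.exp_le_exp.2 ?_
      rw [Complex.re_ofReal_mul, stepChar_re]
      exact mul_le_mul_of_nonneg_left (by linarith [hgap θ hθ]) hb.le
  have hsplit : ∫ θ, Real.exp (b * (1 - κ * ∑ i, θ i ^ 2)) ∂(box d) =
      Real.exp b * ∫ θ, Real.exp (-(b * κ * ∑ i, θ i ^ 2)) ∂(box d) := by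
    rw [← integral_const_mul]
    refine integral_congr_ae (.of_forall fun θ => ?_)
    simp only
    rw [← Real.exp_add]; congr 1; ring
  rw [hsplit] at hle
  have hg := integral_box_gaussian_le (d := d) (mul_pos hb hκ)
  have hpow : Real.sqrt (Real.pi / (b * κ)) ^ d = (Real.pi / κ) ^ ((d : ℝ) / 2) * b ^ (-(d : ℝ) / 2) := by
    rw [Real.sqrt_eq_rpow, ← Real.rpow_natCast, ← Real.rpow_mul (by positivity),
      show Real.pi / (b * κ) = Real.pi / κ * b⁻¹ by field_simp,
      Real.mul_rpow (by positivity) (by positivity), Real.inv_rpow hb.le, ← Real.rpow_neg hb.le]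
    congr 2 <;> ring
  rw [hpow] at hg
  have h3 : (2 * Real.pi) ^ d * (Real.exp (-b) * ∑' k : ℕ, b ^ k / k.factorial * chainProb P k x) ≤
      (Real.pi / κ) ^ ((d : ℝ) / 2) * b ^ (-(d : ℝ) / 2) := by
    calc _ = Real.exp (-b) * ((2 * Real.pi) ^ d * ∑' k : ℕ, b ^ k / k.factorial * chainProb P k x) := by ring
      _ ≤ Real.exp (-b) * (Real.exp b * ∫ θ, Real.exp (-(b * κ * ∑ i, θ i ^ 2)) ∂(box d)) :=
        mul_le_mul_of_nonneg_left hle (Real.exp_nonneg _)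
      _ = ∫ θ, Real.exp (-(b * κ * ∑ i, θ i ^ 2)) ∂(box d) := by
        rw [← mul_assoc, ← Real.exp_add]; simp
      _ ≤ _ := hg
  rw [mul_assoc, le_inv_mul_iff₀ hpi]
  exact h3

/-- The probability that a walk visits a given site in a given unit time interval. -/
theorem exists_visit_le (P : WalkKernel d) : ∃ C : ℝ, 0 < C ∧ ∀ (a : ℝ × Site d) (z : Site d) (t : ℝ),
    a.1 ≤ t → noiseLaw P {w | ∃ q : ℚ, t ≤ q ∧ q ≤ t + 1 ∧ (q, z) ∈ graph a w} ≤
      ENNReal.ofReal (C * (t - a.1 + 1) ^ (-(d : ℝ) / 2)) := by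
  obtain ⟨C, hC, h⟩ := exists_tsum_chainProb_le P
  -- `noise_state_le` carries the exponential of the left end of the unit interval, the heat kernel
  -- that of the right end; the factor `exp 1` is the ratio.
  refine ⟨Real.exp 1 * C, by positivity, fun a z t ht => ?_⟩
  have hb : 0 < t - a.1 + 1 := by linarith
  obtain ⟨hs, hle⟩ := h _ hb (z - a.2)
  have hsub : {w : Noise d | ∃ q : ℚ, t ≤ q ∧ q ≤ t + 1 ∧ (q, z) ∈ graph a w} ⊆
      ⋃ k, {w | arrival w k ≤ t - a.1 + 1 ∧ t - a.1 < arrival w (k + 1) ∧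
        position w k ∈ ({z - a.2} : Set (Site d))} := by
    rintro w ⟨q, h1, h2, k, h3, h4, h5⟩
    simp only at h3 h4 h5
    refine Set.mem_iUnion.2 ⟨k, by linarith, by linarith, ?_⟩
    rw [h5]; simp
  refine (measure_mono hsub).trans ((measure_iUnion_le _).trans ?_)
  refine (ENNReal.tsum_le_tsum fun k => noise_state_le P k (t - a.1) (t - a.1 + 1) _).trans ?_
  have e : ∀ k : ℕ, ENNReal.ofReal (Real.exp (-(t - a.1)) * simplexVol k (t - a.1 + 1)) *
      noiseLaw P {w | position w k ∈ ({z - a.2} : Set (Site d))} =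
      ENNReal.ofReal (Real.exp (-(t - a.1)) *
        ((t - a.1 + 1) ^ k / k.factorial * chainProb P k (z - a.2))) := by
    intro k
    rw [simplexVol, if_pos hb.le, chainProb, ← mul_assoc, ENNReal.ofReal_mul (q := (noiseLaw P).real _)
      (by positivity), ofReal_measureReal]
  simp_rw [e]
  rw [← ENNReal.ofReal_tsum_of_nonneg _ (hs.mul_left _), tsum_mul_left]
  · refine ENNReal.ofReal_le_ofReal ?_
    have e2 : Real.exp (-(t - a.1)) = Real.exp 1 * Real.exp (-(t - a.1 + 1)) := by
      rw [← Real.exp_add]; congr 1; ring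
    rw [e2, mul_assoc, mul_assoc]
    exact mul_le_mul_of_nonneg_left hle (Real.exp_nonneg _)
  · intro k
    exact mul_nonneg (Real.exp_nonneg _) (mul_nonneg (by positivity) measureReal_nonneg)

/-! ### The number of absorbed walks as a functional of the graphs -/

open scoped Classical in
/-- The number of absorbed paths, if the paths of a list are run one after the other, each one
until it visits the obstacle set. -/
def hits : List (Set (Pt d)) → Set (Pt d) → ℕ
  | [], _ => 0
  | V :: l, Γ => (if (V ∩ Γ).Nonempty then 1 else 0) + hits l (Γ ∪ alive V Γ)

/-- The graphs of the walks released along `ψ` at the times in a list. -/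
def graphs (ψ : ℝ → Site d) (ω : ℝ → Noise d) (l : List ℝ) : List (Set (Pt d)) :=
  l.map fun u => graph (u, ψ u) (ω u)

lemma measurable_hits (ψ : ℝ → Site d) (l : List ℝ) :
    Measurable fun q : (ℝ → Noise d) × Set (Pt d) => hits (graphs ψ q.1 l) q.2 := by
  induction l with
  | nil => exact measurable_const
  | cons u l ih =>
    have hg : Measurable fun q : (ℝ → Noise d) × Set (Pt d) => graph (u, ψ u) (q.1 u) :=
      measurable_graph measurable_const ((measurable_pi_apply u).comp measurable_fst)
    exact (Measurable.ite (Measurable.set_nonempty (Measurable.set_inter hg measurable_snd))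
      measurable_const measurable_const).add (ih.comp (measurable_fst.prodMk
        (Measurable.set_union measurable_snd (Measurable.alive hg measurable_snd))))

lemma graphs_update (ψ : ℝ → Site d) (ω : ℝ → Noise d) {u : ℝ} {l : List ℝ} (hu : u ∉ l)
    (w : Noise d) : graphs ψ (Function.update ω u w) l = graphs ψ ω l := by
  refine List.map_congr_left fun v hv => ?_
  have hvu : v ≠ u := fun h => hu (by rwa [h] at hv)
  rw [Function.update_of_ne hvu]

lemma pow_hits_cons (y : ℝ≥0∞) (V : Set (Pt d)) (l : List (Set (Pt d))) (Γ : Set (Pt d)) :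
    y ^ hits (V :: l) Γ = weight y V Γ * y ^ hits l (Γ ∪ alive V Γ) := by
  rw [hits, pow_add, weight]
  split_ifs <;> simp

/-- Distinct release times use independent coordinates, so the noises can be integrated out one at a
time as in the recursion `run`. -/
lemma lintegral_pow_hits (P : WalkKernel d) (y : ℝ≥0∞) (ψ : ℝ → Site d) {l : List ℝ}
    (hl : l.Nodup) (Γ : Set (Pt d)) :
    ∫⁻ ω, y ^ hits (graphs ψ ω l) Γ ∂(law P) = gen P y (l.map fun u => (u, ψ u)) Γ := by
  induction l generalizing Γ with
  | nil => simp [hits, graphs, run]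
  | cons u l ih =>
    obtain ⟨hu, hl⟩ := List.nodup_cons.1 hl
    have hm : ∀ (l : List ℝ) (Γ : Set (Pt d)),
        Measurable fun ω : ℝ → Noise d => y ^ hits (graphs ψ ω l) Γ := fun l Γ =>
      (measurable_of_countable (fun n : ℕ => y ^ n)).comp
        ((measurable_hits ψ l).comp (measurable_id.prodMk measurable_const))
    have hU := measurePreserving_update (noiseLaw P) u
    have e := hU.lintegral_comp (hm (u :: l) Γ)
    rw [law, ← e, lintegral_prod_symm (fun q : (ℝ → Noise d) × Noise d =>
      y ^ hits (graphs ψ (Function.update q.1 u q.2) (u :: l)) Γ)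
      ((hm (u :: l) Γ).comp hU.measurable).aemeasurable, List.map_cons, gen, run]
    refine lintegral_congr fun w => ?_
    rw [← gen, ← ih hl, law, ← lintegral_const_mul _ (hm l _)]
    refine lintegral_congr fun ω => ?_
    rw [← pow_hits_cons]
    congr 2
    rw [graphs, List.map_cons, ← graphs, graphs_update _ _ hu, Function.update_self]

/-! ### Comparison of absorption at real times and at rational times -/

lemma Good.jumpCount_eq {w : Noise d} (hw : Good w) {t : ℝ} (ht : 0 ≤ t) :
    jumpCount w t = stateAt w t := by
  have : {n : ℕ | ∑ i ∈ Finset.range (n + 1), (w i).1 ≤ t} =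
      (Finset.range (stateAt w t) : Set ℕ) := by
    ext n
    simp only [Set.mem_ofPred_eq, Finset.coe_range, Set.mem_Iio]
    constructor
    · intro h
      by_contra hn
      have h1 := hw.lt_arrival_stateAt t
      have h2 := hw.strictMono.monotone (show stateAt w t + 1 ≤ n + 1 by omega)
      have h3 : arrival w (n + 1) ≤ t := h
      linarith
    · intro h
      exact (hw.strictMono.monotone (Nat.succ_le_of_lt h)).trans (arrival_stateAt_le w ht)
  rw [jumpCount, this, Set.ncard_coe_finset, Finset.card_range]

lemma Good.walk_eq {ψ : ℝ → Site d} {ω : ℝ → Noise d} {u t : ℝ} (hw : Good (ω u)) (ht : u ≤ t) :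
    walk ψ ω u t = siteAt (u, ψ u) (ω u) t := by
  rw [walk, hw.jumpCount_eq (sub_nonneg.2 ht)]; rfl

section Compare

variable {ψ : ℝ → Site d} {S : Finset ℝ} {ω : ℝ → Noise d}

/-- After each time there is a time interval without jumps and without new walks. -/
lemma exists_walk_const (hω : ∀ u ∈ S, Good (ω u)) (t : ℝ) : ∃ t', t < t' ∧ ∀ v ∈ S,
    (v ≤ t → ∀ s, t ≤ s → s < t' → walk ψ ω v s = walk ψ ω v t) ∧ (t < v → t' ≤ v) := by
  have h : ∀ᶠ t' in 𝓝[>] t, ∀ v ∈ S,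
      (v ≤ t → ∀ s, t ≤ s → s < t' → walk ψ ω v s = walk ψ ω v t) ∧ (t < v → t' ≤ v) := by
    refine (Filter.eventually_all_finset S).2 fun v hv => Filter.Eventually.and ?_ ?_
    · by_cases hvt : v ≤ t
      · obtain ⟨t1, h1, h2⟩ := (hω v hv).siteAt_const (a := (v, ψ v)) hvt
        filter_upwards [Ioc_mem_nhdsGT h1] with t' ht' _ s hs hs'
        rw [(hω v hv).walk_eq (hvt.trans hs), (hω v hv).walk_eq hvt]
        exact h2 s hs (hs'.trans_le ht'.2)
      · exact Eventually.of_forall fun t' h => absurd h hvt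
    · by_cases hvt : t < v
      · filter_upwards [Ioc_mem_nhdsGT hvt] with t' ht' _ using ht'.2
      · exact Eventually.of_forall fun t' h => absurd h hvt
  obtain ⟨t', h1, h2⟩ := (h.and self_mem_nhdsWithin).exists
  exact ⟨t', h2, h1⟩

lemma absorbed_iff {u t : ℝ} : Absorbed ψ S ω u t ↔ ∃ s, s ≤ t ∧ ∃ v ∈ S, u < v ∧ v ≤ s ∧
    walk ψ ω u s = walk ψ ω v s ∧ ¬ Absorbed ψ S ω v s := by
  rw [Absorbed]
  simp only [exists_prop]

/-- Just after `t` there is no jump and no release, so an absorption there would come from a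
coincidence already present at `t`. This right-continuity lets rational times detect everything. -/
lemma not_absorbed_after (hω : ∀ u ∈ S, Good (ω u)) {u t : ℝ} (hu : u ∈ S) (hut : u ≤ t)
    (h : ¬ Absorbed ψ S ω u t) : ∃ t', t < t' ∧ ∀ s < t', ¬ Absorbed ψ S ω u s := by
  obtain ⟨t', ht, hc⟩ := exists_walk_const (ψ := ψ) hω t
  refine ⟨t', ht, fun s hs ha => ?_⟩
  obtain ⟨r, hr, v, hv, huv, hvr, he, hna⟩ := absorbed_iff.1 ha
  rcases le_or_gt r t with h1 | h1
  · exact h (absorbed_iff.2 ⟨r, h1, v, hv, huv, hvr, he, hna⟩)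
  · have hvt : v ≤ t := by
      by_contra hvt
      linarith [(hc v hv).2 (not_le.1 hvt)]
    rw [(hc u hu).1 hut r h1.le (hr.trans_lt hs), (hc v hv).1 hvt r h1.le (hr.trans_lt hs)] at he
    exact h (absorbed_iff.2 ⟨t, le_rfl, v, hv, huv, hvt, he, fun ha' => hna (ha'.mono h1.le)⟩)

/-- The part of the graph of a walk before its absorption. -/
def livePart (ψ : ℝ → Site d) (S : Finset ℝ) (ω : ℝ → Noise d) (v : ℝ) : Set (Pt d) :=
  {p | v ≤ p.1 ∧ p.2 = walk ψ ω v p.1 ∧ ¬ Absorbed ψ S ω v p.1}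

/-- The obstacles for a walk. -/
def obstacles (ψ : ℝ → Site d) (S : Finset ℝ) (ω : ℝ → Noise d) (u : ℝ) : Set (Pt d) :=
  {p | ∃ v ∈ S, u < v ∧ p ∈ livePart ψ S ω v}

lemma exists_hit_of_absorbed (hω : ∀ u ∈ S, Good (ω u)) {u t : ℝ} (hu : u ∈ S)
    (h : Absorbed ψ S ω u t) : ∃ s ≤ t, ∃ t', s < t' ∧ ∀ q : ℚ, s ≤ q → q < t' →
      ((q, walk ψ ω u q) : Pt d) ∈ graph (u, ψ u) (ω u) ∩ obstacles ψ S ω u := by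
  obtain ⟨s, hs, v, hv, huv, hvs, he, hna⟩ := absorbed_iff.1 h
  obtain ⟨t1, h1, hc⟩ := exists_walk_const (ψ := ψ) hω s
  obtain ⟨t2, h2, hn⟩ := not_absorbed_after hω hv hvs hna
  refine ⟨s, hs, min t1 t2, lt_min h1 h2, fun q hq hq' => ⟨?_, v, hv, huv, hvs.trans hq, ?_, ?_⟩⟩
  · have huq : u ≤ q := (huv.le.trans hvs).trans hq
    exact (hω u hu).mem_graph.2 ⟨huq, (hω u hu).walk_eq huq⟩
  · have h3 := hq'.trans_le (min_le_left t1 t2)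
    simp only
    rw [(hc u hu).1 (huv.le.trans hvs) q hq h3, (hc v hv).1 hvs q hq h3, he]
  · exact hn _ (hq'.trans_le (min_le_right t1 t2))

lemma absorbed_of_hit (hω : ∀ u ∈ S, Good (ω u)) {u : ℝ} (hu : u ∈ S) {p : Pt d}
    (h1 : p ∈ graph (u, ψ u) (ω u)) (h2 : p ∈ obstacles ψ S ω u) : Absorbed ψ S ω u p.1 := by
  obtain ⟨v, hv, huv, hvp, he, hna⟩ := h2
  obtain ⟨h3, h4⟩ := (hω u hu).mem_graph.1 h1
  refine absorbed_iff.2 ⟨p.1, le_rfl, v, hv, huv, hvp, ?_, hna⟩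
  rw [← he, h4, (hω u hu).walk_eq h3]

lemma hit_obstacles_iff (hω : ∀ u ∈ S, Good (ω u)) {u : ℝ} (hu : u ∈ S) :
    (graph (u, ψ u) (ω u) ∩ obstacles ψ S ω u).Nonempty ↔ ∃ t, Absorbed ψ S ω u t := by
  constructor
  · rintro ⟨p, h1, h2⟩
    exact ⟨_, absorbed_of_hit hω hu h1 h2⟩
  · rintro ⟨t, h⟩
    obtain ⟨s, -, t', h1, h2⟩ := exists_hit_of_absorbed hω hu h
    obtain ⟨q, h3, h4⟩ := exists_rat_btwn h1
    exact ⟨_, h2 q h3.le h4⟩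

/-- An absorption is followed by an interval on which the walk sits in the obstacle set, hence by
rational visits arbitrarily close to it; a survivor, conversely, survives up to some later rational
time. -/
lemma alive_obstacles (hω : ∀ u ∈ S, Good (ω u)) {u : ℝ} (hu : u ∈ S) :
    alive (graph (u, ψ u) (ω u)) (obstacles ψ S ω u) = livePart ψ S ω u := by
  ext p
  constructor
  · rintro ⟨hp, q, hq, hh⟩
    obtain ⟨h3, h4⟩ := (hω u hu).mem_graph.1 hp
    refine ⟨h3, by rw [h4, (hω u hu).walk_eq h3], fun ha => ?_⟩
    obtain ⟨s, hs, t', h1, h2⟩ := exists_hit_of_absorbed hω hu ha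
    have hsq : s < q := lt_of_le_of_lt hs (by exact_mod_cast hq)
    obtain ⟨r, h5, h6⟩ := exists_rat_btwn (lt_min h1 hsq)
    have := hh _ (h2 r h5.le (h6.trans_le (min_le_left _ _))).1
      (h2 r h5.le (h6.trans_le (min_le_left _ _))).2
    have h7 : (r : ℝ) < q := h6.trans_le (min_le_right _ _)
    have h8 : r < q := by exact_mod_cast h7
    exact absurd this (not_le.2 h8)
  · rintro ⟨h1, h2, h3⟩
    obtain ⟨t', h4, h5⟩ := not_absorbed_after hω hu h1 h3
    obtain ⟨q, h6, h7⟩ := exists_rat_btwn h4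
    refine ⟨(hω u hu).mem_graph.2 ⟨h1, by rw [h2, (hω u hu).walk_eq h1]⟩, q, by exact_mod_cast h6,
      fun p' hp' hO => ?_⟩
    by_contra h8
    have h9 : (p'.1 : ℝ) < q := by exact_mod_cast not_le.1 h8
    exact h5 q h7 ((absorbed_of_hit hω hu hp' hO).mono h9.le)

-- Here `l` lists the walks still to be run and the obstacle set holds the live parts of those
-- already run. Decreasing release times make the latter exactly the walks able to absorb the head
-- of `l`.
open scoped Classical in
lemma hits_eq_countP (hω : ∀ u ∈ S, Good (ω u)) (l : List ℝ) (hl : l.Pairwise (· > ·))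
    (h1 : ∀ u ∈ l, u ∈ S) (h2 : ∀ v ∈ S, v ∉ l → ∀ u ∈ l, u < v) :
    hits (graphs ψ ω l) {p | ∃ v ∈ S, v ∉ l ∧ p ∈ livePart ψ S ω v} =
      l.countP fun u => ∃ t, Absorbed ψ S ω u t := by
  induction l with
  | nil => rfl
  | cons u l ih =>
    obtain ⟨hul, hl⟩ := List.pairwise_cons.1 hl
    have hu : u ∈ S := h1 u (by simp)
    have e1 : {p | ∃ v ∈ S, v ∉ u :: l ∧ p ∈ livePart ψ S ω v} = obstacles ψ S ω u := by
      ext p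
      refine exists_congr fun v => and_congr_right fun hv => and_congr_left fun _ => ?_
      refine ⟨fun h => h2 v hv h u (by simp), fun h => ?_⟩
      rintro (_ | ⟨_, hvl⟩)
      · exact lt_irrefl _ h
      · exact lt_asymm h (hul v hvl)
    have e2 : obstacles ψ S ω u ∪ livePart ψ S ω u =
        {p | ∃ v ∈ S, v ∉ l ∧ p ∈ livePart ψ S ω v} := by
      rw [← e1]
      ext p
      constructor
      · rintro (⟨v, hv, hvl, hp⟩ | hp)
        · exact ⟨v, hv, fun h => hvl (List.mem_cons_of_mem _ h), hp⟩
        · exact ⟨u, hu, fun h => lt_irrefl _ (hul u h), hp⟩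
      · rintro ⟨v, hv, hvl, hp⟩
        by_cases hvu : v = u
        · subst hvu; exact Or.inr hp
        · exact Or.inl ⟨v, hv, by simp [hvu, hvl], hp⟩
    have h2' : ∀ v ∈ S, v ∉ l → ∀ x ∈ l, x < v := by
      intro v hv hvl x hx
      by_cases hvu : v = u
      · subst hvu; exact hul x hx
      · exact h2 v hv (by simp [hvu, hvl]) x (List.mem_cons_of_mem _ hx)
    rw [e1, graphs, List.map_cons, ← graphs, hits, alive_obstacles hω hu, e2,
      ih hl (fun x hx => h1 x (List.mem_cons_of_mem _ hx)) h2', List.countP_cons, add_comm]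
    simp [hit_obstacles_iff hω hu]

end Compare

/-- The law of the number of walks that coalesce. -/
lemma ae_numCoal_eq (P : WalkKernel d) (ψ : ℝ → Site d) {l : List ℝ} (hl : l.Pairwise (· > ·))
    {S : Finset ℝ} (hS : ∀ u, u ∈ S ↔ u ∈ l) :
    ∀ᵐ ω ∂(law P), numCoal ψ S ω = hits (graphs ψ ω l) ∅ := by
  classical
  have h : ∀ᵐ ω ∂(law P), ∀ u ∈ S, Good (ω u) :=
    (Filter.eventually_all_finset S).2 fun u _ =>
      (measurePreserving_eval_infinitePi (fun _ : ℝ => noiseLaw P) u).quasiMeasurePreserving.ae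
        (ae_good P)
  filter_upwards [h] with ω hω
  have e := hits_eq_countP (ψ := ψ) hω l hl (fun u hu => (hS u).2 hu)
    (fun v hv hvl => absurd ((hS v).1 hv) hvl)
  have e0 : {p : Pt d | ∃ v ∈ S, v ∉ l ∧ p ∈ livePart ψ S ω v} = ∅ := by
    ext p
    simp only [Set.mem_ofPred_eq, Set.mem_empty_iff_false, iff_false]
    rintro ⟨v, hv, hvl, -⟩
    exact hvl ((hS v).1 hv)
  rw [e0] at e
  have hnd : l.Nodup := hl.imp fun h => ne_of_gt h
  have hSl : S = l.toFinset := by ext u; simp [hS]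
  rw [e, numCoal, List.countP_eq_length_filter, ← List.toFinset_card_of_nodup (hnd.filter _), hSl]
  congr 1
  ext u
  simp

/-! ### The exponential function with values in `[0, ∞]` -/

/-- The exponential of a real number as an extended nonnegative real. -/
def ex (x : ℝ) : ℝ≥0∞ := ENNReal.ofReal (Real.exp x)

lemma ex_add (x y : ℝ) : ex (x + y) = ex x * ex y := by
  rw [ex, Real.exp_add, ENNReal.ofReal_mul (Real.exp_nonneg _)]; rfl

lemma ex_zero : ex 0 = 1 := by simp [ex]

lemma ex_le {x y : ℝ} (h : x ≤ y) : ex x ≤ ex y := ENNReal.ofReal_le_ofReal (Real.exp_le_exp.2 h)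

lemma one_le_ex {x : ℝ} (h : 0 ≤ x) : 1 ≤ ex x := ex_zero ▸ ex_le h

lemma ex_ne_top (x : ℝ) : ex x ≠ ∞ := ENNReal.ofReal_ne_top

lemma ex_rpow (x t : ℝ) : ex x ^ t = ex (x * t) := by
  rw [ex, ENNReal.ofReal_rpow_of_pos (Real.exp_pos _), ← Real.exp_mul]; rfl

lemma ex_pow (x : ℝ) (n : ℕ) : ex x ^ n = ex (n * x) := by
  rw [ex, ← ENNReal.ofReal_pow (Real.exp_nonneg _), ← Real.exp_nat_mul]; rfl

lemma measurable_ex : Measurable ex := ENNReal.measurable_ofReal.comp Real.measurable_exp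

lemma one_add_ofReal_le_ex {x : ℝ} (hx : 0 ≤ x) : 1 + ENNReal.ofReal x ≤ ex x := by
  rw [← ENNReal.ofReal_one, ← ENNReal.ofReal_add zero_le_one hx]
  exact ENNReal.ofReal_le_ofReal (by linarith [Real.add_one_le_exp x])

/-- Jensen's inequality for the exponential and a subprobability on `ℕ`. -/
lemma ex_le_one_add_tsum {p M : ℕ → ℝ≥0∞} (hp : ∑' n, p n ≤ 1) (hM : ∀ n, M n ≠ ∞) {x : ℝ}
    (hx : 0 ≤ x) (h : ENNReal.ofReal x ≤ ∑' n, p n * M n) :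
    ex x ≤ 1 + ∑' n, p n * ex (M n).toReal := by
  set s := ∑' n, p n
  set Z := ∑' n, p n * ex (M n).toReal with hZ
  by_cases hZt : Z = ∞
  · simp [hZt]
  have hs : s ≠ ∞ := ne_top_of_le_ne_top ENNReal.one_ne_top hp
  -- The tangent to the exponential at `x`, rearranged into sums to avoid truncated subtraction.
  have h1 : ∀ n, ex x * (1 + M n) ≤ ex (M n).toReal + ex x * ENNReal.ofReal x := by
    intro n
    obtain ⟨m, hm⟩ : ∃ m : ℝ, m = (M n).toReal := ⟨_, rfl⟩
    have hm0 : 0 ≤ m := hm ▸ ENNReal.toReal_nonneg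
    rw [← hm, ← ENNReal.ofReal_toReal (hM n), ← hm, ex, ex, ← ENNReal.ofReal_one,
      ← ENNReal.ofReal_add zero_le_one hm0, ← ENNReal.ofReal_mul (Real.exp_nonneg _),
      ← ENNReal.ofReal_mul (Real.exp_nonneg _), ← ENNReal.ofReal_add (Real.exp_nonneg _)
        (mul_nonneg (Real.exp_nonneg _) hx)]
    refine ENNReal.ofReal_le_ofReal ?_
    have h2 := Real.add_one_le_exp (m - x)
    have h3 : Real.exp m = Real.exp x * Real.exp (m - x) := by rw [← Real.exp_add]; congr 1; ring
    nlinarith [Real.exp_pos x]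
  have h2 : ex x * (s + ENNReal.ofReal x) ≤ Z + s * (ex x * ENNReal.ofReal x) := by
    calc ex x * (s + ENNReal.ofReal x) ≤ ex x * (∑' n, p n + ∑' n, p n * M n) := by gcongr
      _ = ∑' n, p n * (ex x * (1 + M n)) := by
        rw [← ENNReal.tsum_add, ← ENNReal.tsum_mul_left]
        exact tsum_congr fun n => by ring
      _ ≤ ∑' n, (p n * ex (M n).toReal + p n * (ex x * ENNReal.ofReal x)) :=
        ENNReal.tsum_le_tsum fun n => by rw [← mul_add]; gcongr; exact h1 n
      _ = _ := by rw [ENNReal.tsum_add, ENNReal.tsum_mul_right]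
  obtain ⟨s', hs'⟩ : ∃ m : ℝ, m = s.toReal := ⟨_, rfl⟩
  obtain ⟨z, hz⟩ : ∃ m : ℝ, m = Z.toReal := ⟨_, rfl⟩
  have hs0 : 0 ≤ s' := hs' ▸ ENNReal.toReal_nonneg
  have hz0 : 0 ≤ z := hz ▸ ENNReal.toReal_nonneg
  have hs1 : s' ≤ 1 := by
    rw [hs']; exact ENNReal.toReal_le_of_le_ofReal zero_le_one (by simpa using hp)
  rw [← ENNReal.ofReal_toReal hs, ← ENNReal.ofReal_toReal hZt, ← hs', ← hz, ex,
    ← ENNReal.ofReal_add hs0 hx, ← ENNReal.ofReal_mul (Real.exp_nonneg _),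
    ← ENNReal.ofReal_mul (Real.exp_nonneg _), ← ENNReal.ofReal_mul hs0,
    ← ENNReal.ofReal_add hz0 (by positivity), ENNReal.ofReal_le_ofReal_iff (by positivity)] at h2
  rw [← ENNReal.ofReal_toReal hZt, ← hz, ex, ← ENNReal.ofReal_one, ← ENNReal.ofReal_add zero_le_one hz0]
  refine ENNReal.ofReal_le_ofReal ?_
  -- By `h2` it remains to see `(1 - s') * (1 - x) * exp x ≤ 1`; for `x > 1` the left side is not
  -- positive.
  have h3 : Real.exp x * (1 - x) ≤ 1 := by
    have h4 := Real.add_one_le_exp (-x)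
    have h5 : Real.exp x * Real.exp (-x) = 1 := by rw [← Real.exp_add]; simp
    nlinarith [Real.exp_pos x]
  rcases le_or_gt x 1 with hx1 | hx1
  · have h6 : (1 - s') * (Real.exp x * (1 - x)) ≤ 1 := by
      have : 0 ≤ Real.exp x * (1 - x) := mul_nonneg (Real.exp_nonneg _) (by linarith)
      nlinarith
    nlinarith
  · have h6 : (1 - s') * (Real.exp x * (1 - x)) ≤ 0 :=
      mul_nonpos_of_nonneg_of_nonpos (by linarith)
        (mul_nonpos_of_nonneg_of_nonpos (Real.exp_nonneg _) (by linarith))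
    nlinarith

/-! ### Hitting probabilities -/

/-- The probability that the walk released from `a` visits `A`. -/
def hitProb (P : WalkKernel d) (a : ℝ × Site d) (A : Set (Pt d)) : ℝ≥0∞ :=
  noiseLaw P {w | (graph a w ∩ A).Nonempty}

lemma measurableSet_hit (a : ℝ × Site d) (A : Set (Pt d)) :
    MeasurableSet {w : Noise d | (graph a w ∩ A).Nonempty} :=
  Measurable.set_nonempty (Measurable.set_inter (measurable_graph measurable_const measurable_id)
    measurable_const)

lemma measurable_hitProb (P : WalkKernel d) (a : ℝ × Site d) : Measurable (hitProb P a) := by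
  have h : MeasurableSet {q : Set (Pt d) × Noise d | (graph a q.2 ∩ q.1).Nonempty} :=
    Measurable.set_nonempty (Measurable.set_inter (measurable_graph measurable_const measurable_snd)
      measurable_fst)
  exact measurable_measure_prodMk_left h

lemma hitProb_union_le (P : WalkKernel d) (a : ℝ × Site d) (A B : Set (Pt d)) :
    hitProb P a (A ∪ B) ≤ hitProb P a A + hitProb P a B := by
  refine le_trans (measure_mono ?_) (measure_union_le _ _)
  rintro w ⟨p, hp, h | h⟩
  · exact Or.inl ⟨p, hp, h⟩
  · exact Or.inr ⟨p, hp, h⟩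

lemma hitProb_mono (P : WalkKernel d) (a : ℝ × Site d) {A B : Set (Pt d)} (h : A ⊆ B) :
    hitProb P a A ≤ hitProb P a B :=
  measure_mono fun _ hw => hw.mono (Set.inter_subset_inter_right _ h)

lemma hitProb_ne_top (P : WalkKernel d) (a : ℝ × Site d) (A : Set (Pt d)) : hitProb P a A ≠ ∞ :=
  measure_ne_top _ _

/-- The expected number of independent walks released from the points of a list that visit `A`. -/
def hitSum (P : WalkKernel d) (U : List (ℝ × Site d)) (A : Set (Pt d)) : ℝ :=
  (U.map fun u => (hitProb P u A).toReal).sum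

lemma hitSum_cons (P : WalkKernel d) (u : ℝ × Site d) (U : List (ℝ × Site d)) (A : Set (Pt d)) :
    hitSum P (u :: U) A = (hitProb P u A).toReal + hitSum P U A := by simp [hitSum]

lemma hitSum_append (P : WalkKernel d) (U U' : List (ℝ × Site d)) (A : Set (Pt d)) :
    hitSum P (U ++ U') A = hitSum P U A + hitSum P U' A := by simp [hitSum]

lemma hitSum_nonneg (P : WalkKernel d) (U : List (ℝ × Site d)) (A : Set (Pt d)) :
    0 ≤ hitSum P U A := by
  induction U with
  | nil => simp [hitSum]
  | cons u U ih => rw [hitSum_cons]; exact add_nonneg ENNReal.toReal_nonneg ih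

lemma hitSum_empty (P : WalkKernel d) (U : List (ℝ × Site d)) : hitSum P U ∅ = 0 := by
  induction U with
  | nil => simp [hitSum]
  | cons u U ih => rw [hitSum_cons, ih]; simp [hitProb]

lemma measurable_hitSum (P : WalkKernel d) (U : List (ℝ × Site d)) : Measurable (hitSum P U) := by
  induction U with
  | nil => exact measurable_const
  | cons u U ih =>
    simp_rw [funext (hitSum_cons P u U)]
    exact (measurable_hitProb P u).ennreal_toReal.add ih

lemma hitSum_union_le (P : WalkKernel d) (U : List (ℝ × Site d)) (A B : Set (Pt d)) :
    hitSum P U (A ∪ B) ≤ hitSum P U A + hitSum P U B := by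
  induction U with
  | nil => simp [hitSum]
  | cons u U ih =>
    simp only [hitSum_cons]
    have h := ENNReal.toReal_mono (ENNReal.add_ne_top.2 ⟨hitProb_ne_top P u A, hitProb_ne_top P u B⟩)
      (hitProb_union_le P u A B)
    rw [ENNReal.toReal_add (hitProb_ne_top P u A) (hitProb_ne_top P u B)] at h
    linarith

lemma hitSum_mono (P : WalkKernel d) (U : List (ℝ × Site d)) {A B : Set (Pt d)} (h : A ⊆ B) :
    hitSum P U A ≤ hitSum P U B := by
  induction U with
  | nil => simp [hitSum]
  | cons u U ih =>
    simp only [hitSum_cons]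
    have h := ENNReal.toReal_mono (hitProb_ne_top P u B) (hitProb_mono P u h)
    linarith

/-! ### The number of sites visited in a unit of time -/

/-- The sites visited by `V` in the time interval `[s, s + 1]`. -/
def visits (V : Set (Pt d)) (s : ℝ) : Set (Site d) :=
  {z | ∃ q : ℚ, s ≤ q ∧ (q : ℝ) ≤ s + 1 ∧ (q, z) ∈ V}

/-- The number of sites visited by `V` in the time interval `[s, s + 1]`. -/
def visitCount (V : Set (Pt d)) (s : ℝ) : ℝ≥0∞ := ∑' z, (visits V s).indicator 1 z

lemma measurable_visitCount (s : ℝ) : Measurable fun V : Set (Pt d) => visitCount V s := by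
  refine Measurable.tsum fun z => ?_
  have h : MeasurableSet {V : Set (Pt d) | z ∈ visits V s} := by
    have : {V : Set (Pt d) | z ∈ visits V s} =
        ⋃ q : ℚ, ⋃ _ : s ≤ q ∧ (q : ℝ) ≤ s + 1, {V | (q, z) ∈ V} := by
      ext V; simp [visits, and_assoc]
    rw [this]
    exact .iUnion fun q => .iUnion fun _ => measurableSet_mem_of_measurable measurable_id _
  have e : (fun V : Set (Pt d) => (visits V s).indicator (1 : Site d → ℝ≥0∞) z) =
      {V : Set (Pt d) | z ∈ visits V s}.indicator 1 := by
    ext V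
    exact indicator_one_congr Iff.rfl
  rw [e]
  exact measurable_one.indicator h

lemma visitCount_mono {V V' : Set (Pt d)} {s s' : ℝ} (h : visits V s ⊆ visits V' s') :
    visitCount V s ≤ visitCount V' s' :=
  ENNReal.tsum_le_tsum fun z => Set.indicator_le_indicator_of_subset h (fun _ => zero_le) z

lemma Good.visitCount_le {w : Noise d} (hw : Good w) (a : ℝ × Site d) (s : ℝ) :
    visitCount (graph a w) s ≤ (stateAt w (s + 1 - a.1) + 1 : ℕ) := by
  classical
  set T := (Finset.range (stateAt w (s + 1 - a.1) + 1)).image fun k => a.2 + position w k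
  have hsub : visits (graph a w) s ⊆ T := by
    rintro z ⟨q, -, h2, k, h3, -, h5⟩
    simp only [T, Finset.coe_image, Finset.coe_range]
    refine ⟨k, ?_, h5.symm⟩
    have h6 := hw.lt_arrival_stateAt (s + 1 - a.1)
    have h7 : arrival w k < arrival w (stateAt w (s + 1 - a.1) + 1) := by
      simp only at h3
      linarith
    exact hw.strictMono.lt_iff_lt.1 h7
  calc visitCount (graph a w) s ≤ ∑' z, (T : Set (Site d)).indicator 1 z :=
        ENNReal.tsum_le_tsum fun z => Set.indicator_le_indicator_of_subset hsub (fun _ => zero_le) z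
    _ = (T.card : ℝ≥0∞) := by
      rw [← tsum_subtype]
      simp only [Pi.one_apply]
      rw [ENNReal.tsum_set_one, Set.encard_coe_eq_coe_finsetCard]; simp
    _ ≤ _ := by
      refine Nat.cast_le.2 (Finset.card_image_le.trans ?_)
      rw [Finset.card_range]

lemma Good.visitCount_ne_top {w : Noise d} (hw : Good w) (a : ℝ × Site d) (s : ℝ) :
    visitCount (graph a w) s ≠ ∞ := ne_top_of_le_ne_top (by simp) (hw.visitCount_le a s)

/-- The exponential moment of the number of jumps in a unit of time. -/
lemma lintegral_ex_stateAt_le (P : WalkKernel d) :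
    ∫⁻ w, ex ((stateAt w 1 + 1 : ℕ) : ℝ) ∂(noiseLaw P) ≤ ex (1 + Real.exp 1) := by
  have h1 : ∀ᵐ w ∂(noiseLaw P), ex ((stateAt w 1 + 1 : ℕ) : ℝ) ≤
      ∑' k : ℕ, {w : Noise d | arrival w k ≤ 1}.indicator (fun _ => ex ((k + 1 : ℕ) : ℝ)) w := by
    filter_upwards [ae_good P] with w hw
    refine le_trans (le_of_eq ?_) (ENNReal.le_tsum (stateAt w 1))
    rw [Set.indicator_of_mem]
    exact arrival_stateAt_le w zero_le_one
  have hms : ∀ k, MeasurableSet {w : Noise d | arrival w k ≤ 1} := fun k =>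
    measurableSet_le (measurable_arrival k) measurable_const
  refine (lintegral_mono_ae h1).trans ?_
  rw [lintegral_tsum fun k => (measurable_const.indicator (hms k)).aemeasurable]
  have h2 : ∀ k : ℕ, ∫⁻ w, {w : Noise d | arrival w k ≤ 1}.indicator
      (fun _ => ex ((k + 1 : ℕ) : ℝ)) w ∂(noiseLaw P) ≤
        ENNReal.ofReal (Real.exp 1 * (Real.exp 1 ^ k / k.factorial)) := by
    intro k
    rw [lintegral_indicator_const (hms k)]
    refine (mul_le_mul_right (noise_arrival_le P k 1) _).trans ?_
    rw [ex, ← ENNReal.ofReal_mul (Real.exp_nonneg _), simplexVol, if_pos zero_le_one]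
    refine ENNReal.ofReal_le_ofReal (le_of_eq ?_)
    rw [one_pow, ← Real.exp_nat_mul, mul_one]
    push_cast
    rw [Real.exp_add]; ring
  refine (ENNReal.tsum_le_tsum h2).trans ?_
  have hs : HasSum (fun k : ℕ => Real.exp 1 * (Real.exp 1 ^ k / k.factorial))
      (Real.exp 1 * Real.exp (Real.exp 1)) := by
    have := NormedSpace.expSeries_div_hasSum_exp (Real.exp 1)
    rw [← Real.exp_eq_exp_ℝ] at this
    exact this.mul_left _
  rw [← ENNReal.ofReal_tsum_of_nonneg (fun k => by positivity) hs.summable, hs.tsum_eq, ex,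
    Real.exp_add]

/-- The exponential moment of the number of sites that a walk visits in a unit of time. -/
lemma lintegral_ex_visitCount_le (P : WalkKernel d) (a : ℝ × Site d) {s : ℝ} (hs : a.1 ≤ s) :
    ∫⁻ w, ex (visitCount (graph a w) s).toReal ∂(noiseLaw P) ≤ ex (1 + Real.exp 1) := by
  have hΨ : Measurable fun V : Set (Pt d) => ex (visitCount V s).toReal :=
    measurable_ex.comp (measurable_visitCount s).ennreal_toReal
  -- Visiting this set means reaching time `s`: the strong Markov property becomes the simple one,
  -- and the sites counted are those of a fresh walk in its first unit of time.
  rw [lintegral_graph_splice P a {p | s ≤ p.1} hΨ]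
  calc _ ≤ ∫⁻ w, ex (1 + Real.exp 1) ∂(noiseLaw P) := by
        refine lintegral_mono_ae ?_
        filter_upwards [ae_good P] with w hw
        refine le_trans (lintegral_mono_ae ?_) (lintegral_ex_stateAt_le P)
        filter_upwards [ae_good P] with w' hw'
        have hle : ∀ p ∈ graph a w, p ∈ {p : Pt d | s ≤ p.1} → s ≤ p.1 := fun p _ h => h
        have hex : ∀ t, s < t → ∃ p ∈ graph a w, p ∈ {p : Pt d | s ≤ p.1} ∧ (p.1 : ℝ) < t := by
          intro t ht
          obtain ⟨q, h1, h2⟩ := exists_rat_btwn ht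
          exact ⟨(q, siteAt a w q), hw.mem_graph.2 ⟨hs.trans h1.le, rfl⟩, h1.le, h2⟩
        have hne : (graph a w ∩ {p : Pt d | s ≤ p.1}).Nonempty := by
          obtain ⟨p, h1, h2, -⟩ := hex (s + 1) (by linarith)
          exact ⟨p, h1, h2⟩
        have hτ := hitTime_eq hle hex
        rw [splice, if_pos hne, alive_eq_lt hle hex, hτ]
        set F := graph (s, siteAt a w s) w'
        have hsub : visits ({p | p ∈ graph a w ∧ (p.1 : ℝ) < s} ∪ F) s ⊆ visits F s := by
          rintro z ⟨q, h1, h2, h3 | h3⟩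
          · exact absurd h3.2 (not_lt.2 h1)
          · exact ⟨q, h1, h2, h3⟩
        refine ex_le (ENNReal.toReal_le_of_le_ofReal (Nat.cast_nonneg _) ?_)
        have := hw'.visitCount_le (s, siteAt a w s) s
        simp only [add_sub_cancel_left] at this
        rw [ENNReal.ofReal_natCast]
        exact (visitCount_mono hsub).trans this
    _ = _ := by simp

/-! ### The hitting probability of the graph of a walk -/

/-- Since `((x + 1) / x) ^ s ≥ 1 + 1 / x`, the terms of the series in `tsum_rpow_le` are dominated
by a telescoping difference. -/
lemma rpow_neg_step {x s : ℝ} (hx : 0 < x) (hs : 1 ≤ s) :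
    (x + 1) ^ (-(s + 1)) ≤ x ^ (-s) - (x + 1) ^ (-s) := by
  have hx1 : 0 < x + 1 := by linarith
  have h1 : x ^ (-s) = (x + 1) ^ (-s) * ((x + 1) / x) ^ s := by
    rw [Real.div_rpow hx1.le hx.le, Real.rpow_neg hx.le, Real.rpow_neg hx1.le]
    have := (Real.rpow_pos_of_pos hx s).ne'
    have := (Real.rpow_pos_of_pos hx1 s).ne'
    field_simp
  have h2 : (x + 1) / x ≤ ((x + 1) / x) ^ s :=
    Real.self_le_rpow_of_one_le ((one_le_div hx).2 (by linarith)) hs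
  have h3 : (x + 1) ^ (-(s + 1)) = (x + 1) ^ (-s) * (1 / (x + 1)) := by
    rw [neg_add, Real.rpow_add hx1, Real.rpow_neg_one, one_div]
  have h4 : 1 / (x + 1) ≤ 1 / x := one_div_le_one_div_of_le hx (by linarith)
  have h5 : (x + 1) / x = 1 + 1 / x := by field_simp
  rw [h1, h3]
  have h6 := Real.rpow_pos_of_pos hx1 (-s)
  nlinarith

lemma tsum_rpow_le {D s : ℝ} (hD : 0 < D) (hs : 1 ≤ s) :
    ∑' n : ℕ, ENNReal.ofReal ((D + n + 1) ^ (-(s + 1))) ≤ ENNReal.ofReal (D ^ (-s)) := by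
  refine ENNReal.tsum_le_of_sum_range_le fun n => ?_
  rw [← ENNReal.ofReal_sum_of_nonneg fun i _ => by positivity]
  refine ENNReal.ofReal_le_ofReal ?_
  suffices ∑ i ∈ Finset.range n, (D + i + 1) ^ (-(s + 1)) ≤ D ^ (-s) - (D + n) ^ (-s) by
    have : 0 ≤ (D + n : ℝ) ^ (-s) := by positivity
    linarith
  induction n with
  | zero => simp
  | succ n ih =>
    rw [Finset.sum_range_succ]
    have := rpow_neg_step (x := D + n) (by positivity) hs
    push_cast
    rw [← add_assoc]
    linarith

/-- A meeting happens at one of the sites that `v` visits in some unit interval after its release,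
and `u` visits each of them in that interval with probability bounded by the heat kernel. -/
lemma hitProb_graph_le {P : WalkKernel d} {C : ℝ}
    (hC : ∀ (a : ℝ × Site d) (z : Site d) (t : ℝ), a.1 ≤ t →
      noiseLaw P {w | ∃ q : ℚ, t ≤ q ∧ (q : ℝ) ≤ t + 1 ∧ (q, z) ∈ graph a w} ≤
        ENNReal.ofReal (C * (t - a.1 + 1) ^ (-(d : ℝ) / 2)))
    {u v : ℝ × Site d} (huv : u.1 < v.1) {w : Noise d} (hw : Good w) :
    hitProb P u (graph v w) ≤ ∑' n : ℕ, visitCount (graph v w) (v.1 + n) *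
      ENNReal.ofReal (C * (v.1 - u.1 + n + 1) ^ (-(d : ℝ) / 2)) := by
  have hsub : {w' : Noise d | (graph u w' ∩ graph v w).Nonempty} ⊆ ⋃ n : ℕ, ⋃ z : Site d,
      ⋃ _ : z ∈ visits (graph v w) (v.1 + n),
        {w' | ∃ q : ℚ, v.1 + n ≤ q ∧ (q : ℝ) ≤ v.1 + n + 1 ∧ (q, z) ∈ graph u w'} := by
    rintro w' ⟨p, h1, h2⟩
    have h3 := le_of_mem_graph hw p h2
    have h4 := Nat.floor_le (sub_nonneg.2 h3)
    have h5 := (Nat.lt_floor_add_one ((p.1 : ℝ) - v.1)).le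
    simp only [Set.mem_iUnion]
    exact ⟨⌊(p.1 : ℝ) - v.1⌋₊, p.2, ⟨p.1, by linarith, by linarith, h2⟩, p.1, by linarith,
      by linarith, h1⟩
  refine (measure_mono hsub).trans ((measure_iUnion_le _).trans (ENNReal.tsum_le_tsum fun n => ?_))
  refine (measure_iUnion_le _).trans ?_
  rw [visitCount, ← ENNReal.tsum_mul_right]
  refine ENNReal.tsum_le_tsum fun z => ?_
  by_cases hz : z ∈ visits (graph v w) (v.1 + n)
  · simp only [hz, Set.iUnion_true, Set.indicator_of_mem, Pi.one_apply, one_mul]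
    refine (hC u z (v.1 + n) (by linarith [(Nat.cast_nonneg n : (0 : ℝ) ≤ n)])).trans (le_of_eq ?_)
    congr 3; ring
  · simp [hz]

/-- Exponential moments of the expected number of walks from the past that a walk meets. -/
theorem exists_lintegral_ex_hitSum_le (P : WalkKernel d) : ∃ C B : ℝ, 0 < C ∧ 0 < B ∧
    ∀ ε : ℝ, 0 < ε → ε < ((d : ℝ) - 4) / 2 → ∀ (U : List (ℝ × Site d)) (v : ℝ × Site d) (θ : ℝ),
      (∀ u ∈ U, u.1 < v.1) → 0 ≤ θ →
      θ * (C * (U.map fun u => (v.1 - u.1) ^ (-(1 + ε))).sum) ≤ 1 →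
      ∫⁻ w, ex (θ * hitSum P U (graph v w)) ∂(noiseLaw P) ≤
        ex (B * (θ * (C * (U.map fun u => (v.1 - u.1) ^ (-(1 + ε))).sum))) := by
  obtain ⟨C, hC0, hC⟩ := exists_visit_le P
  refine ⟨C, Real.exp (1 + Real.exp 1), hC0, Real.exp_pos _, fun ε hε hεd U v θ hU hθ hΛ => ?_⟩
  -- The heat kernel exponent `d / 2` exceeds `s + 1 = 2 + ε`; summing over unit intervals costs one
  -- power and leaves `s`.
  set s : ℝ := 1 + ε
  have hpow : ∀ u ∈ U, ∀ n : ℕ, C * (v.1 - u.1 + n + 1) ^ (-(d : ℝ) / 2) ≤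
      C * (v.1 - u.1 + n + 1) ^ (-(s + 1)) := by
    intro u hu n
    have h1 := hU u hu
    refine mul_le_mul_of_nonneg_left (Real.rpow_le_rpow_of_exponent_le ?_ ?_) hC0.le
    · linarith [(Nat.cast_nonneg n : (0 : ℝ) ≤ n)]
    · simp only [s]; linarith
  have key : ∀ U : List (ℝ × Site d), (∀ u ∈ U, u.1 < v.1) →
      (∀ n : ℕ, 0 ≤ (U.map fun u => (v.1 - u.1 + n + 1) ^ (-(s + 1))).sum) ∧
      0 ≤ (U.map fun u => (v.1 - u.1) ^ (-s)).sum ∧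
      ∑' n : ℕ, ENNReal.ofReal (U.map fun u => (v.1 - u.1 + n + 1) ^ (-(s + 1))).sum ≤
        ENNReal.ofReal (U.map fun u => (v.1 - u.1) ^ (-s)).sum ∧
      ∀ w, Good w → ENNReal.ofReal (hitSum P U (graph v w)) ≤ ∑' n : ℕ,
        ENNReal.ofReal (C * (U.map fun u => (v.1 - u.1 + n + 1) ^ (-(s + 1))).sum) *
          visitCount (graph v w) (v.1 + n) := by
    intro U hU
    induction U with
    | nil => simp [hitSum]
    | cons u U ih =>
      obtain ⟨i1, i2, i3, i4⟩ := ih (fun x hx => hU x (List.mem_cons_of_mem _ hx))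
      have hu : u.1 < v.1 := hU u (by simp)
      have hD : 0 < v.1 - u.1 := sub_pos.2 hu
      simp only [List.map_cons, List.sum_cons]
      have hn : ∀ n : ℕ, 0 ≤ (v.1 - u.1 + n + 1) ^ (-(s + 1)) := fun n => by positivity
      refine ⟨fun n => add_nonneg (hn n) (i1 n), add_nonneg (by positivity) i2, ?_, fun w hw => ?_⟩
      · simp_rw [fun n => ENNReal.ofReal_add (hn n) (i1 n)]
        rw [ENNReal.tsum_add, ENNReal.ofReal_add (by positivity) i2]
        exact add_le_add (tsum_rpow_le hD (by simp only [s]; linarith)) i3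
      · rw [hitSum_cons, ENNReal.ofReal_add ENNReal.toReal_nonneg (hitSum_nonneg _ _ _),
          ENNReal.ofReal_toReal (hitProb_ne_top _ _ _)]
        simp_rw [mul_add, fun n => ENNReal.ofReal_add (mul_nonneg hC0.le (hn n))
          (mul_nonneg hC0.le (i1 n)), add_mul]
        rw [ENNReal.tsum_add]
        refine add_le_add ((hitProb_graph_le hC hu hw).trans (ENNReal.tsum_le_tsum fun n => ?_))
          (i4 w hw)
        rw [mul_comm]
        refine mul_le_mul_left (ENNReal.ofReal_le_ofReal ?_) _
        refine mul_le_mul_of_nonneg_left (Real.rpow_le_rpow_of_exponent_le ?_ ?_) hC0.le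
        · linarith [(Nat.cast_nonneg n : (0 : ℝ) ≤ n)]
        · simp only [s]; linarith
  obtain ⟨k1, k2, k3, k4⟩ := key U hU
  -- The weight of the `n`-th unit interval. The weights sum to at most `Λ ≤ 1`, so Jensen's
  -- inequality requires only the exponential moment of the sites visited in one unit of time.
  set p : ℕ → ℝ≥0∞ := fun n =>
    ENNReal.ofReal (θ * (C * (U.map fun u => (v.1 - u.1 + n + 1) ^ (-(s + 1))).sum)) with hp
  set Λ := θ * (C * (U.map fun u => (v.1 - u.1) ^ (-s)).sum) with hΛdef
  have hp1 : ∑' n, p n ≤ ENNReal.ofReal Λ := by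
    simp_rw [hp, hΛdef, ← mul_assoc, ENNReal.ofReal_mul (mul_nonneg hθ hC0.le)]
    rw [ENNReal.tsum_mul_left]
    gcongr
  have hp2 : ∑' n, p n ≤ 1 := hp1.trans (by simpa using ENNReal.ofReal_le_ofReal hΛ)
  have hb : ∀ᵐ w ∂(noiseLaw P), ex (θ * hitSum P U (graph v w)) ≤
      1 + ∑' n, p n * ex (visitCount (graph v w) (v.1 + n)).toReal := by
    filter_upwards [ae_good P] with w hw
    refine ex_le_one_add_tsum hp2 (fun n => hw.visitCount_ne_top v _)
      (mul_nonneg hθ (hitSum_nonneg _ _ _)) ?_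
    rw [ENNReal.ofReal_mul hθ]
    simp_rw [hp, ENNReal.ofReal_mul hθ, mul_assoc, ENNReal.tsum_mul_left]
    gcongr
    exact k4 w hw
  have hm : ∀ n : ℕ, Measurable fun w : Noise d =>
      p n * ex (visitCount (graph v w) (v.1 + n)).toReal := fun n =>
    (measurable_ex.comp ((measurable_visitCount _).comp
      (measurable_graph measurable_const measurable_id)).ennreal_toReal).const_mul _
  refine (lintegral_mono_ae hb).trans ?_
  rw [lintegral_add_left measurable_const, lintegral_tsum fun n => (hm n).aemeasurable]
  calc _ ≤ 1 + ∑' n, p n * ex (1 + Real.exp 1) := by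
        rw [lintegral_const, measure_univ, mul_one]
        refine add_le_add le_rfl (ENNReal.tsum_le_tsum fun n => ?_)
        rw [lintegral_const_mul']
        · exact mul_le_mul_right (lintegral_ex_visitCount_le P v
            (by linarith [(Nat.cast_nonneg n : (0 : ℝ) ≤ n)])) _
        · exact ENNReal.ofReal_ne_top
    _ ≤ 1 + ENNReal.ofReal Λ * ex (1 + Real.exp 1) := by
      rw [ENNReal.tsum_mul_right]; gcongr
    _ = 1 + ENNReal.ofReal (Real.exp (1 + Real.exp 1) * Λ) := by
      rw [mul_comm, ex, ENNReal.ofReal_mul (Real.exp_nonneg _)]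
    _ ≤ _ := one_add_ofReal_le_ex (mul_nonneg (Real.exp_nonneg _)
      (mul_nonneg hθ (mul_nonneg hC0.le k2)))

/-! ### Hölder's inequality for one block of walks -/

/-- Hölder's inequality for three functions. -/
lemma lintegral_mul_mul_le {α : Type*} [MeasurableSpace α] (μ : Measure α) {f g h : α → ℝ≥0∞}
    (hf : AEMeasurable f μ) (hg : AEMeasurable g μ) (hh : AEMeasurable h μ) {r p m : ℝ}
    (hr : 0 ≤ r) (hp : 0 ≤ p) (hm : 0 ≤ m) (hsum : r + p + m = 1) :
    ∫⁻ x, f x ^ r * g x ^ p * h x ^ m ∂μ ≤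
      (∫⁻ x, f x ∂μ) ^ r * (∫⁻ x, g x ∂μ) ^ p * (∫⁻ x, h x ∂μ) ^ m := by
  have := ENNReal.lintegral_prod_norm_pow_le (μ := μ) (Finset.univ : Finset (Fin 3))
    (f := ![f, g, h]) (p := ![r, p, m])
    (by intro i _; fin_cases i <;> simpa) (by simp [Fin.sum_univ_three, hsum])
    (by intro i _; fin_cases i <;> simpa)
  simpa [Fin.prod_univ_three] using this

/-- Being stopped by a union is being killed at `O` and then stopped by `A`. This keeps the
obstacles created inside a block apart from those of the later blocks. -/
lemma alive_union (V O A : Set (Pt d)) : alive V (A ∪ O) = alive (alive V O) A := by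
  ext p
  constructor
  · rintro ⟨hp, q, hq, hh⟩
    exact ⟨⟨hp, q, hq, fun p' hp' hO => hh p' hp' (Or.inr hO)⟩, q, hq,
      fun p' hp' hA => hh p' hp'.1 (Or.inl hA)⟩
  · rintro ⟨⟨hp, q, hq, hh⟩, q2, hq2, hh2⟩
    refine ⟨hp, min q q2, lt_min hq hq2, fun p' hp' h => ?_⟩
    by_contra hlt
    have hlt := lt_min_iff.1 (not_le.1 hlt)
    rcases h with h | h
    · exact absurd (hh2 p' ⟨hp', q, hlt.1, hh⟩ h) (not_le.2 hlt.2)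
    · exact absurd (hh p' hp' h) (not_le.2 hlt.1)

lemma weight_union_le {y : ℝ≥0∞} (hy : 1 ≤ y) (V O A : Set (Pt d)) :
    weight y V (A ∪ O) ≤ weight y (alive V O) A * weight y V O := by
  by_cases hO : (V ∩ O).Nonempty
  · rw [weight_of_hit hO]
    calc _ ≤ 1 * y := by rw [one_mul]; exact weight_le hy _ _
      _ ≤ _ := mul_le_mul_left (one_le_weight hy _ _) _
  · rw [alive_eq_self hO, weight_of_not_hit hO, mul_one]
    refine le_of_eq (weight_congr ?_)
    constructor
    · rintro ⟨p, hp, h | h⟩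
      · exact ⟨p, hp, h⟩
      · exact absurd ⟨p, hp, h⟩ hO
    · rintro ⟨p, hp, h⟩
      exact ⟨p, hp, Or.inl h⟩

lemma weight_rpow (x t : ℝ) (V O : Set (Pt d)) : weight (ex x) V O ^ t = weight (ex (x * t)) V O := by
  unfold weight; split_ifs
  · exact ex_rpow x t
  · simp

lemma lintegral_weight_le (P : WalkKernel d) {x : ℝ} (hx : 0 ≤ x) (a : ℝ × Site d)
    (O : Set (Pt d)) :
    ∫⁻ w, weight (ex x) (graph a w) O ∂(noiseLaw P) ≤
      ex ((Real.exp x - 1) * (hitProb P a O).toReal) := by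
  have hx1 : 0 ≤ Real.exp x - 1 := by linarith [Real.add_one_le_exp x]
  have e : ∀ w, weight (ex x) (graph a w) O =
      1 + {w : Noise d | (graph a w ∩ O).Nonempty}.indicator
        (fun _ => ENNReal.ofReal (Real.exp x - 1)) w := by
    intro w
    by_cases h : (graph a w ∩ O).Nonempty
    · rw [weight_of_hit h, Set.indicator_of_mem (by exact h), ← ENNReal.ofReal_one,
        ← ENNReal.ofReal_add zero_le_one hx1, ex]
      congr 1; ring
    · rw [weight_of_not_hit h, Set.indicator_of_notMem (by exact h), add_zero]
  simp_rw [e]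
  rw [lintegral_add_left measurable_const, lintegral_indicator_const (measurableSet_hit a O),
    lintegral_const, measure_univ, mul_one]
  refine le_trans (le_of_eq ?_) (one_add_ofReal_le_ex (mul_nonneg hx1 ENNReal.toReal_nonneg))
  rw [ENNReal.ofReal_mul hx1, ENNReal.ofReal_toReal (hitProb_ne_top _ _ _)]; rfl

/-- Decoupling of the walks of one block from the obstacles `O` and from the terminal functional. -/
theorem run_union_le (P : WalkKernel d) {x r p m : ℝ} (hx : 0 ≤ x) (hr : 0 < r) (hp : 0 < p)
    (hm : 0 < m) (hsum : 1 / r + 1 / p + 1 / m = 1) {Θ : Set (Pt d) → ℝ≥0∞} {X : Set (Pt d) → ℝ}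
    (hXm : Measurable X) (hX : ∀ A B, X (A ∪ B) ≤ X A + X B) (hXmono : ∀ A B, A ⊆ B → X A ≤ X B)
    (O : Set (Pt d)) {T : ℝ≥0∞} (hΘ : ∀ A, Θ (A ∪ O) ≤ T * ex (X A)) (l : List (ℝ × Site d))
    (A : Set (Pt d)) :
    run P (ex x) Θ l (A ∪ O) ≤ T * ex (X A) * gen P (ex (x * r)) l A ^ (1 / r) *
      (ex ((Real.exp (x * p) - 1) / p * hitSum P l O) *
        (l.map fun a => (∫⁻ w, ex (m * X (graph a w)) ∂(noiseLaw P)) ^ (1 / m)).prod) := by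
  induction l generalizing A with
  | nil => simpa [run, hitSum, ex_zero] using hΘ A
  | cons a l ih =>
    have hy : 1 ≤ ex x := one_le_ex hx
    set Q := ex ((Real.exp (x * p) - 1) / p * hitSum P l O) *
        (l.map fun a => (∫⁻ w, ex (m * X (graph a w)) ∂(noiseLaw P)) ^ (1 / m)).prod
    have hg : Measurable fun w : Noise d => graph a w := measurable_graph measurable_const measurable_id
    have hgO := Measurable.alive hg (measurable_const (a := O))
    have hgA := Measurable.alive hgO (measurable_const (a := A))
    have hf1 : Measurable fun w : Noise d => weight (ex (x * r)) (alive (graph a w) O) A *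
        gen P (ex (x * r)) l (A ∪ alive (alive (graph a w) O) A) :=
      (Measurable.weight _ hgO measurable_const).mul ((measurable_gen P _ l).comp
        (Measurable.set_union measurable_const hgA))
    have hf2 : Measurable fun w : Noise d => weight (ex (x * p)) (graph a w) O :=
      Measurable.weight _ hg measurable_const
    have hf3 : Measurable fun w : Noise d => ex (m * X (graph a w)) :=
      measurable_ex.comp ((hXm.comp hg).const_mul m)
    have hpt : ∀ w : Noise d, weight (ex x) (graph a w) (A ∪ O) *
        run P (ex x) Θ l ((A ∪ O) ∪ alive (graph a w) (A ∪ O)) ≤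
        T * ex (X A) * Q * ((weight (ex (x * r)) (alive (graph a w) O) A *
          gen P (ex (x * r)) l (A ∪ alive (alive (graph a w) O) A)) ^ (1 / r) *
          (weight (ex (x * p)) (graph a w) O) ^ (1 / p) * (ex (m * X (graph a w))) ^ (1 / m)) := by
      intro w
      -- The new live part joins `A` while `O` stays fixed, so the induction hypothesis applies with
      -- the same `O`. The Hölder exponents are also the same at every walk, so the powers of `gen`
      -- match.
      rw [alive_union, Set.union_right_comm]
      have h1 := ih (A ∪ alive (alive (graph a w) O) A)
      have h2 : ex (X (A ∪ alive (alive (graph a w) O) A)) ≤ ex (X A) * ex (X (graph a w)) := by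
        rw [← ex_add]
        refine ex_le ((hX _ _).trans (add_le_add le_rfl (hXmono _ _ ?_)))
        exact (alive_subset _ _).trans (alive_subset _ _)
      have h3 := weight_union_le hy (graph a w) O A
      have e1 : ex (m * X (graph a w)) ^ (1 / m) = ex (X (graph a w)) := by
        rw [ex_rpow]; congr 1; field_simp
      have e2 : weight (ex (x * p)) (graph a w) O ^ (1 / p) = weight (ex x) (graph a w) O := by
        rw [weight_rpow]; congr 2; field_simp
      have e3 : weight (ex (x * r)) (alive (graph a w) O) A ^ (1 / r) =
          weight (ex x) (alive (graph a w) O) A := by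
        rw [weight_rpow]; congr 2; field_simp
      rw [ENNReal.mul_rpow_of_nonneg _ _ (by positivity), e1, e2, e3]
      refine (mul_le_mul' h3 (h1.trans (mul_le_mul_left (mul_le_mul_left
        (mul_le_mul_right h2 T) _) _))).trans (le_of_eq ?_)
      ring
    calc run P (ex x) Θ (a :: l) (A ∪ O) ≤ _ := lintegral_mono hpt
      _ = T * ex (X A) * Q * ∫⁻ w, ((weight (ex (x * r)) (alive (graph a w) O) A *
          gen P (ex (x * r)) l (A ∪ alive (alive (graph a w) O) A)) ^ (1 / r) *
          (weight (ex (x * p)) (graph a w) O) ^ (1 / p) * (ex (m * X (graph a w))) ^ (1 / m))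
            ∂(noiseLaw P) :=
        lintegral_const_mul _ (((hf1.pow_const _).mul (hf2.pow_const _)).mul (hf3.pow_const _))
      _ ≤ T * ex (X A) * Q * (gen P (ex (x * r)) (a :: l) A ^ (1 / r) *
          ex ((Real.exp (x * p) - 1) * (hitProb P a O).toReal) ^ (1 / p) *
          (∫⁻ w, ex (m * X (graph a w)) ∂(noiseLaw P)) ^ (1 / m)) := by
        refine mul_le_mul_right ((lintegral_mul_mul_le _ hf1.aemeasurable hf2.aemeasurable
          hf3.aemeasurable (by positivity) (by positivity) (by positivity) hsum).trans ?_) _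
        refine mul_le_mul_left (mul_le_mul' (ENNReal.rpow_le_rpow ?_ (by positivity))
          (ENNReal.rpow_le_rpow ?_ (by positivity))) _
        -- The killing at `O` is removed here, which leaves the block running without outside
        -- obstacles.
        · exact lintegral_kill_le P (one_le_ex (by positivity)) a l A O
        · exact lintegral_weight_le P (by positivity) a O
      _ = _ := by
        rw [ex_rpow, hitSum_cons, mul_add, ex_add, List.map_cons, List.prod_cons]
        have : (Real.exp (x * p) - 1) * (hitProb P a O).toReal * (1 / p) =
          (Real.exp (x * p) - 1) / p * (hitProb P a O).toReal := by ring
        rw [this]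
        simp only [Q]
        ring

/-! ### Several blocks -/

/-- The concatenation of the first `n` blocks, the latest one first. -/
def pref {α : Type*} (L : ℕ → List α) : ℕ → List α
  | 0 => []
  | n + 1 => L n ++ pref L n

lemma gen_append_le (P : WalkKernel d) {x : ℝ} (hx : 0 ≤ x) (l l' : List (ℝ × Site d))
    (Γ : Set (Pt d)) : gen P (ex x) (l ++ l') Γ ≤ ex (l.length * x) * gen P (ex x) l' Γ := by
  induction l with
  | nil => simp [ex_zero]
  | cons a l ih =>
    refine (gen_cons_le P (one_le_ex hx) a (l ++ l') Γ (ex_ne_top x)).trans ?_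
    rw [List.length_cons, Nat.cast_add, Nat.cast_one, add_mul, one_mul, add_comm, ex_add, mul_assoc]
    exact mul_le_mul_right ih _

lemma one_le_gen (P : WalkKernel d) {x : ℝ} (hx : 0 ≤ x) (l : List (ℝ × Site d))
    (Γ : Set (Pt d)) : 1 ≤ gen P (ex x) l Γ := by
  induction l with
  | nil => simp [run]
  | cons a l ih => exact ih.trans (le_gen_cons P (one_le_ex hx) a l Γ)

lemma gen_le (P : WalkKernel d) {x : ℝ} (hx : 0 ≤ x) (l : List (ℝ × Site d))
    (Γ : Set (Pt d)) : gen P (ex x) l Γ ≤ ex (l.length * x) := by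
  simpa [run] using gen_append_le P hx l [] Γ

/-- Decoupling of several blocks. For each block, either the walks of the block are dropped, at the
price `Q i` for each of them, or they are decoupled from the earlier blocks by Hölder's
inequality. -/
theorem gen_pref_le (P : WalkKernel d) {x r p m κ : ℝ} (hx : 0 ≤ x) (hr : 0 < r) (hp : 0 < p)
    (hm : 0 < m) (hsum : 1 / r + 1 / p + 1 / m = 1) (hκ : κ = (Real.exp (x * p) - 1) / p)
    (L : ℕ → List (ℝ × Site d)) (Q : ℕ → ℝ) (n : ℕ)
    (hQ : ∀ i < n, x ≤ Q i ∨ ∀ v ∈ L i,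
      ∫⁻ w, ex (m * κ * hitSum P (pref L i) (graph v w)) ∂(noiseLaw P) ≤ ex (m * Q i))
    (O : Set (Pt d)) :
    gen P (ex x) (pref L n) O ≤
      ex (κ * hitSum P (pref L n) O + ∑ i ∈ Finset.range n, (L i).length * Q i) *
        ∏ i ∈ Finset.range n, gen P (ex (x * r)) (L i) ∅ ^ (1 / r) := by
  have hκ0 : 0 ≤ κ := by
    rw [hκ]
    have := Real.add_one_le_exp (x * p)
    have : 0 ≤ x * p := by positivity
    exact div_nonneg (by linarith) hp.le
  induction n generalizing O with
  | zero => simp [pref, run, hitSum, ex_zero]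
  | succ n ih =>
    have ih' := fun O => ih (fun i hi => hQ i (by omega)) O
    set R := ∏ i ∈ Finset.range n, gen P (ex (x * r)) (L i) ∅ ^ (1 / r)
    set W := ∑ i ∈ Finset.range n, (L i).length * Q i
    rw [Finset.prod_range_succ, Finset.sum_range_succ, pref, hitSum_append]
    have hg1 : 1 ≤ gen P (ex (x * r)) (L n) ∅ ^ (1 / r) :=
      ENNReal.one_le_rpow (one_le_gen P (by positivity) _ _) (by positivity)
    -- In the first case the block is dropped: each walk costs at most a factor `ex x ≤ ex (Q n)`,
    -- and the factors missing from the target are at least 1.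
    rcases hQ n (Nat.lt_succ_self n) with h | h
    · calc gen P (ex x) (L n ++ pref L n) O
          ≤ ex ((L n).length * x) * (ex (κ * hitSum P (pref L n) O + W) * R) :=
            (gen_append_le P hx _ _ O).trans (mul_le_mul_right (ih' O) _)
        _ ≤ ex ((L n).length * Q n) * (ex (κ * (hitSum P (L n) O + hitSum P (pref L n) O) + W) *
              R) * 1 := by
          rw [mul_one]
          refine mul_le_mul' (ex_le ?_) (mul_le_mul_left (ex_le ?_) _)
          · gcongr
          · have := mul_nonneg hκ0 (hitSum_nonneg P (L n) O)
            linarith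
        _ ≤ ex ((L n).length * Q n) * (ex (κ * (hitSum P (L n) O + hitSum P (pref L n) O) + W) *
              R) * gen P (ex (x * r)) (L n) ∅ ^ (1 / r) := mul_le_mul_right hg1 _
        _ = _ := by
          rw [← add_assoc, ex_add _ ((L n).length * Q n)]; ring
    · have hΘ : ∀ A, gen P (ex x) (pref L n) (A ∪ O) ≤
          (ex (κ * hitSum P (pref L n) O + W) * R) * ex (κ * hitSum P (pref L n) A) := by
        intro A
        refine (ih' (A ∪ O)).trans ?_
        rw [mul_right_comm, ← ex_add]
        refine mul_le_mul_left (ex_le ?_) _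
        have := mul_le_mul_of_nonneg_left (hitSum_union_le P (pref L n) A O) hκ0
        linarith
      -- The induction hypothesis at `A ∪ O` splits by subadditivity of `hitSum`: the `O` part is
      -- the constant `T`, the `A` part is the functional `X`. The block starts with `A = ∅`, where
      -- `X` vanishes.
      have key := run_union_le P hx hr hp hm hsum
        (X := fun A => κ * hitSum P (pref L n) A)
        ((measurable_hitSum P _).const_mul κ)
        (fun A B => by
          have := mul_le_mul_of_nonneg_left (hitSum_union_le P (pref L n) A B) hκ0
          linarith)
        (fun A B hAB => mul_le_mul_of_nonneg_left (hitSum_mono P _ hAB) hκ0) O hΘ (L n) ∅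
      rw [Set.empty_union] at key
      rw [gen, run_append]
      refine key.trans ?_
      have hprod : ((L n).map fun a => (∫⁻ w, ex (m * (κ * hitSum P (pref L n) (graph a w)))
          ∂(noiseLaw P)) ^ (1 / m)).prod ≤ ex ((L n).length * Q n) := by
        have : ∀ l : List (ℝ × Site d), (∀ v ∈ l, v ∈ L n) →
            (l.map fun a => (∫⁻ w, ex (m * (κ * hitSum P (pref L n) (graph a w)))
              ∂(noiseLaw P)) ^ (1 / m)).prod ≤ ex (l.length * Q n) := by
          intro l
          induction l with
          | nil => simp [ex_zero]
          | cons v l ihl =>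
            intro hl
            rw [List.map_cons, List.prod_cons, List.length_cons, Nat.cast_add, Nat.cast_one, add_mul,
              one_mul, add_comm, ex_add]
            refine mul_le_mul' ?_ (ihl fun z hz => hl z (List.mem_cons_of_mem _ hz))
            simp_rw [← mul_assoc]
            refine (ENNReal.rpow_le_rpow (h v (hl v (by simp))) (by positivity)).trans ?_
            rw [ex_rpow]
            refine ex_le (le_of_eq ?_)
            field_simp
        exact this _ fun _ h => h
      rw [hitSum_empty, mul_zero, ex_zero, mul_one, ← hκ]
      refine (mul_le_mul_right (mul_le_mul_right hprod _) _).trans (le_of_eq ?_)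
      rw [mul_add, add_assoc, ex_add, ex_add, ex_add, ex_add]
      ring

/-! ### The choice of the parameters -/

/-- Bernoulli's inequality for `exp (x * t) = (1 + (exp (x * s) - 1)) ^ (t / s)`. The sign of `x` is
free; the next lemma uses it at `-x`. -/
lemma exp_sub_one_div_mono {x s t : ℝ} (hs : 0 < s) (hst : s ≤ t) :
    (Real.exp (x * s) - 1) / s ≤ (Real.exp (x * t) - 1) / t := by
  have ht : 0 < t := hs.trans_le hst
  have h := one_add_mul_self_le_rpow_one_add (s := Real.exp (x * s) - 1)
    (by linarith [Real.exp_pos (x * s)]) ((one_le_div hs).2 hst)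
  rw [add_sub_cancel, ← Real.exp_mul] at h
  have e : x * s * (t / s) = x * t := by field_simp
  rw [e] at h
  rw [div_le_div_iff₀ hs ht]
  have h2 := mul_le_mul_of_nonneg_right h hs.le
  have e2 : (1 + t / s * (Real.exp (x * s) - 1)) * s = s + t * (Real.exp (x * s) - 1) := by
    field_simp
  rw [e2] at h2
  linarith

/-- Write the numerator as `exp (x * p) * (1 - exp (-(x * p)))`. The second factor over `p`
decreases in `p`, and the first grows by at most `exp 1 < 3` from `t` to `p`. -/
lemma exp_sub_one_div_le {x t p : ℝ} (ht : 0 < t) (htp : t ≤ p) (h : x * (p - t) ≤ 1)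
    (hx : 0 ≤ x) : (Real.exp (x * p) - 1) / p ≤ 3 * ((Real.exp (x * t) - 1) / t) := by
  have hp : 0 < p := ht.trans_le htp
  have h1 := exp_sub_one_div_mono (x := -x) ht htp
  have e : ∀ s, Real.exp (-x * s) = Real.exp (-(x * s)) := fun s => by congr 1; ring
  rw [e, e] at h1
  have h2 : Real.exp (x * p) - 1 = Real.exp (x * p) * (1 - Real.exp (-(x * p))) := by
    rw [mul_sub, ← Real.exp_add, mul_one, add_neg_cancel, Real.exp_zero]
  have h3 : Real.exp (x * t) - 1 = Real.exp (x * t) * (1 - Real.exp (-(x * t))) := by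
    rw [mul_sub, ← Real.exp_add, mul_one, add_neg_cancel, Real.exp_zero]
  have h4 : Real.exp (x * p) ≤ 3 * Real.exp (x * t) := by
    have : x * p = x * (p - t) + x * t := by ring
    rw [this, Real.exp_add]
    refine mul_le_mul_of_nonneg_right ?_ (Real.exp_nonneg _)
    exact (Real.exp_le_exp.2 h).trans (by linarith [Real.exp_one_lt_d9])
  have h5 : (1 - Real.exp (-(x * p))) / p ≤ (1 - Real.exp (-(x * t))) / t := by
    have e1 : (1 - Real.exp (-(x * p))) / p = -((Real.exp (-(x * p)) - 1) / p) := by ring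
    have e2 : (1 - Real.exp (-(x * t))) / t = -((Real.exp (-(x * t)) - 1) / t) := by ring
    rw [e1, e2]; linarith
  have h6 : 0 ≤ (1 - Real.exp (-(x * t))) / t := by
    refine div_nonneg (sub_nonneg.2 (Real.exp_le_one_iff.2 ?_)) ht.le
    have : 0 ≤ x * t := by positivity
    linarith
  calc (Real.exp (x * p) - 1) / p = Real.exp (x * p) * ((1 - Real.exp (-(x * p))) / p) := by
        rw [h2]; ring
    _ ≤ Real.exp (x * p) * ((1 - Real.exp (-(x * t))) / t) :=
      mul_le_mul_of_nonneg_left h5 (Real.exp_nonneg _)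
    _ ≤ 3 * Real.exp (x * t) * ((1 - Real.exp (-(x * t))) / t) :=
      mul_le_mul_of_nonneg_right h4 h6
    _ = _ := by rw [h3]; ring

/-- Each walk is absorbed at most once, so raising the exponent costs at most one factor `ex (x * (q
- r))` per walk. -/
lemma gen_mul_le (P : WalkKernel d) {x q r : ℝ} (hx : 0 ≤ x) (hrq : r ≤ q)
    (l : List (ℝ × Site d)) (Γ : Set (Pt d)) :
    gen P (ex (x * q)) l Γ ≤ ex (l.length * (x * (q - r))) * gen P (ex (x * r)) l Γ := by
  have hw : ∀ V Γ : Set (Pt d),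
      weight (ex (x * q)) V Γ ≤ ex (x * (q - r)) * weight (ex (x * r)) V Γ := by
    intro V Γ
    by_cases h : (V ∩ Γ).Nonempty
    · rw [weight_of_hit h, weight_of_hit h, ← ex_add]
      exact ex_le (by linarith)
    · rw [weight_of_not_hit h, weight_of_not_hit h, mul_one]
      exact one_le_ex (mul_nonneg hx (sub_nonneg.2 hrq))
  induction l generalizing Γ with
  | nil => simp [run, ex_zero]
  | cons a l ih =>
    rw [gen, run, gen, run, ← lintegral_const_mul' _ _ (ex_ne_top _)]
    refine lintegral_mono fun w => (mul_le_mul' (hw _ _) (ih _)).trans (le_of_eq ?_)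
    rw [List.length_cons, Nat.cast_add, Nat.cast_one, add_mul, one_mul, ex_add]
    ring

lemma length_pref {α : Type*} (L : ℕ → List α) (n : ℕ) :
    ((pref L n).length : ℝ) = ∑ i ∈ Finset.range n, ((L i).length : ℝ) := by
  induction n with
  | zero => simp [pref]
  | succ n ih =>
    rw [pref, List.length_append, Finset.sum_range_succ, Nat.cast_add, ih, add_comm]

lemma mem_pref {α : Type*} {L : ℕ → List α} {n : ℕ} {u : α} :
    u ∈ pref L n ↔ ∃ i < n, u ∈ L i := by
  induction n with
  | zero => simp [pref]
  | succ n ih =>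
    rw [pref, List.mem_append, ih]
    constructor
    · rintro (h | ⟨i, hi, h⟩)
      · exact ⟨n, by omega, h⟩
      · exact ⟨i, by omega, h⟩
    · rintro ⟨i, hi, h⟩
      rcases Nat.lt_succ_iff_lt_or_eq.1 hi with h' | rfl
      · exact Or.inr ⟨i, h', h⟩
      · exact Or.inl h

lemma sum_pref_le {L : ℕ → List (ℝ × Site d)} {D : ℕ → ℝ} {s t : ℝ} (hs : 0 ≤ s) (n : ℕ)
    (h : ∀ i < n, ∀ u ∈ L i, 0 < D i ∧ D i ≤ t - u.1) :
    ((pref L n).map fun u => (t - u.1) ^ (-s)).sum ≤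
      ∑ i ∈ Finset.range n, ((L i).length : ℝ) / D i ^ s := by
  induction n with
  | zero => simp [pref]
  | succ n ih =>
    rw [pref, List.map_append, List.sum_append, Finset.sum_range_succ, add_comm]
    refine add_le_add (ih fun i hi => h i (by omega)) ?_
    have h1 := List.sum_le_card_nsmul ((L n).map fun u => (t - u.1) ^ (-s)) (1 / D n ^ s) ?_
    · rw [List.length_map, nsmul_eq_mul, mul_one_div] at h1
      exact h1
    · intro z hz
      obtain ⟨u, hu, rfl⟩ := List.mem_map.1 hz
      obtain ⟨h2, h3⟩ := h n (Nat.lt_succ_self n) u hu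
      rw [one_div, ← Real.rpow_neg h2.le]
      exact Real.rpow_le_rpow_of_nonpos h2 h3 (by linarith)

lemma mul_le_exp {x L : ℝ} (hx : 0 < x) (h : L ≤ x ∨ L ≤ 1) : x * L ≤ Real.exp x := by
  have h1 := Real.quadratic_le_exp_of_nonneg hx.le
  rcases h with h | h
  · have h2 : x ^ 2 ≤ Real.exp x := by
      have h3 := Real.quadratic_le_exp_of_nonneg (x := x / 2) (by linarith)
      have h4 : Real.exp x = Real.exp (x / 2) * Real.exp (x / 2) := by
        rw [← Real.exp_add]; congr 1; ring
      have h5 : x ≤ 1 + x / 2 + (x / 2) ^ 2 / 2 := by nlinarith [sq_nonneg (x - 2)]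
      have h6 : x ≤ Real.exp (x / 2) := h5.trans h3
      rw [h4, sq]
      exact mul_le_mul h6 h6 hx.le (Real.exp_nonneg _)
    nlinarith
  · nlinarith

set_option maxHeartbeats 1000000 in
/-- The moment generating function of the number of coalescing walks of several blocks. -/
theorem exists_gen_pref_le (P : WalkKernel d) : ∃ C : ℝ, 0 < C ∧
    ∀ ε : ℝ, 0 < ε → ε < ((d : ℝ) - 4) / 2 → ∀ K x r r' : ℝ, 0 < K → 0 < x → 1 < r → 1 < r' →
      1 / r + 1 / r' = 1 → ∀ (L : ℕ → List (ℝ × Site d)) (D : ℕ → ℕ → ℝ) (n : ℕ),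
      (∀ i j, 0 ≤ D i j) →
      (∀ i j, i < j → ∀ u ∈ L i, ∀ v ∈ L j, 0 < D i j ∧ D i j ≤ v.1 - u.1) →
      gen P (ex x) (pref L n) ∅ ≤
        ex (1 / (K ^ (1 / 4 : ℝ) / 2) * Real.exp x * ∑ j ∈ Finset.range n, ((L j).length : ℝ) +
          C * K * ((Real.exp (x * r') - 1) / r') * ∑ j ∈ Finset.range n, ((L j).length : ℝ) *
            ∑ i ∈ Finset.range j, ((L i).length : ℝ) / D i j ^ (1 + ε)) *
        ∏ j ∈ Finset.range n, gen P (ex (x * r)) (L j) ∅ ^ (1 / r) := by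
  obtain ⟨C, B, hC, hB, hmain⟩ := exists_lintegral_ex_hitSum_le P
  -- The 3 pays for `κ' ≤ 3 * κ`. `B + 1` instead of `B` makes `Q j` dominate both the exponential
  -- moment bound and, through its summand 1, the total weight in that bound's hypothesis.
  refine ⟨3 * C * (B + 1), by positivity, ?_⟩
  intro ε hε hεd K x r r' hK hx hr hr' hrr L D n hD0 hD
  set Lc := K ^ (1 / 4 : ℝ) / 2 with hLc
  have hLc0 : 0 < Lc := by positivity
  have hKL : K = 16 * Lc ^ 4 := by
    rw [hLc, div_pow, ← Real.rpow_natCast, ← Real.rpow_mul hK.le]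
    norm_num
    ring
  set κ := (Real.exp (x * r') - 1) / r' with hκ
  have hκ0 : 0 < κ := by
    have : 0 < x * r' := by positivity
    exact div_pos (by linarith [Real.add_one_le_exp (x * r')]) (by linarith)
  set a : ℕ → ℝ := fun j => ∑ i ∈ Finset.range j, ((L i).length : ℝ) / D i j ^ (1 + ε) with ha
  have ha0 : ∀ j, 0 ≤ a j := fun j => Finset.sum_nonneg fun i _ =>
    div_nonneg (Nat.cast_nonneg _) (Real.rpow_nonneg (hD0 i j) _)
  set Q : ℕ → ℝ := fun j => 3 * C * (B + 1) * K * κ * a j with hQdef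
  have hQ0 : ∀ j, 0 ≤ Q j := fun j => mul_nonneg (by positivity) (ha0 j)
  have eQ : 3 * C * (B + 1) * K * κ * ∑ j ∈ Finset.range n, ((L j).length : ℝ) * a j =
      ∑ j ∈ Finset.range n, ((L j).length : ℝ) * Q j := by
    rw [Finset.mul_sum]
    exact Finset.sum_congr rfl fun j _ => by simp only [hQdef]; ring
  rw [eQ]
  have hsumQ : 0 ≤ ∑ j ∈ Finset.range n, ((L j).length : ℝ) * Q j :=
    Finset.sum_nonneg fun j _ => mul_nonneg (Nat.cast_nonneg _) (hQ0 j)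
  -- Here the trivial bound `x` per walk is already below `exp x / Lc`, the price per walk allowed
  -- by `δ`.
  by_cases htriv : Lc ≤ x ∨ Lc ≤ 1
  · refine (gen_le P hx.le _ _).trans ?_
    rw [length_pref, ← mul_one (ex _)]
    refine mul_le_mul' (ex_le ?_) (Finset.one_le_prod' fun j _ =>
      ENNReal.one_le_rpow (one_le_gen P (by positivity) _ _) (by positivity))
    have h1 : x ≤ 1 / Lc * Real.exp x := by
      rw [one_div, inv_mul_eq_div, le_div_iff₀ hLc0]
      exact mul_le_exp hx htriv
    have h2 : 0 ≤ ∑ j ∈ Finset.range n, ((L j).length : ℝ) :=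
      Finset.sum_nonneg fun j _ => Nat.cast_nonneg _
    linarith [mul_le_mul_of_nonneg_left h1 h2]
  · rw [not_or, not_le, not_le] at htriv
    obtain ⟨hxL, hL1⟩ := htriv
    have hK1 : 1 ≤ K := by
      rw [hKL]; linarith [one_le_pow₀ (n := 4) hL1.le]
    -- Capping the conjugate exponent at `Lc` keeps `m` bounded in terms of `K`. The exponent `q`
    -- conjugate to `t` is at least `r`; returning from `q` to `r` costs `x * (1 - r / q) ≤ x / Lc`
    -- per walk.
    set t := min r' Lc with ht
    have ht1 : 1 < t := lt_min hr' hL1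
    have ht0 : 0 < t := by linarith
    have htr : t ≤ r' := min_le_left _ _
    have htL : t ≤ Lc := min_le_right _ _
    set q := t / (t - 1) with hq
    have hq0 : 0 < q := div_pos ht0 (by linarith)
    have hq1 : 1 / q = 1 - 1 / t := by
      rw [hq]; have : t - 1 ≠ 0 := by linarith
      field_simp
    have hr1 : 1 / r = 1 - 1 / r' := by linarith
    have hqr1 : 1 / q ≤ 1 / r := by
      rw [hq1, hr1]
      linarith [one_div_le_one_div_of_le ht0 htr]
    have hqr : r ≤ q := (one_div_le_one_div hq0 (by linarith)).1 hqr1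
    have hdef : 1 - r / q ≤ 1 / Lc := by
      have e : r / q = r * (1 / q) := by ring
      rcases le_total r' Lc with h | h
      · have : t = r' := min_eq_left h
        rw [e, hq1, this, ← hr1, mul_one_div_cancel (by linarith)]
        simp only [sub_self]; positivity
      · have : t = Lc := min_eq_right h
        rw [e, hq1, this]
        have h3 : 1 / Lc ≤ 1 := by rw [div_le_one hLc0]; exact hL1.le
        linarith [mul_nonneg (sub_nonneg.2 hr.le) (sub_nonneg.2 h3)]
    -- `1 / t` is shared between `p`, slightly above `t`, and a large `m`. This `A` gives `x * (p -
    -- t) = x * t / A ≤ 1` since `x` and `t` are at most `Lc`, so `κ'` is comparable with `κ`.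
    set A := Lc ^ 2 + 1 with hA
    have hA0 : 0 < A := by positivity
    set p := t * (1 + 1 / A) with hp
    set m := t * (A + 1) with hm
    have hp0 : 0 < p := by positivity
    have hm0 : 0 < m := by positivity
    have hsum : 1 / q + 1 / p + 1 / m = 1 := by
      rw [hq1, hp, hm]; field_simp; ring
    set κ' := (Real.exp (x * p) - 1) / p with hκ'
    have hκ'0 : 0 ≤ κ' := by
      have : 0 < x * p := by positivity
      exact div_nonneg (by linarith [Real.add_one_le_exp (x * p)]) hp0.le
    have hκκ : κ' ≤ 3 * κ := by
      refine (exp_sub_one_div_le ht0 ?_ ?_ hx.le).trans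
        (mul_le_mul_of_nonneg_left (exp_sub_one_div_mono ht0 htr) (by norm_num))
      · rw [hp]; nlinarith [show 0 < 1 / A by positivity]
      · have e : x * (p - t) = x * t / A := by rw [hp]; field_simp; ring
        rw [e, div_le_one hA0, hA]
        linarith [mul_le_mul hxL.le htL ht0.le hLc0.le]
    have key := gen_pref_le P (n := n) hx.le hq0 hp0 hm0 hsum hκ' L Q ?_ ∅
    · refine key.trans ?_
      rw [hitSum_empty, mul_zero, zero_add, add_comm, ex_add, mul_assoc]
      refine mul_le_mul_right ?_ _
      rw [Finset.mul_sum]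
      have hex : ∀ T : Finset ℕ, ∀ f : ℕ → ℝ, ex (∑ j ∈ T, f j) = ∏ j ∈ T, ex (f j) := by
        intro T f
        induction T using Finset.induction_on with
        | empty => simp [ex_zero]
        | insert j T hj ih => rw [Finset.sum_insert hj, Finset.prod_insert hj, ex_add, ih]
      rw [hex, ← Finset.prod_mul_distrib]
      refine Finset.prod_le_prod' fun j _ => ?_
      have h1 : 1 ≤ gen P (ex (x * r)) (L j) ∅ := one_le_gen P (by positivity) _ _
      calc gen P (ex (x * q)) (L j) ∅ ^ (1 / q)
          ≤ (ex ((L j).length * (x * (q - r))) * gen P (ex (x * r)) (L j) ∅) ^ (1 / q) :=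
            ENNReal.rpow_le_rpow (gen_mul_le P hx.le hqr _ _) (by positivity)
        _ = ex ((L j).length * (x * (1 - r / q))) * gen P (ex (x * r)) (L j) ∅ ^ (1 / q) := by
          rw [ENNReal.mul_rpow_of_nonneg _ _ (by positivity), ex_rpow]
          congr 2
          field_simp
        _ ≤ _ := by
          refine mul_le_mul' (ex_le ?_) (ENNReal.rpow_le_rpow_of_exponent_le h1 hqr1)
          have h2 : x * (1 - r / q) ≤ 1 / Lc * Real.exp x := by
            calc x * (1 - r / q) ≤ x * (1 / Lc) := mul_le_mul_of_nonneg_left hdef hx.le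
              _ = 1 / Lc * x := mul_comm _ _
              _ ≤ _ := mul_le_mul_of_nonneg_left
                (by linarith [Real.add_one_le_exp x]) (by positivity)
          have := mul_le_mul_of_nonneg_left h2 (Nat.cast_nonneg (α := ℝ) (L j).length)
          linarith
    · intro j hj
      by_cases hxQ : x ≤ Q j
      · exact Or.inl hxQ
      · right
        intro v hv
        have hU : ∀ u ∈ pref L j, u.1 < v.1 := by
          intro u hu
          obtain ⟨i, hi, hu⟩ := mem_pref.1 hu
          have := hD i j hi u hu v hv
          linarith
        set S := ((pref L j).map fun u => (v.1 - u.1) ^ (-(1 + ε))).sum with hS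
        have hSa : S ≤ a j := sum_pref_le (by linarith) j fun i hi u hu => hD i j hi u hu v hv
        have hS0 : 0 ≤ S := by
          refine List.sum_nonneg fun z hz => ?_
          obtain ⟨u, hu, rfl⟩ := List.mem_map.1 hz
          exact Real.rpow_nonneg (by linarith [hU u hu]) _
        have hCS : κ' * (C * S) ≤ 3 * κ * (C * a j) :=
          mul_le_mul hκκ (mul_le_mul_of_nonneg_left hSa hC.le) (by positivity) (by positivity)
        have hka : 0 ≤ 3 * κ * (C * a j) := by
          have := ha0 j; positivity
        have hQj : Q j = (B + 1) * K * (3 * κ * (C * a j)) := by simp only [hQdef]; ring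
        refine (hmain ε hε hεd (pref L j) v (m * κ') hU (by positivity) ?_).trans (ex_le ?_)
        -- Since the block is kept, `Q j < x < Lc`. With `m ≤ Lc * (A + 1)`, `K` times the total
        -- weight is at most `Lc ^ 4 + 2 * Lc ^ 2 ≤ 16 * Lc ^ 4 = K`, so the weight is at most 1.
        -- This is the source of the fourth root in `Lc`.
        · have h1 : K * (3 * κ * (C * a j)) ≤ Lc := by
            have h2 : 0 ≤ B * (K * (3 * κ * (C * a j))) := by positivity
            have h3 : Q j < x := not_le.1 hxQ
            rw [hQj] at h3
            linarith
          have h2 : m ≤ Lc * (A + 1) := mul_le_mul_of_nonneg_right htL (by positivity)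
          have h3 : m * κ' * (C * S) ≤ Lc * (A + 1) * (3 * κ * (C * a j)) := by
            rw [mul_assoc]
            exact mul_le_mul h2 hCS (by positivity) (by positivity)
          refine h3.trans ?_
          have h4 : K * (Lc * (A + 1) * (3 * κ * (C * a j))) ≤ K * 1 := by
            calc K * (Lc * (A + 1) * (3 * κ * (C * a j)))
                = Lc * (A + 1) * (K * (3 * κ * (C * a j))) := by ring
              _ ≤ Lc * (A + 1) * Lc := mul_le_mul_of_nonneg_left h1 (by positivity)
              _ ≤ K * 1 := by
                rw [hKL, hA]
                have h5 : 1 ≤ Lc ^ 2 := one_le_pow₀ hL1.le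
                linarith [mul_le_mul_of_nonneg_left h5 (sq_nonneg Lc)]
          exact le_of_mul_le_mul_left h4 hK
        · rw [hQj]
          have h1 : B * (m * κ' * (C * S)) = m * (B * (κ' * (C * S))) := by ring
          rw [h1]
          refine mul_le_mul_of_nonneg_left ?_ hm0.le
          have h2 : B * (κ' * (C * S)) ≤ B * (3 * κ * (C * a j)) :=
            mul_le_mul_of_nonneg_left hCS hB.le
          have h3 : B * (3 * κ * (C * a j)) ≤ (B + 1) * K * (3 * κ * (C * a j)) := by
            refine mul_le_mul_of_nonneg_right ?_ hka
            linarith [mul_le_mul_of_nonneg_left hK1 hB.le]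
          exact h2.trans h3

/-! ### Blocks of release times -/

lemma map_pref {α β : Type*} (f : α → β) (T : ℕ → List α) (n : ℕ) :
    (pref T n).map f = pref (fun i => (T i).map f) n := by
  induction n with
  | zero => rfl
  | succ n ih => rw [pref, List.map_append, ih, pref]

lemma pairwise_pref {T : ℕ → List ℝ} (h1 : ∀ i, (T i).Pairwise (· > ·))
    (h2 : ∀ i j, i < j → ∀ u ∈ T i, ∀ v ∈ T j, u < v) (n : ℕ) : (pref T n).Pairwise (· > ·) := by
  induction n with
  | zero => exact List.Pairwise.nil
  | succ n ih =>
    refine List.pairwise_append.2 ⟨h1 n, ih, fun v hv u hu => ?_⟩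
    obtain ⟨i, hi, hu⟩ := mem_pref.1 hu
    exact h2 i n hi u hu v hv

/-- The release times of the `i`-th block in decreasing order. -/
def times {N : ℕ} (S : Fin N → Finset ℝ) (i : ℕ) : List ℝ :=
  if h : i < N then (S ⟨i, h⟩).sort (· ≥ ·) else []

section Times

variable {N : ℕ} {S : Fin N → Finset ℝ}

lemma times_fin (i : Fin N) : times S i = (S i).sort (· ≥ ·) := dif_pos i.2

lemma mem_times {i : ℕ} {u : ℝ} : u ∈ times S i ↔ ∃ h : i < N, u ∈ S ⟨i, h⟩ := by
  unfold times
  split_ifs with h <;> simp [h]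

lemma length_times (i : Fin N) : (times S i).length = (S i).card := by
  rw [times_fin, Finset.length_sort]

lemma pairwise_times (i : ℕ) : (times S i).Pairwise (· > ·) := by
  unfold times
  split_ifs with h
  · exact (Finset.sortedGT_sort _).pairwise
  · exact List.Pairwise.nil

end Times

lemma blockDist_nonneg (A B : Finset ℝ) : 0 ≤ blockDist A B := by
  refine Real.sInf_nonneg ?_
  rintro _ ⟨u, -, v, -, rfl⟩
  exact dist_nonneg

lemma blockDist_le {A B : Finset ℝ} {u v : ℝ} (hu : u ∈ A) (hv : v ∈ B) :
    blockDist A B ≤ dist u v := by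
  refine csInf_le ⟨0, ?_⟩ ⟨u, hu, v, hv, rfl⟩
  rintro _ ⟨u, -, v, -, rfl⟩
  exact dist_nonneg

lemma blockDist_pos {A B : Finset ℝ} (hA : A.Nonempty) (hB : B.Nonempty)
    (h : ∀ u ∈ A, ∀ v ∈ B, u < v) : 0 < blockDist A B := by
  have hne : (Set.image2 dist (A : Set ℝ) (B : Set ℝ)).Nonempty := hA.to_set.image2 hB.to_set
  obtain ⟨u, hu, v, hv, e⟩ := hne.csInf_mem (A.finite_toSet.image2 dist B.finite_toSet)
  rw [blockDist, ← e]
  exact dist_pos.2 (h u hu v hv).ne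

/-- The exponential moments of `numCoal`. -/
lemma integral_rpow_numCoal (P : WalkKernel d) (ψ : ℝ → Site d) {l : List ℝ}
    (hl : l.Pairwise (· > ·)) {S : Finset ℝ} (hS : ∀ u, u ∈ S ↔ u ∈ l) {ρ : ℝ} (hρ : 0 < ρ)
    (hρ1 : ρ < 1) {t : ℝ} (ht : 0 ≤ t) :
    Integrable (fun ω => ρ ^ (-(t * (numCoal ψ S ω : ℝ)))) (law P) ∧
      ENNReal.ofReal (∫ ω, ρ ^ (-(t * (numCoal ψ S ω : ℝ))) ∂(law P)) =
        gen P (ex (-Real.log ρ * t)) (l.map fun u => (u, ψ u)) ∅ := by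
  have hx : 0 ≤ -Real.log ρ := by linarith [Real.log_neg hρ hρ1]
  have e1 : ∀ n : ℕ, ENNReal.ofReal (ρ ^ (-(t * (n : ℝ)))) = ex (-Real.log ρ * t) ^ n := by
    intro n
    rw [ex_pow, ex, Real.rpow_def_of_pos hρ]
    congr 2; ring
  have hae := ae_numCoal_eq P ψ hl hS
  have hm : Measurable fun ω : ℝ → Noise d => ρ ^ (-(t * (hits (graphs ψ ω l) ∅ : ℝ))) :=
    (measurable_of_countable (fun n : ℕ => ρ ^ (-(t * (n : ℝ))))).comp
      ((measurable_hits ψ l).comp (measurable_id.prodMk measurable_const))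
  -- Measurability is needed only up to a null set, and `hits` provides a measurable version.
  have haem : AEStronglyMeasurable (fun ω => ρ ^ (-(t * (numCoal ψ S ω : ℝ)))) (law P) :=
    ⟨_, hm.stronglyMeasurable, by filter_upwards [hae] with ω h; rw [h]⟩
  have hnn : 0 ≤ᵐ[law P] fun ω => ρ ^ (-(t * (numCoal ψ S ω : ℝ))) :=
    .of_forall fun ω => Real.rpow_nonneg hρ.le _
  have hlin : ∫⁻ ω, ENNReal.ofReal (ρ ^ (-(t * (numCoal ψ S ω : ℝ)))) ∂(law P) =
      gen P (ex (-Real.log ρ * t)) (l.map fun u => (u, ψ u)) ∅ := by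
    rw [← lintegral_pow_hits P _ ψ (hl.imp fun h => ne_of_gt h)]
    refine lintegral_congr_ae ?_
    filter_upwards [hae] with ω h
    rw [e1, h]
  have hfin : Integrable (fun ω => ρ ^ (-(t * (numCoal ψ S ω : ℝ)))) (law P) := by
    refine ⟨haem, ?_⟩
    rw [hasFiniteIntegral_iff_ofReal hnn, hlin]
    exact lt_of_le_of_lt (gen_le P (mul_nonneg hx ht) _ _) (ex_ne_top _).lt_top
  exact ⟨hfin, by rw [ofReal_integral_eq_lintegral_ofReal hfin hnn, hlin]⟩

/-- The induction over blocks groups pairs by the later block, the theorem by the earlier one. -/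
lemma sum_range_eq_sum_fin {N : ℕ} (c : Fin N → ℝ) (g : Fin N → Fin N → ℝ) (a : ℕ → ℝ)
    (b : ℕ → ℕ → ℝ) (ha : ∀ j : Fin N, a j = c j) (hb : ∀ i j : Fin N, c j * b i j = g i j) :
    ∑ j ∈ Finset.range N, a j * ∑ i ∈ Finset.range j, b i j =
      ∑ i : Fin N, ∑ j ∈ Finset.univ.filter (fun j : Fin N => i < j), g i j := by
  simp_rw [Finset.sum_filter]
  rw [Finset.sum_comm, Finset.sum_range]
  refine Finset.sum_congr rfl fun j _ => ?_
  have e : Finset.range j = (Finset.range N).filter (fun i => i < (j : ℕ)) := by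
    ext i
    have := j.2
    simp only [Finset.mem_range, Finset.mem_filter]
    omega
  rw [e, Finset.sum_filter, Finset.sum_range, Finset.mul_sum]
  refine Finset.sum_congr rfl fun i _ => ?_
  simp only [Fin.lt_def]
  split_ifs
  · rw [ha, hb]
  · simp

end CoalescingRW

end

/-! ### Proof of the decoupling inequality -/

open CoalescingRW in
theorem proposition4p1 (d : ℕ) (hd : 5 ≤ d) (P : WalkKernel d) :
    ∃ (δ : ℝ → ℝ) (C : ℝ → ℝ),
      (∀ K : ℝ, 0 < K → 0 < δ K) ∧
      Filter.Tendsto δ Filter.atTop (nhds 0) ∧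
      (∀ ε : ℝ, 0 < ε → ε < ((d : ℝ) - 4) / 2 → 0 < C ε) ∧
      ∀ (ρ : ℝ), 0 < ρ → ρ < 1 →
      ∀ (ψ : ℝ → Site d) (N : ℕ) (S : Fin N → Finset ℝ),
      (∀ i j : Fin N, i < j → ∀ s ∈ S i, ∀ t ∈ S j, s < t) →
      ∀ (ε K r r' : ℝ), 0 < ε → ε < ((d : ℝ) - 4) / 2 → 0 < K → 1 < r → 1 < r' →
      1 / r + 1 / r' = 1 →
      MeasureTheory.Integrable
        (fun ω => ρ ^ (-(numCoal ψ (Finset.univ.biUnion S) ω : ℝ))) (law P) ∧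
      ∫ ω, ρ ^ (-(numCoal ψ (Finset.univ.biUnion S) ω : ℝ)) ∂(law P) ≤
        Real.exp (δ K / ρ * ∑ j : Fin N, ((S j).card : ℝ)
          + C ε * K * ((ρ ^ (-r') - 1) / r') *
            ∑ j : Fin N, ∑ k ∈ Finset.univ.filter (fun k : Fin N => j < k),
              ((S j).card : ℝ) * ((S k).card : ℝ) / blockDist (S j) (S k) ^ (1 + ε))
        * (∏ j : Fin N, ∫ ω, ρ ^ (-(r * (numCoal ψ (S j) ω : ℝ))) ∂(law P)) ^ (1 / r) := by
  obtain ⟨C, hC, hmain⟩ := exists_gen_pref_le P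
  refine ⟨fun K => 1 / (K ^ (1 / 4 : ℝ) / 2), fun _ => C, fun K hK => by positivity, ?_,
    fun _ _ _ => hC, ?_⟩
  · have h : Tendsto (fun K : ℝ => K ^ (1 / 4 : ℝ) / 2) atTop atTop :=
      (tendsto_rpow_atTop (by norm_num)).atTop_div_const (by norm_num)
    exact h.inv_tendsto_atTop.congr fun K => (one_div _).symm
  intro ρ hρ hρ1 ψ N S hS ε K r r' hε hεd hK hr hr' hrr
  -- With `x = -log ρ` one has `exp x = 1 / ρ` and `exp (x * r') = ρ ^ (-r')`, the two quantities in
  -- the exponent.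
  have hx : 0 < -Real.log ρ := by linarith [Real.log_neg hρ hρ1]
  set T := times S
  set L : ℕ → List (ℝ × Site d) := fun i => (T i).map fun u => (u, ψ u)
  -- Outside the range the blocks are empty lists, so the value 0 never has to be positive.
  set D : ℕ → ℕ → ℝ := fun i j =>
    if h : i < N ∧ j < N then blockDist (S ⟨i, h.1⟩) (S ⟨j, h.2⟩) else 0 with hDdef
  have hlen : ∀ i : Fin N, ((L i).length : ℝ) = (S i).card := fun i => by
    simp only [L, T, List.length_map, length_times]
  have hTT : ∀ i j, i < j → ∀ u ∈ T i, ∀ v ∈ T j, u < v := by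
    intro i j hij u hu v hv
    obtain ⟨hi, hu⟩ := mem_times.1 hu
    obtain ⟨hj, hv⟩ := mem_times.1 hv
    exact hS _ _ hij u hu v hv
  have hD0 : ∀ i j, 0 ≤ D i j := by
    intro i j
    simp only [hDdef]
    split_ifs
    · exact blockDist_nonneg _ _
    · exact le_rfl
  have hD : ∀ i j, i < j → ∀ u ∈ L i, ∀ v ∈ L j, 0 < D i j ∧ D i j ≤ v.1 - u.1 := by
    intro i j hij u hu v hv
    obtain ⟨u, hu', rfl⟩ := List.mem_map.1 hu
    obtain ⟨v, hv', rfl⟩ := List.mem_map.1 hv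
    clear hu hv
    have huv := hTT i j hij u hu' v hv'
    obtain ⟨hi, hu⟩ := mem_times.1 hu'
    obtain ⟨hj, hv⟩ := mem_times.1 hv'
    simp only [hDdef, dif_pos (And.intro hi hj)]
    refine ⟨blockDist_pos ⟨u, hu⟩ ⟨v, hv⟩ (hS _ _ hij), (blockDist_le hu hv).trans ?_⟩
    rw [dist_comm, Real.dist_eq, abs_of_pos (sub_pos.2 huv)]
  have key := hmain ε hε hεd K (-Real.log ρ) r r' hK hx hr hr' hrr L D N hD0 hD
  have hU : ∀ u, u ∈ Finset.univ.biUnion S ↔ u ∈ pref T N := by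
    intro u
    rw [mem_pref, Finset.mem_biUnion]
    constructor
    · rintro ⟨i, -, hu⟩
      exact ⟨i, i.2, mem_times.2 ⟨i.2, hu⟩⟩
    · rintro ⟨i, hi, hu⟩
      obtain ⟨hi, hu⟩ := mem_times.1 hu
      exact ⟨⟨i, hi⟩, Finset.mem_univ _, hu⟩
  obtain ⟨hint, hleft⟩ := integral_rpow_numCoal P ψ (pairwise_pref pairwise_times hTT N) hU hρ hρ1
    zero_le_one
  simp only [one_mul, mul_one] at hint hleft
  refine ⟨hint, ?_⟩
  have hfac : ∀ j : Fin N, gen P (ex (-Real.log ρ * r)) (L j) ∅ =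
      ENNReal.ofReal (∫ ω, ρ ^ (-(r * (numCoal ψ (S j) ω : ℝ))) ∂(law P)) := fun j =>
    (integral_rpow_numCoal P ψ (pairwise_times (S := S) j)
      (fun u => by rw [times_fin, Finset.mem_sort]) hρ hρ1 (by linarith)).2.symm
  have hnn : ∀ j : Fin N, 0 ≤ ∫ ω, ρ ^ (-(r * (numCoal ψ (S j) ω : ℝ))) ∂(law P) := fun j =>
    integral_nonneg fun ω => Real.rpow_nonneg hρ.le _
  rw [← ENNReal.ofReal_le_ofReal_iff (mul_nonneg (Real.exp_nonneg _)
    (Real.rpow_nonneg (Finset.prod_nonneg fun j _ => hnn j) _)), hleft, map_pref,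
    ENNReal.ofReal_mul (Real.exp_nonneg _), ← ENNReal.ofReal_rpow_of_nonneg
    (Finset.prod_nonneg fun j _ => hnn j) (by positivity),
    ENNReal.ofReal_prod_of_nonneg fun j _ => hnn j]
  refine key.trans (le_of_eq ?_)
  rw [ENNReal.prod_rpow_of_nonneg (by positivity), Finset.prod_range
    (fun j => gen P (ex (-Real.log ρ * r)) (L j) ∅), ex]
  simp_rw [hfac]
  congr 3
  have e1 : Real.exp (-Real.log ρ) = 1 / ρ := by rw [Real.exp_neg, Real.exp_log hρ, one_div]
  have e2 : Real.exp (-Real.log ρ * r') = ρ ^ (-r') := by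
    rw [Real.rpow_def_of_pos hρ]; congr 1; ring
  rw [e1, e2, Finset.sum_range, sum_range_eq_sum_fin (fun j => ((S j).card : ℝ)) (fun i j =>
    ((S i).card : ℝ) * ((S j).card : ℝ) / blockDist (S i) (S j) ^ (1 + ε)) _
    (fun i j => ((L i).length : ℝ) / D i j ^ (1 + ε)) hlen]
  · simp_rw [hlen, mul_one_div]
  · intro i j
    simp only [hlen, hDdef, dif_pos (And.intro i.2 j.2), Fin.eta]
    ring
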